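/- Let $n\ge 1$ and let $s_1,s_2=q$ be non-zero complex numbers such that $s_1^as_2^b=1$ with $a,b\in\mathbb Z$ only for $a=b=0$; put $s_3=(s_1s_2)^{-1}$, $t_i=s_i-s_i^{-1}$. Fix logarithms $\ell_1,\ell_2$ of $s_1,s_2$ and put $\gamma=\ell_1/(\ell_1+\ell_2)$, so that $s_1=s_3^{-\gamma}$, $s_2=s_3^{-(1-\gamma)}$; a multiplication of $z$ by $s_1^as_2^b$ in a power of $z$ uses the logarithm $a\ell_1+b\ell_2$. **Bosons.** Let $I=\{n,\dots,2,1,\bar 1\}$, with $1,\bar 1$ fermionic and the other colors bosonic, and let $C=(c_{ij})$ be the deformed Cartan matrix of type $\mathfrak{osp}(2|2n)$: $c_{ii}=q+q^{-1}$ for $i\ne 1,\bar 1$; $c_{11}=c_{\bar1\bar1}=t_3$; $c_{1\bar1}=c_{\bar11}=qs_1^{-1}-s_1q^{-1}$; $c_{i,i+1}=c_{i+1,i}=-1$ for $2\le i\le n-1$; $c_{21}=c_{2\bar1}=-1$, $c_{12}=c_{\bar12}=t_1$; other entries $0$. Put $d_i=-t_1t_3$ for $i\neq 1,\bar 1$,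 $d_1=d_{\bar1}=t_3$, $B=(d_ic_{ij})$, and $K=\lim_{s_3\to1}t_3^{-2}B$ (with $\gamma$ fixed), i.e. $K_{ii}=2\gamma$ $(i\ne1,\bar1)$, $K_{11}=K_{\bar1\bar1}=1$, $K_{i,i\pm1}=K_{2\bar1}=K_{\bar12}=-\gamma$, $K_{1\bar1}=K_{\bar11}=2\gamma-1$, other entries $0$. For a function $f(s_1,s_2)$ write $f^{[r]}=f(s_1^r,s_2^r)$. Consider the Heisenberg algebra with generators $\mathsf s_{i,r},Q_{\mathsf s_i}$ $(i\in I,r\in\mathbb Z)$ and $$[\mathsf s_{i,r},\mathsf s_{j,r'}]=-\tfrac1r\delta_{r+r',0}(t_3^{[r]})^{-2}B^{[r]}_{ij}\ (r,r'\ne0),\qquad [\mathsf s_{i,0},Q_{\mathsf s_j}]=K_{ij},$$ all other commutators being $0$. Put $\mathsf x_{i,r}=(t_3^{[r]})^2\sum_k((B^{[r]})^{-1})_{ik}\mathsf s_{k,r}$ for $r\ne0$, $\mathsf x_{i,0}=\sum_k(K^{-1})_{ik}\mathsf s_{k,0}$, $Q_{\mathsf x_i}=\sum_k(K^{-1})_{ik}Q_{\mathsf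 s_k}$, $$X_i(z)=e^{Q_{\mathsf x_i}}z^{\mathsf x_{i,0}}:\exp\Bigl(\sum_{r\ne0}\mathsf x_{i,r}z^{-r}\Bigr):,$$ $Y_i(z)=:X_i(s_1z)/X_i(s_1^{-1}z):$ for bosonic $i$, and $Y_i(z)=:1/X_i(z):$ for $i=1,\bar1$. For a Laurent monomial $m=\prod Y_{i,\sigma}^{m_{i,\sigma}}$ put $m(z)=:\prod Y_i(\sigma z)^{m_{i,\sigma}}:$. Write $\boldsymbol i_\sigma=Y_{i,\sigma}$, $\boldsymbol i^\sigma=Y_{i,\sigma}^{-1}$, multiple indices denoting products; factors of color $i>n$ are read as $1$. **Currents.** Let $M_i=(\boldsymbol{i+1})^{q^{n-i+1}}\boldsymbol i_{q^{n-i}}$ and $M_{\bar i}=\boldsymbol i^{q^{n+i}}(\boldsymbol{i+1})_{q^{n+i-1}}$ for $2\le i\le n$, $M_1=\boldsymbol2^{q^n}\boldsymbol1^{q^{n-1}s_1}_{q^{n-1}s_1^{-1}}\bar{\boldsymbol1}^{q^{n-1}s_1}_{q^{n-1}s_1^{-1}}$, $M_0=\boldsymbol1^{q^{n-1}s_1}_{q^{n+1}s_1}\bar{\boldsymbol1}^{q^{n+1}s_1^{-1}}_{q^{n-1}s_1^{-1}}$,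 $M_{\bar0}=\bar{\boldsymbol1}^{q^{n-1}s_1}_{q^{n+1}s_1}\boldsymbol1^{q^{n+1}s_1^{-1}}_{q^{n-1}s_1^{-1}}$, $M_{\bar1}=\boldsymbol1^{q^{n+1}s_1^{-1}}_{q^{n+1}s_1}\bar{\boldsymbol1}^{q^{n+1}s_1^{-1}}_{q^{n+1}s_1}\boldsymbol2_{q^n}$, and $$V_\chi(z)=\sum_{i=1}^nq^{2i-1}s_1M_i(z)+\frac{s_1-s_1^{-1}}{q-q^{-1}}\bigl(M_0(z)+M_{\bar0}(z)\bigr)+\sum_{i=1}^nq^{-2i+1}s_1^{-1}M_{\bar i}(z).$$ For $\nu=(\nu_n,\dots,\nu_1)\in\{0,1\}^n$ put $$\tilde\xi_\nu=\prod_{i=2}^nY_{i,\,q^{i+2\sum_{j>i}\nu_j+\nu_i-\nu_{i-1}}s_1}^{-\nu_i+\nu_{i-1}}\cdot Y_{1,\,q^{2\sum_j\nu_j}s_1^{2\nu_1}}\cdot Y^{-1}_{\bar1,\,q^{2\sum_j\nu_j}s_1^{2-2\nu_1}},\qquad c_\nu=(-1)^{\sum_i\nu_i}q^{n(n-1)/2-2\sum_i(i-1)\nu_i},$$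 let $\tilde\eta_\nu$ be obtained from $\tilde\xi_\nu$ by $1\leftrightarrow\bar1$, and put $V_\xi(z)=\sum_\nu c_\nu\tilde\xi_\nu(z)$, $V_\eta(z)=\sum_\nu c_\nu\tilde\eta_\nu(z)$. **Rationalization.** Take any finite family of auxiliary bosons (generators of a further Heisenberg algebra) commuting with all $\mathsf s_{i,r},Q_{\mathsf s_i}$, and any vertex operators $\Lambda'(z),\bar\Lambda'(z),W'(z)$ in them such that, for $$\Lambda(z)=:\Lambda'(z)\frac{Y_1(z)}{Y_{\bar1}(s_1^2z)}:,\qquad \bar\Lambda(z)=:\bar\Lambda'(z)\frac{Y_{\bar1}(z)}{Y_1(s_1^2z)}:,\qquad T_n(z)=:W'(z)M_n(z):,$$ the contractions (the factor $\langle V_1(z)V_2(w)\rangle$ in $V_1(z)V_2(w)=\langle V_1(z)V_2(w)\rangle:V_1(z)V_2(w):$, expanded in powers of $w/z$) are $$\langle\Lambda(z)\Lambda(w)\rangle=\frac{z-w}{z-s_3^2w},\quad\langle\bar\Lambda(z)\bar\Lambda(w)\rangle=\frac{z-w}{z-s_3^{-2}w},\quad\langle\Lambda(z)\bar\Lambda(w)\rangle=\langle\bar\Lambda(z)\Lambda(w)\rangle=1,$$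 $$\langle T_n(z)\Lambda(w)\rangle=\langle\Lambda(z)T_n(w)\rangle=\langle T_n(z)\bar\Lambda(w)\rangle=\langle\bar\Lambda(z)T_n(w)\rangle=1.$$ Put $T(z)=:W'(z)V_\chi(z):$, $E(z)=:\Lambda'(z)V_\xi(z):$, $F(z)=:\bar\Lambda'(z)V_\eta(z):$. They act on the Fock module with arbitrary highest weight (the direct sum of the polynomial Fock spaces over all momenta $e^{\sum_ju_jQ_j}$, $u_j\in\mathbb C$), on which $W'(z)$, hence $T(z)$, is assumed to involve integral powers of $z$ only. **Theorem.** With $\delta(x)=\sum_{k\in\mathbb Z}x^k$ and $a=(s_1-s_1^{-1})(s_3-s_3^{-1})/(q-q^{-1})$ we have, as formal series in $z,w$ whose coefficients are operators on the Fock module, $$[T(z),E(w)]=-aqs_1\,\delta\Bigl(\frac{q^{n+1}s_1w}{z}\Bigr):W'(q^{n+1}s_1w)\frac{\Lambda'(w)}{\Lambda'(q^2w)}E(q^2w):+as_3\,\delta\Bigl(\frac{q^{-n-1}s_1w}{z}\Bigr):W'(q^{-n-1}s_1w)\frac{\Lambda'(w)}{\Lambda'(q^{-2}w)}E(q^{-2}w):,$$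 $$[T(z),F(w)]=-aqs_1\,\delta\Bigl(\frac{q^{n+1}s_1w}{z}\Bigr):W'(q^{n+1}s_1w)\frac{\bar\Lambda'(w)}{\bar\Lambda'(q^2w)}F(q^2w):+as_3\,\delta\Bigl(\frac{q^{-n-1}s_1w}{z}\Bigr):W'(q^{-n-1}s_1w)\frac{\bar\Lambda'(w)}{\bar\Lambda'(q^{-2}w)}F(q^{-2}w):.$$ -/

import Mathlib

open scoped BigOperators

noncomputable section

namespace Osp

/-! ### Free fields: Heisenberg algebras, Fock modules, vertex operators -/

/-- The commutators of a Heisenberg algebra with generators `a_{j,r}`, `Q_j` (`j ∈ J`, `r ∈ ℤ`):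
`[a_{j,r}, a_{k,-r}] = comm r j k` for `r > 0`, `[a_{j,0}, Q_k] = zero j k`, and all commutators
which do not follow from these vanish. (The value `comm 0` is never used.) -/
structure Heisenberg (J : Type*) where
  comm : ℕ → Matrix J J ℂ
  zero : Matrix J J ℂ

/-- The Heisenberg algebra generated by two mutually commuting Heisenberg algebras. -/
def Heisenberg.prod {J J' : Type*} (H : Heisenberg J) (H' : Heisenberg J') :
    Heisenberg (J ⊕ J') where
  comm r := Matrix.fromBlocks (H.comm r) 0 0 (H'.comm r)
  zero := Matrix.fromBlocks H.zero 0 0 H'.zero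

/-- The vertex operator with data `V = (u, p, c)` is
`V(z) = e^{∑ u_j Q_j} z^{∑ p_j a_{j,0}} e^{∑ c_{0,j} a_{j,0}} :exp (∑_{r ≠ 0} ∑_j c_{r,j} a_{j,r} z^{-r}):`.
Addition of data is the normally ordered product of vertex operators. -/
abbrev Vertex (J : Type*) := (J → ℂ) × (J → ℂ) × (ℤ → J → ℂ)

namespace Vertex

variable {J : Type*}

/-- The coefficients `u_j` of `Q_j`. -/
def charge (V : Vertex J) : J → ℂ := V.1

/-- The coefficients `p_j` of `log z · a_{j,0}`. -/
def power (V : Vertex J) : J → ℂ := V.2.1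

/-- The coefficients `c_{r,j}` of `z^{-r} a_{j,r}`. -/
def modes (V : Vertex J) : ℤ → J → ℂ := V.2.2

/-- The vertex operator `V(e^ℓ z)`. The logarithm `ℓ` of the multiplier fixes the branch of
`(e^ℓ z)^{a_{j,0}} = e^{ℓ a_{j,0}} z^{a_{j,0}}`. -/
def shift (l : ℂ) (V : Vertex J) : Vertex J :=
  (V.charge, V.power,
    fun r j => Complex.exp (-(r : ℂ) * l) * V.modes r j + if r = 0 then l * V.power j else 0)

/-- A vertex operator of the first factor, in a product of two Heisenberg algebras. -/
def inl {J' : Type*} (V : Vertex J) : Vertex (J ⊕ J') :=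
  (Sum.elim V.charge 0, Sum.elim V.power 0, fun r => Sum.elim (V.modes r) 0)

/-- A vertex operator of the second factor, in a product of two Heisenberg algebras. -/
def inr {J' : Type*} (V : Vertex J') : Vertex (J ⊕ J') :=
  (Sum.elim 0 V.charge, Sum.elim 0 V.power, fun r => Sum.elim 0 (V.modes r))

end Vertex

/-- The power series `exp (∑_{r ≥ 1} f_r X^r)`. -/
def expSeries {A : Type*} [CommRing A] [Algebra ℚ A] (f : ℕ → A) : PowerSeries A :=
  (PowerSeries.exp A).subst (PowerSeries.mk fun r => if r = 0 then 0 else f r)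

section Fock

variable {J : Type*} [Fintype J]

/-- The polynomial ring in the creation operators `a_{j,-r}`, `r > 0`. -/
abbrev Osc (J : Type*) := MvPolynomial (J × ℕ+) ℂ

/-- The Fock module `⨁_u ℂ[a_{j,-r}] e^{∑ u_j Q_j} |α⟩` (sum over all `u : J → ℂ`), where `|α⟩` is
annihilated by all `a_{j,r}`, `r > 0`, and `a_{j,0} |α⟩ = α_j |α⟩`. -/
abbrev Fock (J : Type*) := (J → ℂ) →₀ Osc J

/-- The eigenvalue of `a_{j,0}` on the sector `u` of the Fock module with highest weight `α`. -/
def weight (H : Heisenberg J) (α u : J → ℂ) (j : J) : ℂ := α j + ∑ k, H.zero j k * u k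

/-- The exponent of `z` in `z^{∑ p_j a_{j,0}}` acting on the sector `u`. -/
def zExponent (H : Heisenberg J) (α : J → ℂ) (V : Vertex J) (u : J → ℂ) : ℂ :=
  ∑ j, V.power j * weight H α u j

/-- The creation part `exp (∑_{r>0} ∑_j c_{-r,j} a_{j,-r} z^r)` as a power series in `z`. -/
def creation (V : Vertex J) : PowerSeries (Osc J) :=
  expSeries fun r =>
    if h : 0 < r then
      ∑ j, MvPolynomial.C (V.modes (-(r : ℤ)) j) * (MvPolynomial.X (j, ⟨r, h⟩) : Osc J)
    else 0

/-- The annihilation part `exp (∑_{r>0} ∑_j c_{r,j} a_{j,r} z^{-r})`, with values in polynomials in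
`z^{-1}`. Since `a_{j,r}` acts on polynomials in the `a_{k,-r}` as the derivation
`∑_k [a_{j,r}, a_{k,-r}] ∂/∂a_{k,-r}`, this exponential is, by Taylor's formula, the substitution
`a_{k,-r} ↦ a_{k,-r} + (∑_j c_{r,j} [a_{j,r}, a_{k,-r}]) z^{-r}`. -/
def annihilation (H : Heisenberg J) (V : Vertex J) : Osc J →ₐ[ℂ] Polynomial (Osc J) :=
  MvPolynomial.aeval fun kr : J × ℕ+ =>
    Polynomial.C (MvPolynomial.X kr) +
      Polynomial.C (MvPolynomial.C
        (∑ j, V.modes ((kr.2 : ℕ) : ℤ) j * H.comm kr.2 j kr.1)) * Polynomial.X ^ (kr.2 : ℕ)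

/-- The coefficient of `z^d` in the oscillator part (creation part times annihilation part)
`:exp (∑_{r ≠ 0} ∑_j c_{r,j} a_{j,r} z^{-r}):`. -/
def oscCoeff (H : Heisenberg J) (V : Vertex J) (d : ℤ) : Osc J →ₗ[ℂ] Osc J :=
  (Polynomial.lsum fun l : ℕ => LinearMap.mulLeft ℂ
      (if 0 ≤ d + l then PowerSeries.coeff (d + l).toNat (creation V) else 0)).comp
    (annihilation H V).toLinearMap

/-- Formal series `∑_κ X_κ z^κ` with complex exponents `κ` and coefficients acting on the Fock
module. -/
abbrev Field (J : Type*) := ℂ → Module.End ℂ (Fock J)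

open Classical in
/-- The vertex operator `V(z)` acting on the Fock module with highest weight `α`: its coefficient
of `z^κ`. On the sector `u` only exponents `κ ∈ zExponent + ℤ` occur. -/
def vertexField (H : Heisenberg J) (α : J → ℂ) (V : Vertex J) : Field J := fun κ =>
  Finsupp.lsum ℂ fun u : J → ℂ =>
    if (⌊(κ - zExponent H α V u).re⌋ : ℂ) = κ - zExponent H α V u then
      Complex.exp (∑ j, V.modes 0 j * weight H α u j) •
        (Finsupp.lsingle (u + V.charge)).comp (oscCoeff H V ⌊(κ - zExponent H α V u).re⌋)
    else 0

/-- Finite linear combinations of vertex operators. -/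
abbrev Current (J : Type*) := Vertex J →₀ ℂ

/-- The current `X(z) = ∑ x_V V(z)` acting on the Fock module with highest weight `α`. -/
def Current.field (H : Heisenberg J) (α : J → ℂ) (X : Current J) : Field J := fun κ =>
  X.sum fun V x => x • vertexField H α V κ

/-- The current `X(e^ℓ z)`. -/
def Current.shift (l : ℂ) (X : Current J) : Current J := Finsupp.mapDomain (Vertex.shift l) X

/-- The normally ordered product `:V(z) X(z):` of a vertex operator and a current. -/
def Current.normalMul (V : Vertex J) (X : Current J) : Current J :=
  Finsupp.mapDomain (fun U => V + U) X

/-- The commutator `[X(z), Y(w)]`: the coefficient of `z^κ w^κ'`. -/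
def commutator (X Y : Field J) : ℂ → ℂ → Module.End ℂ (Fock J) := fun κ κ' =>
  X κ * Y κ' - Y κ' * X κ

open Classical in
/-- `δ(e^ℓ w/z) G(w)`, where `δ(x) = ∑_{k ∈ ℤ} x^k`: the coefficient of `z^κ w^κ'`. The
coefficient of `z^{-k} w^κ'` is `e^{kℓ} G_{κ' - k}`. -/
def deltaTimes (l : ℂ) (G : Field J) : ℂ → ℂ → Module.End ℂ (Fock J) := fun κ κ' =>
  if ∃ k : ℤ, κ = -(k : ℂ) then Complex.exp (-κ * l) • G (κ' + κ) else 0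

/-- The contraction of `V(z)` and `W(w)`, defined by
`V(z) W(w) = (contraction) :V(z) W(w):`, is
`z^{∑ p_j zero_{jk} u_k} e^{∑ c_{0,j} zero_{jk} u_k} exp (∑_{r>0} ∑ c_{r,j} comm_{r,jk} c'_{-r,k} (w/z)^r)`.
`HasContraction H V W f g` says that it is the expansion in powers of `w/z` of the
function `f(w/z)/g(w/z)`; in particular it contains the power `z^0` only. -/
def HasContraction (H : Heisenberg J) (V W : Vertex J) (f g : PowerSeries ℂ) : Prop :=
  ∑ j, ∑ k, V.power j * H.zero j k * W.charge k = 0 ∧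
  g * (PowerSeries.C (Complex.exp (∑ j, ∑ k, V.modes 0 j * H.zero j k * W.charge k)) *
      expSeries fun r =>
        ∑ j, ∑ k, V.modes (r : ℤ) j * H.comm r j k * W.modes (-(r : ℤ)) k) = f

end Fock

/-! ### The bosons attached to the deformed Cartan matrix of type `osp(2|2n)` -/

/-- The parameters `s₁ = e^{ℓ₁}`, `q = s₂ = e^{ℓ₂}`, which are multiplicatively independent. -/
structure Params where
  l₁ : ℂ
  l₂ : ℂ
  generic : ∀ a b : ℤ, Complex.exp (a * l₁ + b * l₂) = 1 → a = 0 ∧ b = 0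

namespace Params

variable (P : Params)

def s₁ : ℂ := Complex.exp P.l₁

def q : ℂ := Complex.exp P.l₂

def s₃ : ℂ := (P.s₁ * P.q)⁻¹

/-- The number `γ` with `ℓ₁ = -γ ℓ₃`, `ℓ₂ = -(1 - γ) ℓ₃`, where `ℓ₃ = -(ℓ₁ + ℓ₂)`. -/
def γ : ℂ := P.l₁ / (P.l₁ + P.l₂)

/-- The constant `a = (s₁ - s₁⁻¹)(s₃ - s₃⁻¹)/(q - q⁻¹)`. -/
def a : ℂ := (P.s₁ - P.s₁⁻¹) * (P.s₃ - P.s₃⁻¹) / (P.q - P.q⁻¹)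

end Params

/-- Colors: `i = 1, …, n` stands for the color `i`, and `0` stands for the color `\bar 1`. The
fermionic colors are `0` and `1`. -/
abbrev Color (n : ℕ) := Fin (n + 1)

/-- `t₃ = s₃ - s₃⁻¹` as a function of `x = s₁`, `y = q`. -/
def t₃ (x y : ℂ) : ℂ := (x * y)⁻¹ - x * y

/-- The deformed Cartan matrix of type `osp(2|2n)` as a function of `x = s₁`, `y = q`. -/
def cartan (n : ℕ) (x y : ℂ) : Matrix (Color n) (Color n) ℂ := fun i j =>
  if (i : ℕ) ≤ 1 ∧ (j : ℕ) ≤ 1 then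
    if i = j then t₃ x y else y * x⁻¹ - x * y⁻¹
  else if i = j then y + y⁻¹
  else if (i : ℕ) ≤ 1 ∧ (j : ℕ) = 2 then x - x⁻¹
  else if (i : ℕ) = 2 ∧ (j : ℕ) ≤ 1 then -1
  else if (i : ℕ) + 1 = j ∨ (j : ℕ) + 1 = i then -1
  else 0

/-- The symmetrized matrix `B = D C`, with `d_i = t₃` for fermionic `i` and `d_i = -t₁ t₃` for
bosonic `i`. -/
def symCartan (n : ℕ) (x y : ℂ) : Matrix (Color n) (Color n) ℂ := fun i j =>
  (if (i : ℕ) ≤ 1 then t₃ x y else -((x - x⁻¹) * t₃ x y)) * cartan n x y i j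

/-- The matrix `K`, the limit of `t₃^{-2} B` as `s₃ → 1` with `s₁ = s₃^{-γ}`,
`q = s₃^{-(1-γ)}`. -/
def zeroCartan (n : ℕ) (γ : ℂ) : Matrix (Color n) (Color n) ℂ := fun i j =>
  if (i : ℕ) ≤ 1 ∧ (j : ℕ) ≤ 1 then
    if i = j then 1 else 2 * γ - 1
  else if i = j then 2 * γ
  else if ((i : ℕ) ≤ 1 ∧ (j : ℕ) = 2) ∨ ((i : ℕ) = 2 ∧ (j : ℕ) ≤ 1) then -γ
  else if (i : ℕ) + 1 = j ∨ (j : ℕ) + 1 = i then -γ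
  else 0

section Bosons

variable (P : Params) (n : ℕ)

/-- `t₃^{[r]}`. -/
def t₃Pow (r : ℤ) : ℂ := t₃ (P.s₁ ^ r) (P.q ^ r)

/-- `B^{[r]}`. -/
def symCartanPow (r : ℤ) : Matrix (Color n) (Color n) ℂ := symCartan n (P.s₁ ^ r) (P.q ^ r)

/-- The Heisenberg algebra with generators `s_{i,r}`, `Q_{s_i}`:
`[s_{i,r}, s_{j,-r}] = -(1/r) (t₃^{[r]})^{-2} B^{[r]}_{ij}`, `[s_{i,0}, Q_{s_j}] = K_{ij}`. -/
def screeningAlgebra : Heisenberg (Color n) where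
  comm r := fun i j => -(1 / (r : ℂ)) * (t₃Pow P r ^ 2)⁻¹ * symCartanPow P n r i j
  zero := zeroCartan n P.γ

/-- `X_i(z) = e^{Q_{x_i}} z^{x_{i,0}} :exp (∑_{r ≠ 0} x_{i,r} z^{-r}):`, where
`x_{i,r} = (t₃^{[r]})² ∑_k ((B^{[r]})⁻¹)_{ik} s_{k,r}` for `r ≠ 0`,
`x_{i,0} = ∑_k (K⁻¹)_{ik} s_{k,0}` and `Q_{x_i} = ∑_k (K⁻¹)_{ik} Q_{s_k}`. -/
def X (i : Color n) : Vertex (Color n) :=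
  ((zeroCartan n P.γ)⁻¹ i, (zeroCartan n P.γ)⁻¹ i,
    fun r k => if r = 0 then 0 else t₃Pow P r ^ 2 * (symCartanPow P n r)⁻¹ i k)

/-- The `Y` currents: `:X_i(s₁ z)/X_i(s₁⁻¹ z):` for bosonic `i` and `:1/X_i(z):` for
fermionic `i`. -/
def Y (i : Color n) : Vertex (Color n) :=
  if (i : ℕ) ≤ 1 then -X P n i
  else (X P n i).shift P.l₁ - (X P n i).shift (-P.l₁)

end Bosons

/-! ### The `qq`-characters -/

/-- Laurent monomials in the variables `Y_{i,σ}`, `σ = s₁^a q^b`, written additively: the exponent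
of `Y_{i, s₁^a q^b}` is the value at `(i, a, b)`. -/
abbrev Mono (n : ℕ) := (Color n × ℤ × ℤ) →₀ ℤ

/-- The variable `Y_{i,σ}`, `σ = s₁^a q^b`; by convention it is `1` if `i > n`. -/
def var (n i : ℕ) (a b : ℤ) : Mono n :=
  if h : i < n + 1 then Finsupp.single (⟨i, h⟩, a, b) 1 else 0

/-- The vertex operator `m(z) = :∏ Y_i(σ z)^{m_{i,σ}}:`. -/
def bosonize (P : Params) (n : ℕ) (m : Mono n) : Vertex (Color n) :=
  m.sum fun k e => e • (Y P n k.1).shift (k.2.1 * P.l₁ + k.2.2 * P.l₂)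

/-- The monomial `M_i`, `1 ≤ i ≤ n`, of `χ_{1,1}`. -/
def boxMono (n i : ℕ) : Mono n :=
  if i = 1 then
    -var n 2 0 n - var n 1 1 (n - 1) + var n 1 (-1) (n - 1)
      - var n 0 1 (n - 1) + var n 0 (-1) (n - 1)
  else -var n (i + 1) 0 (n - i + 1) + var n i 0 (n - i)

/-- The monomials `M_0` (for `(c, c') = (1, 0)`) and `M_{\bar 0}` (for `(c, c') = (0, 1)`)
of `χ_{1,1}`. -/
def boxMonoMid (n c c' : ℕ) : Mono n :=
  -var n c 1 (n - 1) + var n c 1 (n + 1) - var n c' (-1) (n + 1) + var n c' (-1) (n - 1)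

/-- The monomial `M_{\bar i}`, `1 ≤ i ≤ n`, of `χ_{1,1}`. -/
def boxMonoBar (n i : ℕ) : Mono n :=
  if i = 1 then
    -var n 1 (-1) (n + 1) + var n 1 1 (n + 1) - var n 0 (-1) (n + 1) + var n 0 1 (n + 1)
      + var n 2 0 n
  else -var n i 0 (n + i) + var n (i + 1) 0 (n + i - 1)

/-- The entry `ν_i ∈ {0,1}` of the sequence `ν ∈ {0,1}^n` with `{i | ν_i = 1} = S`. -/
def bit (S : Finset ℕ) (i : ℕ) : ℤ := if i ∈ S then 1 else 0

/-- The monomial `\tilde ξ_ν` of `ξ_1` (for `(c, c') = (1, 0)`), and its image under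
`1 ↔ \bar 1`, a monomial of `η_1` (for `(c, c') = (0, 1)`); here `ν ∈ {0,1}^n` is the indicator
function of `S ⊆ {1, …, n}`. -/
def xiMono (n c c' : ℕ) (S : Finset ℕ) : Mono n :=
  ∑ i ∈ Finset.Icc 2 n, (-bit S i + bit S (i - 1)) •
      var n i 1 (i + 2 * ∑ j ∈ Finset.Icc (i + 1) n, bit S j + bit S i - bit S (i - 1))
    + var n c (2 * bit S 1) (2 * ∑ j ∈ Finset.Icc 1 n, bit S j)
    - var n c' (2 - 2 * bit S 1) (2 * ∑ j ∈ Finset.Icc 1 n, bit S j)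

/-- The coefficient `c^ξ_ν = (-1)^{∑ ν_i} q^{n(n-1)/2 - 2 ∑ (i-1) ν_i}`. -/
def xiCoeff (P : Params) (n : ℕ) (S : Finset ℕ) : ℂ :=
  (-1) ^ (∑ i ∈ Finset.Icc 1 n, bit S i) *
    P.q ^ ((n : ℤ) * (n - 1) / 2 - 2 * ∑ i ∈ Finset.Icc 1 n, ((i : ℤ) - 1) * bit S i)

/-- The bosonization `V_χ(z)` of `χ_{1,1}`. -/
def chiCurrent (P : Params) (n : ℕ) : Current (Color n) :=
  ∑ i ∈ Finset.Icc 1 n,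
      Finsupp.single (bosonize P n (boxMono n i)) (P.q ^ (2 * (i : ℤ) - 1) * P.s₁)
    + Finsupp.single (bosonize P n (boxMonoMid n 1 0)) ((P.s₁ - P.s₁⁻¹) / (P.q - P.q⁻¹))
    + Finsupp.single (bosonize P n (boxMonoMid n 0 1)) ((P.s₁ - P.s₁⁻¹) / (P.q - P.q⁻¹))
    + ∑ i ∈ Finset.Icc 1 n,
      Finsupp.single (bosonize P n (boxMonoBar n i)) (P.q ^ (-2 * (i : ℤ) + 1) * P.s₁⁻¹)

/-- The bosonization `V_ξ(z)` of `ξ_1` (for `(c, c') = (1, 0)`), and the bosonization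
`V_η(z)` of `η_1` (for `(c, c') = (0, 1)`). -/
def xiCurrent (P : Params) (n c c' : ℕ) : Current (Color n) :=
  ∑ S ∈ (Finset.Icc 1 n).powerset,
    Finsupp.single (bosonize P n (xiMono n c c' S)) (xiCoeff P n S)

/-! ### Rationalization -/

/-- Auxiliary bosons commuting with the bosons `s_i`, and vertex operators `Λ'(z)`, `\bar Λ'(z)`,
`W'(z)` in them. -/
structure Auxiliary (A : Type*) where
  alg : Heisenberg A
  Lam : Vertex A
  LamBar : Vertex A
  W : Vertex A

section Rationalization

variable {A : Type*} [Fintype A] (P : Params) (n : ℕ) (R : Auxiliary A)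

/-- All bosons: the `s_i` together with the auxiliary ones. -/
def algebra : Heisenberg (Color n ⊕ A) := (screeningAlgebra P n).prod R.alg

/-- The current `:U(z) X(z):`, for `U` in the auxiliary bosons and `X` in the bosons `s_i`. -/
def dress (U : Vertex A) (X : Current (Color n)) : Current (Color n ⊕ A) :=
  Current.normalMul U.inr (Finsupp.mapDomain Vertex.inl X)

/-- `Λ(z) = :Λ'(z) Y_1(z) / Y_{\bar 1}(s₁² z):`. -/
def Λ : Vertex (Color n ⊕ A) :=
  R.Lam.inr + (bosonize P n (var n 1 0 0 - var n 0 2 0)).inl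

/-- `\bar Λ(z) = :\bar Λ'(z) Y_{\bar 1}(z) / Y_1(s₁² z):`. -/
def ΛBar : Vertex (Color n ⊕ A) :=
  R.LamBar.inr + (bosonize P n (var n 0 0 0 - var n 1 2 0)).inl

/-- `T_n(z) = :W'(z) M_n(z):`. -/
def topT : Vertex (Color n ⊕ A) := R.W.inr + (bosonize P n (boxMono n n)).inl

/-- `T(z) = :W'(z) V_{χ_{1,1}}(z):`. -/
def T : Current (Color n ⊕ A) := dress n R.W (chiCurrent P n)

/-- `E(z) = :Λ'(z) V_ξ(z):`. -/
def E : Current (Color n ⊕ A) := dress n R.Lam (xiCurrent P n 1 0)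

/-- `F(z) = :\bar Λ'(z) V_η(z):`. -/
def F : Current (Color n ⊕ A) := dress n R.LamBar (xiCurrent P n 0 1)

/-- The conditions which the auxiliary vertex operators have to satisfy: the contractions
`Λ(z)Λ(w) : (z-w)/(z-s₃²w)`, `\bar Λ(z)\bar Λ(w) : (z-w)/(z-s₃⁻²w)`,
`Λ(z)\bar Λ(w) : 1`, `\bar Λ(z)Λ(w) : 1`, and `T_n` has contraction `1` with `Λ` and `\bar Λ`
in both orders. -/
structure IsRationalization : Prop where
  lam_lam : HasContraction (algebra P n R) (Λ P n R) (Λ P n R)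
    (1 - PowerSeries.X) (1 - PowerSeries.C (P.s₃ ^ 2) * PowerSeries.X)
  lamBar_lamBar : HasContraction (algebra P n R) (ΛBar P n R) (ΛBar P n R)
    (1 - PowerSeries.X) (1 - PowerSeries.C (P.s₃⁻¹ ^ 2) * PowerSeries.X)
  lam_lamBar : HasContraction (algebra P n R) (Λ P n R) (ΛBar P n R) 1 1
  lamBar_lam : HasContraction (algebra P n R) (ΛBar P n R) (Λ P n R) 1 1
  top_lam : HasContraction (algebra P n R) (topT P n R) (Λ P n R) 1 1
  top_lamBar : HasContraction (algebra P n R) (topT P n R) (ΛBar P n R) 1 1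
  lam_top : HasContraction (algebra P n R) (Λ P n R) (topT P n R) 1 1
  lamBar_top : HasContraction (algebra P n R) (ΛBar P n R) (topT P n R) 1 1

/-- The current `:W'(e^m w) U(w)/U(e^l w) X(e^l w):`. -/
def shifted (m l : ℂ) (U : Vertex A) (X : Current (Color n ⊕ A)) : Current (Color n ⊕ A) :=
  Current.normalMul ((R.W.shift m).inr + U.inr - (U.shift l).inr) (X.shift l)

end Rationalization

end Osp

end

noncomputable section

namespace Osp

/-! ### Exponentials of power series -/

section ExpSeries

variable {A : Type*} [CommRing A] [Algebra ℚ A]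

/-! `T`, `E` and `F` are finite sums of vertex operators, so each commutator is a sum over pairs of
terms. For one pair, Wick's theorem writes V(z)W(w) as φ(w/z) :V(z)W(w):, while W(w)V(z) is the
opposite expansion of the same rational function φ times the same normally ordered product. The two
expansions differ by delta functions at the poles of φ (`oscCoeff_commutator`,
`commutator_vertexField`).

The functions φ are found without inverting B. The monomials of V_χ form a chain M_n, …, M_1, then
M_0 and M_{\bar 0}, then M_{\bar 1}, …, M_{\bar n}, whose neighbours differ by an affine root. The
mode vector of a root is a multiple of a row of B^{[r]}, so pairing a root with a monomial reads off
the exponents of one color (`monoPairing_rootBos`, `monoPairing_rootFer`). The start of the chain is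
fixed by the assumption that T_n has contraction 1 with Λ and \bar Λ. The outcome: M_i has
contraction 1 with the term ν if ν_i = 0, and two poles with coefficients -a and a if ν_i = 1;
M_{\bar i} behaves in the same way with ν_i = 0 and ν_i = 1 exchanged; M_0 and M_{\bar 0} always
have exactly one pole (`relPairing_boxMono`, `relPairing_boxMonoBar`, `relPairing_boxMonoMid_self`,
`relPairing_boxMonoMid_swap`).

The residues telescope. Fix a set S, read as ν. For i ∉ S the product of M_i with the term S ∪ {i}
contributes a multiple of G_i - G_{i+1}; for i ∈ S one has G_i = G_{i+1}; and one middle monomial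
with the term S contributes the same multiple of -G_1. What survives is G_{n+1}, which is the term S
with its argument multiplied by q² (`residueMono_last`). In the same way the products of M_{\bar i}
with the terms S \ {i}, i ∈ S, and the other middle monomial leave the term S at q⁻²
(`residueMonoBar_last`). Summing over S gives the two delta functions of the theorem. -/

theorem hasSubst_mk_of_zero {R : Type*} [CommRing R] (f : ℕ → R) :
    PowerSeries.HasSubst (PowerSeries.mk fun r => if r = 0 then 0 else f r) :=
  PowerSeries.HasSubst.of_constantCoeff_zero' (by
    rw [← PowerSeries.coeff_zero_eq_constantCoeff_apply]; simp [-PowerSeries.coeff_zero_eq_constantCoeff])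

theorem expSeries_congr {f g : ℕ → A} (h : ∀ r, r ≠ 0 → f r = g r) :
    expSeries f = expSeries g := by
  unfold expSeries
  congr 2
  funext r
  by_cases hr : r = 0
  · simp [hr]
  · simp [hr, h r hr]

theorem coeff_zero_expSeries (f : ℕ → A) : PowerSeries.coeff 0 (expSeries f) = 1 := by
  rw [expSeries, PowerSeries.coeff_subst' (hasSubst_mk_of_zero f), finsum_eq_single _ 0]
  · simp
  · intro d hd
    simp [hd]

theorem coeff_succ_expSeries (f : ℕ → A) (n : ℕ) :
    ((n : A) + 1) * PowerSeries.coeff (n + 1) (expSeries f) =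
      ∑ ij ∈ Finset.HasAntidiagonal.antidiagonal n,
        PowerSeries.coeff ij.1 (expSeries f) * (((ij.2 : A) + 1) * f (ij.2 + 1)) := by
  have h : PowerSeries.derivative A (expSeries f) =
      expSeries f * PowerSeries.derivative A (PowerSeries.mk fun r => if r = 0 then 0 else f r) := by
    rw [expSeries, PowerSeries.derivative_subst (hasSubst_mk_of_zero f),
      PowerSeries.derivative_exp]
  have h' := congrArg (PowerSeries.coeff n) h
  rw [PowerSeries.coeff_derivative, PowerSeries.coeff_mul] at h'
  rw [mul_comm, h']
  refine Finset.sum_congr rfl fun ij _ => ?_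
  rw [PowerSeries.coeff_derivative]
  simp [mul_comm]

/-- The recursion is F' = F f' read coefficientwise. As n + 1 is invertible in a ℚ-algebra, it
determines F from its constant term. The rules below for sums, ring maps, rescaling and geometric
series are all checked through it. -/
theorem eq_expSeries {f : ℕ → A} {F : PowerSeries A} (h0 : PowerSeries.coeff 0 F = 1)
    (hF : ∀ n : ℕ, ((n : A) + 1) * PowerSeries.coeff (n + 1) F =
      ∑ ij ∈ Finset.HasAntidiagonal.antidiagonal n,
        PowerSeries.coeff ij.1 F * (((ij.2 : A) + 1) * f (ij.2 + 1))) :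
    F = expSeries f := by
  ext n
  induction n using Nat.strong_induction_on with
  | _ n ih =>
    rcases n with _ | n
    · rw [h0, coeff_zero_expSeries]
    · have key : ((n : A) + 1) * PowerSeries.coeff (n + 1) F =
          ((n : A) + 1) * PowerSeries.coeff (n + 1) (expSeries f) := by
        rw [hF, coeff_succ_expSeries]
        refine Finset.sum_congr rfl fun ij hij => ?_
        rw [ih ij.1 (by have := Finset.HasAntidiagonal.mem_antidiagonal.1 hij; omega)]
      have hu : IsUnit ((n : A) + 1) := by
        have : ((n : A) + 1) = algebraMap ℚ A ((n : ℚ) + 1) := by simp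
        rw [this]
        exact (IsUnit.mk0 _ (by positivity)).map _
      exact hu.mul_left_cancel key

theorem expSeries_add (f g : ℕ → A) :
    expSeries (fun r => f r + g r) = expSeries f * expSeries g := by
  have hadd : (PowerSeries.mk fun r => if r = 0 then 0 else f r + g r) =
      (PowerSeries.mk fun r => if r = 0 then 0 else f r) +
        PowerSeries.mk fun r => if r = 0 then 0 else g r := by
    ext r
    by_cases hr : r = 0 <;> simp [hr]
  have hd (h : ℕ → A) : PowerSeries.derivative A (expSeries h) =
      expSeries h * PowerSeries.derivative A (PowerSeries.mk fun r => if r = 0 then 0 else h r) := by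
    rw [expSeries, PowerSeries.derivative_subst (hasSubst_mk_of_zero h),
      PowerSeries.derivative_exp]
  symm
  apply eq_expSeries
  · rw [PowerSeries.coeff_zero_eq_constantCoeff_apply, map_mul,
      ← PowerSeries.coeff_zero_eq_constantCoeff_apply, ← PowerSeries.coeff_zero_eq_constantCoeff_apply,
      coeff_zero_expSeries, coeff_zero_expSeries, one_mul]
  · intro n
    have h : PowerSeries.derivative A (expSeries f * expSeries g) = (expSeries f * expSeries g) *
        PowerSeries.derivative A (PowerSeries.mk fun r => if r = 0 then 0 else f r + g r) := by
      rw [Derivation.leibniz, hd, hd, hadd, map_add, smul_eq_mul, smul_eq_mul]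
      ring
    have h' := congrArg (PowerSeries.coeff n) h
    rw [PowerSeries.coeff_derivative] at h'
    rw [mul_comm, h', PowerSeries.coeff_mul]
    refine Finset.sum_congr rfl fun ij _ => ?_
    rw [PowerSeries.coeff_derivative]
    simp [mul_comm]

theorem expSeries_zero : expSeries (fun _ => (0 : A)) = 1 := by
  symm
  apply eq_expSeries
  · simp
  · intro n
    simp

theorem map_expSeries {A' : Type*} [CommRing A'] [Algebra ℚ A'] (φ : A →+* A') (f : ℕ → A) :
    PowerSeries.map φ (expSeries f) = expSeries fun r => φ (f r) := by
  apply eq_expSeries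
  · simp [-PowerSeries.coeff_zero_eq_constantCoeff, coeff_zero_expSeries]
  · intro n
    have h := congrArg φ (coeff_succ_expSeries f n)
    simpa [map_sum] using h

theorem rescale_expSeries (a : A) (f : ℕ → A) :
    PowerSeries.rescale a (expSeries f) = expSeries fun r => a ^ r * f r := by
  apply eq_expSeries
  · simp [-PowerSeries.coeff_zero_eq_constantCoeff, coeff_zero_expSeries]
  · intro n
    have h := congrArg (a ^ (n + 1) * ·) (coeff_succ_expSeries f n)
    simp only [Finset.mul_sum] at h
    rw [PowerSeries.coeff_rescale]
    refine Eq.trans (by ring) (h.trans (Finset.sum_congr rfl fun ij hij => ?_))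
    rw [PowerSeries.coeff_rescale, ← Finset.HasAntidiagonal.mem_antidiagonal.1 hij]
    ring

end ExpSeries

/-- This is -log(1 - τX) = ∑ τ^r X^r / r; the meaningless term r = 0 is discarded by `expSeries`.
Hence a pole τ of a contraction shows up as τ^r/r in the logarithm and a zero ε as -ε^r/r. -/
theorem expSeries_geometric (τ : ℂ) :
    expSeries (fun r => τ ^ r / r) = PowerSeries.mk fun n => τ ^ n := by
  symm
  apply eq_expSeries
  · simp
  · intro n
    have h : ∀ ij ∈ Finset.HasAntidiagonal.antidiagonal n,
        τ ^ ij.1 * (((ij.2 : ℂ) + 1) * (τ ^ (ij.2 + 1) / ((ij.2 + 1 : ℕ) : ℂ))) = τ ^ (n + 1) := by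
      intro ij hij
      have hn : ij.1 + ij.2 = n := by simpa using hij
      subst hn
      have : ((ij.2 : ℂ) + 1) ≠ 0 := Nat.cast_add_one_ne_zero ij.2
      push_cast
      field_simp
      ring
    simp only [PowerSeries.coeff_mk]
    rw [Finset.sum_congr rfl h]
    simp

theorem mk_pow_mul (τ : ℂ) :
    (PowerSeries.mk fun n => τ ^ n) * (1 - PowerSeries.C τ * PowerSeries.X) = 1 := by
  ext n
  rw [mul_sub, mul_one, ← mul_assoc, mul_comm _ (PowerSeries.C τ), mul_assoc, map_sub,
    PowerSeries.coeff_C_mul]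
  rcases n with _ | n
  · simp
  · simp [PowerSeries.coeff_succ_mul_X, PowerSeries.coeff_one, pow_succ']

theorem expSeries_neg_geometric (τ : ℂ) :
    expSeries (fun r => -(τ ^ r / r)) = 1 - PowerSeries.C τ * PowerSeries.X := by
  have h : expSeries (fun r => -(τ ^ r / r)) * expSeries (fun r => τ ^ r / r) = 1 := by
    rw [← expSeries_add, ← expSeries_zero]
    simp
  rw [expSeries_geometric] at h
  calc _ = expSeries (fun r => -(τ ^ r / r)) * ((PowerSeries.mk fun n => τ ^ n) *
        (1 - PowerSeries.C τ * PowerSeries.X)) := by rw [mk_pow_mul, mul_one]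
    _ = _ := by rw [← mul_assoc, h, one_mul]

/-! ### Products of vertex operators: the oscillator part -/

/-- The discrete topology, in which `HasSum` expresses that a family has finite support and the
given sum. -/
@[reducible] def oscTopology (J : Type*) : TopologicalSpace (Osc J) := ⊥

attribute [local instance] oscTopology

theorem oscDiscreteTopology (J : Type*) : DiscreteTopology (Osc J) := ⟨rfl⟩

attribute [local instance] oscDiscreteTopology

section Oscillator

variable {J : Type*} [Fintype J]

/-- The coefficient of `z^d` in the creation part, for `d ∈ ℤ`. -/
def creationCoeff (V : Vertex J) (d : ℤ) : Osc J :=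
  if 0 ≤ d then PowerSeries.coeff d.toNat (creation V) else 0

/-- The coefficient of `z^d` in the product of the creation part with a polynomial in `z⁻¹`. -/
def creationPairing (V : Vertex J) (d : ℤ) : Polynomial (Osc J) →ₗ[ℂ] Osc J :=
  Polynomial.lsum fun l : ℕ => LinearMap.mulLeft ℂ (creationCoeff V (d + l))

theorem creationPairing_monomial (V : Vertex J) (d : ℤ) (l : ℕ) (x : Osc J) :
    creationPairing V d (Polynomial.monomial l x) = creationCoeff V (d + l) * x := by
  simp [creationPairing, Polynomial.lsum]

theorem creationPairing_C_mul (V : Vertex J) (d : ℤ) (a : Osc J) (Q : Polynomial (Osc J)) :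
    creationPairing V d (Polynomial.C a * Q) = a * creationPairing V d Q := by
  induction Q using Polynomial.induction_on' with
  | add p q hp hq => rw [mul_add, map_add, map_add, hp, hq, mul_add]
  | monomial l x =>
    rw [Polynomial.C_mul_monomial, creationPairing_monomial, creationPairing_monomial]
    ring

theorem creationPairing_X_pow_mul (V : Vertex J) (d : ℤ) (i : ℕ) (Q : Polynomial (Osc J)) :
    creationPairing V d (Polynomial.X ^ i * Q) = creationPairing V (d + i) Q := by
  induction Q using Polynomial.induction_on' with
  | add p q hp hq => rw [mul_add, map_add, map_add, hp, hq]
  | monomial l x =>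
    rw [Polynomial.X_pow_mul_monomial, creationPairing_monomial, creationPairing_monomial]
    congr 2
    push_cast
    ring

variable (H : Heisenberg J)

theorem oscCoeff_apply (V : Vertex J) (d : ℤ) (p : Osc J) :
    oscCoeff H V d p = creationPairing V d (annihilation H V p) := rfl

/-- The pairing of the annihilation part of `V` with the creation part of `W`. -/
def modePairing (V W : Vertex J) (r : ℕ) : ℂ :=
  ∑ j, ∑ k, V.modes (r : ℤ) j * H.comm r j k * W.modes (-(r : ℤ)) k

theorem annihilation_C (V : Vertex J) (a : ℂ) :
    annihilation H V (MvPolynomial.C a) = Polynomial.C (MvPolynomial.C a) := by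
  rw [← MvPolynomial.algebraMap_eq, AlgHom.commutes, Polynomial.algebraMap_apply]

theorem annihilation_X (V : Vertex J) (k : J × ℕ+) :
    annihilation H V (MvPolynomial.X k) =
      Polynomial.C (MvPolynomial.X k) + Polynomial.C (MvPolynomial.C
        (∑ j, V.modes ((k.2 : ℕ) : ℤ) j * H.comm k.2 j k.1)) * Polynomial.X ^ (k.2 : ℕ) := by
  rw [annihilation, MvPolynomial.aeval_X]

theorem annihilation_creation_aux (V W : Vertex J) (r : ℕ) (h : 0 < r) :
    annihilation H V (∑ j, MvPolynomial.C (W.modes (-(r : ℤ)) j) *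
      (MvPolynomial.X (j, ⟨r, h⟩) : Osc J)) =
    Polynomial.C (∑ j, MvPolynomial.C (W.modes (-(r : ℤ)) j) *
      (MvPolynomial.X (j, ⟨r, h⟩) : Osc J)) +
      Polynomial.X ^ r * Polynomial.C (MvPolynomial.C (modePairing H V W r)) := by
  have hp : modePairing H V W r =
      ∑ k, W.modes (-(r : ℤ)) k * ∑ j, V.modes (r : ℤ) j * H.comm r j k := by
    rw [modePairing, Finset.sum_comm]
    refine Finset.sum_congr rfl fun k _ => ?_
    rw [Finset.mul_sum]
    refine Finset.sum_congr rfl fun j _ => ?_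
    ring
  rw [hp]
  rw [map_sum, map_sum, map_sum, map_sum]
  simp only [map_mul]
  simp only [annihilation_C, annihilation_X, PNat.mk_coe]
  rw [Finset.mul_sum, ← Finset.sum_add_distrib]
  refine Finset.sum_congr rfl fun k _ => ?_
  rw [mul_add, ← mul_assoc, mul_comm (Polynomial.X ^ r)]
set_option maxHeartbeats 1000000 in
-- The exponent of the creation part is linear in the generators, so the substitution performed by
-- the annihilation part only adds the scalar series of `modePairing`. After exponentiation this
-- series becomes the contraction factor.
theorem map_annihilation_creation (V W : Vertex J) :
    PowerSeries.map (annihilation H V : Osc J →+* Polynomial (Osc J)) (creation W) =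
      PowerSeries.map Polynomial.C (creation W) *
        PowerSeries.rescale Polynomial.X
          (PowerSeries.map (Polynomial.C.comp MvPolynomial.C)
            (expSeries (modePairing H V W))) := by
  rw [creation, map_expSeries]
  rw [map_expSeries]
  rw [map_expSeries]
  rw [rescale_expSeries]
  rw [← expSeries_add]
  apply expSeries_congr
  intro r hr
  have h : 0 < r := Nat.pos_of_ne_zero hr
  simp only [h, dif_pos]
  exact annihilation_creation_aux H V W r h

theorem hasSum_creationPairing_annihilation (V W : Vertex J) (d e : ℤ) (Q : Polynomial (Osc J)) :
    HasSum (fun i : ℕ => PowerSeries.coeff i (expSeries (modePairing H V W)) •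
        (creationCoeff W (e - i) * creationPairing V (d + i) Q))
      (creationPairing V d (annihilation H V (creationCoeff W e) * Q)) := by
  rcases lt_or_ge e 0 with he | he
  · have h (i : ℕ) : creationCoeff W (e - i) = 0 := if_neg (by omega)
    simp only [h, zero_mul, smul_zero]
    rw [creationCoeff, if_neg (by omega), map_zero, zero_mul, map_zero]
    exact hasSum_zero
  · lift e to ℕ using he
    have h := congrArg (PowerSeries.coeff e) (map_annihilation_creation H V W)
    rw [PowerSeries.coeff_map, mul_comm, PowerSeries.coeff_mul] at h
    rw [Finset.Nat.sum_antidiagonal_eq_sum_range_succ_mk] at h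
    simp only [PowerSeries.coeff_rescale, PowerSeries.coeff_map, RingHom.coe_coe, RingHom.comp_apply] at h
    have hW : creationCoeff W (e : ℤ) = PowerSeries.coeff e (creation W) := by
      simp [creationCoeff]
    rw [hW, h, Finset.sum_mul, map_sum]
    have hterm : ∀ i ∈ Finset.range e.succ,
        creationPairing V d (Polynomial.X ^ i *
          Polynomial.C (MvPolynomial.C (PowerSeries.coeff i (expSeries (modePairing H V W)))) *
          Polynomial.C (PowerSeries.coeff (e - i) (creation W)) * Q) =
        PowerSeries.coeff i (expSeries (modePairing H V W)) •
        (creationCoeff W (e - i) * creationPairing V (d + i) Q) := by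
      intro i hi
      have hi' : i ≤ e := Nat.lt_succ_iff.1 (Finset.mem_range.1 hi)
      rw [mul_assoc, mul_assoc, creationPairing_X_pow_mul, creationPairing_C_mul,
        creationPairing_C_mul, MvPolynomial.smul_eq_C_mul, creationCoeff, if_pos (by omega)]
      congr 4
      omega
    rw [Finset.sum_congr rfl hterm]
    apply hasSum_sum_of_ne_finset_zero
    intro i hi
    have : creationCoeff W (e - i) = 0 := if_neg (by have := Finset.mem_range.not.1 hi; omega)
    rw [this, zero_mul, smul_zero]

/-- The coefficient of `z^d w^e` in the oscillator part of `:V(z) W(w):`. -/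
def normalCoeff (V W : Vertex J) (d e : ℤ) : Osc J →ₗ[ℂ] Osc J :=
  (Polynomial.lsum fun l : ℕ =>
    (LinearMap.mulLeft ℂ (creationCoeff W (e + l))).comp (oscCoeff H V d)).comp
      (annihilation H W).toLinearMap

/-- Wick's theorem for two oscillator parts. The i-th coefficient of the contraction multiplies
(w/z)^i, which accounts for the indices d + i and e - i. -/
theorem hasSum_oscCoeff_oscCoeff (V W : Vertex J) (d e : ℤ) (p : Osc J) :
    HasSum (fun i : ℕ => PowerSeries.coeff i (expSeries (modePairing H V W)) •
        normalCoeff H V W (d + i) (e - i) p) (oscCoeff H V d (oscCoeff H W e p)) := by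
  rw [oscCoeff_apply H W]
  simp only [normalCoeff, LinearMap.comp_apply, AlgHom.toLinearMap_apply]
  induction annihilation H W p using Polynomial.induction_on' with
  | add p q hp hq =>
    simp only [map_add, smul_add]
    exact hp.add hq
  | monomial l x =>
    rw [creationPairing_monomial, oscCoeff_apply, map_mul]
    convert hasSum_creationPairing_annihilation H V W d (e + l) (annihilation H V x) using 2
      with i
    simp only [Polynomial.lsum, LinearMap.coe_mk, AddHom.coe_mk]
    rw [Polynomial.sum_monomial_index]
    · simp only [LinearMap.comp_apply, LinearMap.mulLeft_apply, oscCoeff_apply]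
      congr 3
      ring
    · simp

theorem creation_add (V W : Vertex J) : creation (V + W) = creation V * creation W := by
  rw [creation, creation, creation, ← expSeries_add]
  congr 1
  funext r
  split_ifs
  · rw [← Finset.sum_add_distrib]
    refine Finset.sum_congr rfl fun j _ => ?_
    rw [← add_mul, ← map_add]
    rfl
  · simp

theorem hasSum_creationCoeff_add (V W : Vertex J) (D : ℤ) (m : ℕ) :
    HasSum (fun d : ℤ => creationCoeff W (D - d) * creationCoeff V (d + m))
      (creationCoeff (V + W) (D + m)) := by
  rcases lt_or_ge (D + m) 0 with hD | hD
  · have h (d : ℤ) : creationCoeff W (D - d) * creationCoeff V (d + m) = 0 := by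
      rcases lt_or_ge (d + m) 0 with hd | hd
      · rw [creationCoeff, creationCoeff, if_neg (not_le.2 hd), mul_zero]
      · rw [creationCoeff, if_neg (by omega), zero_mul]
    simp only [h]
    rw [creationCoeff, if_neg (not_le.2 hD)]
    exact hasSum_zero
  · obtain ⟨N, hN⟩ := Int.eq_ofNat_of_zero_le hD
    have hs : creationCoeff (V + W) (D + m) =
        ∑ d ∈ (Finset.range N.succ).image fun i : ℕ => (i : ℤ) - m,
          creationCoeff W (D - d) * creationCoeff V (d + m) := by
      rw [Finset.sum_image fun a _ b _ h => by simpa using h, creationCoeff, if_pos hD,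
        creation_add, PowerSeries.coeff_mul,
        Finset.Nat.sum_antidiagonal_eq_sum_range_succ_mk, hN]
      simp only [Int.toNat_natCast]
      refine Finset.sum_congr rfl fun i hi => ?_
      have hi' : i ≤ N := Nat.lt_succ_iff.1 (Finset.mem_range.1 hi)
      rw [creationCoeff, creationCoeff, if_pos (by omega), if_pos (by omega), mul_comm]
      congr 3 <;> omega
    rw [hs]
    apply hasSum_sum_of_ne_finset_zero
    intro d hd
    rcases lt_or_ge (d + m) 0 with hd' | hd'
    · rw [creationCoeff, creationCoeff, if_neg (not_le.2 hd'), mul_zero]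
    · rw [creationCoeff, if_neg, zero_mul]
      intro hd''
      apply hd
      exact Finset.mem_image.2 ⟨(d + m).toNat, Finset.mem_range.2 (by omega), by omega⟩

theorem hasSum_creationPairing_add (V W : Vertex J) (D : ℤ) (Q : Polynomial (Osc J)) :
    HasSum (fun d : ℤ => creationCoeff W (D - d) * creationPairing V d Q)
      (creationPairing (V + W) D Q) := by
  induction Q using Polynomial.induction_on' with
  | add p q hp hq =>
    simp only [map_add, mul_add]
    exact hp.add hq
  | monomial m x =>
    simp only [creationPairing_monomial, ← mul_assoc]
    exact (hasSum_creationCoeff_add V W D m).mul_right x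

/-- Annihilation parts are translations of the generators, and translations compose by adding. Both
factors use the same formal variable because the two vertex operators are taken at the same point.
-/
theorem annihilation_add (V W : Vertex J) :
    annihilation H (V + W) =
      (Polynomial.eval₂AlgHom (annihilation H V) Polynomial.X fun _ => Commute.all _ _).comp
        (annihilation H W) := by
  apply MvPolynomial.algHom_ext
  intro k
  have h (U : Vertex J) : annihilation H U (MvPolynomial.X k) =
      Polynomial.C (MvPolynomial.X k) + Polynomial.C (MvPolynomial.C
        (∑ j, U.modes ((k.2 : ℕ) : ℤ) j * H.comm k.2 j k.1)) * Polynomial.X ^ (k.2 : ℕ) := by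
    rw [annihilation, MvPolynomial.aeval_X]
  rw [AlgHom.comp_apply, h, h, map_add, map_mul, map_pow]
  simp only [Polynomial.eval₂AlgHom_apply, Polynomial.eval₂_C, Polynomial.eval₂_X,
    RingHom.coe_coe, h]
  rw [← MvPolynomial.algebraMap_eq, AlgHom.commutes, Polynomial.algebraMap_apply,
    MvPolynomial.algebraMap_eq, add_assoc, ← add_mul, ← map_add, ← map_add,
    ← Finset.sum_add_distrib]
  congr 4
  refine Finset.sum_congr rfl fun j _ => ?_
  rw [← add_mul]
  rfl

/-- This is the specialization w = z of the normally ordered product. It makes sense because,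
applied to a fixed polynomial, only finitely many coefficients of total degree D are nonzero. -/
theorem hasSum_normalCoeff (V W : Vertex J) (D : ℤ) (p : Osc J) :
    HasSum (fun d : ℤ => normalCoeff H V W d (D - d) p) (oscCoeff H (V + W) D p) := by
  rw [oscCoeff_apply, annihilation_add, AlgHom.comp_apply]
  simp only [normalCoeff, LinearMap.comp_apply, AlgHom.toLinearMap_apply]
  induction annihilation H W p using Polynomial.induction_on' with
  | add p q hp hq =>
    simp only [map_add]
    exact hp.add hq
  | monomial l x =>
    rw [Polynomial.eval₂AlgHom_apply, Polynomial.eval₂_monomial, mul_comm,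
      creationPairing_X_pow_mul, RingHom.coe_coe]
    convert hasSum_creationPairing_add V W (D + l) (annihilation H V x) using 2 with d
    simp only [Polynomial.lsum, LinearMap.coe_mk, AddHom.coe_mk]
    rw [Polynomial.sum_monomial_index]
    · simp only [LinearMap.comp_apply, LinearMap.mulLeft_apply, oscCoeff_apply]
      congr 2
      ring
    · simp

theorem oscCoeff_mul_X (V : Vertex J) (d : ℤ) (p : Osc J) (k : J × ℕ+) :
    oscCoeff H V d (p * MvPolynomial.X k) = MvPolynomial.X k * oscCoeff H V d p +
      MvPolynomial.C (∑ j, V.modes ((k.2 : ℕ) : ℤ) j * H.comm k.2 j k.1) *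
        oscCoeff H V (d + (k.2 : ℕ)) p := by
  rw [oscCoeff_apply, map_mul, annihilation_X, mul_comm, add_mul, map_add, creationPairing_C_mul,
    mul_assoc, creationPairing_C_mul, creationPairing_X_pow_mul]
  rfl

theorem normalCoeff_mul_X (V W : Vertex J) (d e : ℤ) (p : Osc J) (k : J × ℕ+) :
    normalCoeff H V W d e (p * MvPolynomial.X k) =
      MvPolynomial.X k * normalCoeff H V W d e p +
      MvPolynomial.C (∑ j, V.modes ((k.2 : ℕ) : ℤ) j * H.comm k.2 j k.1) *
        normalCoeff H V W (d + (k.2 : ℕ)) e p +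
      MvPolynomial.C (∑ j, W.modes ((k.2 : ℕ) : ℤ) j * H.comm k.2 j k.1) *
        normalCoeff H V W d (e + (k.2 : ℕ)) p := by
  simp only [normalCoeff, LinearMap.comp_apply, AlgHom.toLinearMap_apply, map_mul, annihilation_X]
  induction annihilation H W p using Polynomial.induction_on' with
  | add p q hp hq =>
    rw [add_mul, map_add, hp, hq]
    simp only [map_add]
    ring
  | monomial l x =>
    rw [mul_add, map_add, Polynomial.monomial_mul_C, mul_left_comm, Polynomial.monomial_mul_X_pow,
      Polynomial.C_mul_monomial]
    simp only [Polynomial.lsum, LinearMap.coe_mk, AddHom.coe_mk]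
    rw [Polynomial.sum_monomial_index _ _ (by simp), Polynomial.sum_monomial_index _ _ (by simp),
      Polynomial.sum_monomial_index _ _ (by simp), Polynomial.sum_monomial_index _ _ (by simp),
      Polynomial.sum_monomial_index _ _ (by simp)]
    simp only [LinearMap.comp_apply, LinearMap.mulLeft_apply, oscCoeff_mul_X,
      ← MvPolynomial.smul_eq_C_mul, map_smul]
    simp only [MvPolynomial.smul_eq_C_mul]
    have : e + ((l + (k.2 : ℕ) : ℕ) : ℤ) = e + (k.2 : ℕ) + l := by push_cast; ring
    rw [this]
    ring

/-- Normal ordering does not depend on the order of the factors: on constants both sides are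
products of creation coefficients, and multiplication by a generator obeys the recursion
`normalCoeff_mul_X`, which is symmetric in the two factors. -/
theorem normalCoeff_symm (V W : Vertex J) (d e : ℤ) (p : Osc J) :
    normalCoeff H V W d e p = normalCoeff H W V e d p := by
  induction p using MvPolynomial.induction_on generalizing d e with
  | C a =>
    have hC (U : Vertex J) : annihilation H U (MvPolynomial.C a) =
        Polynomial.monomial 0 (MvPolynomial.C a) := by
      rw [← MvPolynomial.algebraMap_eq, AlgHom.commutes, Polynomial.algebraMap_apply,
        Polynomial.monomial_zero_left]
    have h (U U' : Vertex J) (d e : ℤ) : normalCoeff H U U' d e (MvPolynomial.C a) =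
        creationCoeff U' e * (creationCoeff U d * MvPolynomial.C a) := by
      simp only [normalCoeff, LinearMap.comp_apply, AlgHom.toLinearMap_apply, hC,
        Polynomial.lsum, LinearMap.coe_mk, AddHom.coe_mk]
      rw [Polynomial.sum_monomial_index _ _ (by simp)]
      simp only [LinearMap.mulLeft_apply, oscCoeff_apply, hC, creationPairing_monomial]
      simp
    rw [h, h]
    ring
  | add p q hp hq => rw [map_add, map_add, hp, hq]
  | mul_X p k hp =>
    rw [normalCoeff_mul_X, normalCoeff_mul_X, hp, hp, hp]
    ring

theorem creation_shift (l : ℂ) (V : Vertex J) :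
    creation (V.shift l) = PowerSeries.rescale (MvPolynomial.C (Complex.exp l)) (creation V) := by
  rw [creation, creation, rescale_expSeries]
  apply expSeries_congr
  intro r hr
  have h : 0 < r := Nat.pos_of_ne_zero hr
  simp only [h, dif_pos]
  rw [Finset.mul_sum]
  refine Finset.sum_congr rfl fun j _ => ?_
  rw [← mul_assoc, ← map_pow, ← map_mul, ← Complex.exp_nat_mul]
  congr 2
  simp [Vertex.shift, Vertex.modes, hr]

theorem oscCoeff_shift (l : ℂ) (V : Vertex J) (d : ℤ) (p : Osc J) :
    oscCoeff H (V.shift l) d p = Complex.exp (d * l) • oscCoeff H V d p := by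
  have hcre (d : ℤ) : creationCoeff (V.shift l) d = Complex.exp (d * l) • creationCoeff V d := by
    rw [creationCoeff, creationCoeff]
    split_ifs with h
    · lift d to ℕ using h
      rw [creation_shift, PowerSeries.coeff_rescale, ← map_pow, ← Complex.exp_nat_mul,
        MvPolynomial.smul_eq_C_mul]
      simp
    · simp
  induction p using MvPolynomial.induction_on generalizing d with
  | C a =>
    have hC (U : Vertex J) : annihilation H U (MvPolynomial.C a) =
        Polynomial.monomial 0 (MvPolynomial.C a) := by
      rw [← MvPolynomial.algebraMap_eq, AlgHom.commutes, Polynomial.algebraMap_apply,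
        Polynomial.monomial_zero_left]
    simp only [oscCoeff_apply, hC, creationPairing_monomial, hcre]
    simp
  | add p q hp hq => rw [map_add, map_add, hp, hq, smul_add]
  | mul_X p k hp =>
    have hm (j : J) : (V.shift l).modes ((k.2 : ℕ) : ℤ) j =
        Complex.exp (-((k.2 : ℕ) : ℂ) * l) * V.modes ((k.2 : ℕ) : ℤ) j := by
      simp [Vertex.shift, Vertex.modes]
    rw [oscCoeff_mul_X, oscCoeff_mul_X, hp, hp, smul_add, mul_smul_comm]
    congr 1
    simp only [hm, mul_assoc, ← Finset.mul_sum]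
    rw [← MvPolynomial.smul_eq_C_mul, ← MvPolynomial.smul_eq_C_mul, smul_smul, smul_smul,
      mul_right_comm, ← Complex.exp_add]
    congr 3
    push_cast
    ring

theorem normalCoeff_shift (l : ℂ) (V W : Vertex J) (d e : ℤ) (p : Osc J) :
    normalCoeff H (V.shift l) W d e p = Complex.exp (d * l) • normalCoeff H V W d e p := by
  simp only [normalCoeff, LinearMap.comp_apply, AlgHom.toLinearMap_apply]
  induction annihilation H W p using Polynomial.induction_on' with
  | add p q hp hq => rw [map_add, map_add, hp, hq, smul_add]
  | monomial m x =>
    simp only [Polynomial.lsum, LinearMap.coe_mk, AddHom.coe_mk]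
    rw [Polynomial.sum_monomial_index _ _ (by simp), Polynomial.sum_monomial_index _ _ (by simp)]
    simp only [LinearMap.comp_apply, LinearMap.mulLeft_apply, oscCoeff_shift, mul_smul_comm]

/-- If the two expansions of the contraction differ by a combination of delta functions, so does
the commutator of the oscillator parts. -/
theorem oscCoeff_commutator {ι : Type*} (s : Finset ι) (c l : ι → ℂ) (F G : ℂ) (V W : Vertex J)
    (hpos : ∀ k : ℕ, k ≠ 0 → F * PowerSeries.coeff k (expSeries (modePairing H V W)) =
      ∑ x ∈ s, c x * Complex.exp (k * l x))
    (hneg : ∀ k : ℕ, k ≠ 0 → G * PowerSeries.coeff k (expSeries (modePairing H W V)) =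
      -∑ x ∈ s, c x * Complex.exp (-k * l x))
    (hzero : F - G = ∑ x ∈ s, c x) (d e : ℤ) (p : Osc J) :
    F • oscCoeff H V d (oscCoeff H W e p) - G • oscCoeff H W e (oscCoeff H V d p) =
      ∑ x ∈ s, (c x * Complex.exp (-d * l x)) • oscCoeff H ((V.shift (l x)) + W) (d + e) p := by
  set f : ℕ → ℂ := fun k => PowerSeries.coeff k (expSeries (modePairing H V W)) with hf
  set g : ℕ → ℂ := fun k => PowerSeries.coeff k (expSeries (modePairing H W V)) with hg
  -- One order of the factors produces only k ≥ 0, the other only k ≤ 0. Extending both sums by zero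
  -- to k ∈ ℤ lets them be compared over the same normally ordered coefficients.
  have h1 : HasSum (fun k : ℤ => if 0 ≤ k then (F * f k.toNat) •
      normalCoeff H V W (d + k) (e - k) p else 0) (F • oscCoeff H V d (oscCoeff H W e p)) := by
    have h := (hasSum_oscCoeff_oscCoeff H V W d e p).const_smul F
    rw [← (Nat.cast_injective (R := ℤ)).hasSum_iff]
    · convert h using 2 with k
      simp [hf, smul_smul]
    · intro k hk
      rw [if_neg]
      intro hk'
      exact hk ⟨k.toNat, by simp [hk']⟩
  have h2 : HasSum (fun k : ℤ => if k ≤ 0 then (G * g (-k).toNat) •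
      normalCoeff H V W (d + k) (e - k) p else 0) (G • oscCoeff H W e (oscCoeff H V d p)) := by
    have h := (hasSum_oscCoeff_oscCoeff H W V e d p).const_smul G
    have hinj : Function.Injective fun k : ℕ => -(k : ℤ) := fun a b h => by simpa using h
    rw [← hinj.hasSum_iff]
    · convert h using 2 with k
      rw [normalCoeff_symm]
      simp [hg, smul_smul, sub_eq_add_neg]
    · intro k hk
      rw [if_neg]
      intro hk'
      exact hk ⟨(-k).toNat, by simp [hk']⟩
  -- A delta function at z = e^l w evaluates the normal product there. Its coefficient at (d + k, e
  -- - k) carries e^{(d+k)l}, and the prefactor e^{-dl} leaves e^{kl}.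
  have h3 (x : ι) : HasSum (fun k : ℤ => (c x * Complex.exp (k * l x)) •
      normalCoeff H V W (d + k) (e - k) p)
      ((c x * Complex.exp (-d * l x)) • oscCoeff H (V.shift (l x) + W) (d + e) p) := by
    have h := (hasSum_normalCoeff H (V.shift (l x)) W (d + e) p).const_smul
      (c x * Complex.exp (-d * l x))
    rw [← (Equiv.addLeft d).hasSum_iff] at h
    convert h using 2 with k
    simp only [Function.comp_apply, Equiv.coe_addLeft]
    rw [normalCoeff_shift, smul_smul, mul_assoc, ← Complex.exp_add]
    congr 2
    · congr 2
      push_cast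
      ring
    · congr 1
      ring
  -- Both expansions meet only at k = 0, which is where `hzero` is needed.
  have h4 : (fun k : ℤ => (if 0 ≤ k then (F * f k.toNat) •
        normalCoeff H V W (d + k) (e - k) p else 0) - if k ≤ 0 then (G * g (-k).toNat) •
        normalCoeff H V W (d + k) (e - k) p else 0) =
      fun k : ℤ => ∑ x ∈ s, (c x * Complex.exp (k * l x)) •
        normalCoeff H V W (d + k) (e - k) p := by
    funext k
    rw [← Finset.sum_smul]
    rcases lt_trichotomy k 0 with hk | rfl | hk
    · obtain ⟨m, rfl⟩ : ∃ m : ℕ, k = -(m : ℤ) := ⟨(-k).toNat, by omega⟩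
      rw [if_neg (by omega), if_pos (by omega), neg_neg, Int.toNat_natCast, hg,
        hneg m (by omega), zero_sub, neg_smul, neg_neg]
      push_cast
      rfl
    · have hf0 : f 0 = 1 := coeff_zero_expSeries _
      have hg0 : g 0 = 1 := coeff_zero_expSeries _
      rw [if_pos le_rfl, if_pos le_rfl, ← sub_smul]
      simp [hf0, hg0, hzero]
    · obtain ⟨m, rfl⟩ : ∃ m : ℕ, k = (m : ℤ) := ⟨k.toNat, by omega⟩
      rw [if_pos (by omega), if_neg (by omega), Int.toNat_natCast, hf, hpos m (by omega), sub_zero]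
      push_cast
      rfl
  have h5 := h1.sub h2
  rw [h4] at h5
  exact h5.unique (hasSum_sum fun x _ => h3 x)

end Oscillator

/-! ### Commutators of vertex operators on the Fock module -/

section FockModule

variable {J : Type*} [Fintype J] (H : Heisenberg J) (α : J → ℂ)

theorem vertexField_single (V : Vertex J) (u : J → ℂ) (p : Osc J) (κ : ℂ) (d : ℤ)
    (h : κ = zExponent H α V u + d) :
    vertexField H α V κ (Finsupp.single u p) =
      Complex.exp (∑ j, V.modes 0 j * weight H α u j) •
        Finsupp.single (u + V.charge) (oscCoeff H V d p) := by
  have h1 : κ - zExponent H α V u = d := by rw [h]; ring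
  have h2 : ⌊(κ - zExponent H α V u).re⌋ = d := by rw [h1]; simp
  rw [vertexField, Finsupp.lsum_single, h2, if_pos h1.symm]
  rfl

theorem vertexField_single_of_not_exists (V : Vertex J) (u : J → ℂ) (p : Osc J) (κ : ℂ)
    (h : ¬∃ d : ℤ, κ = zExponent H α V u + d) :
    vertexField H α V κ (Finsupp.single u p) = 0 := by
  rw [vertexField, Finsupp.lsum_single, if_neg]
  · rfl
  · intro h'
    exact h ⟨_, by rw [h']; ring⟩

theorem weight_add (u v : J → ℂ) (j : J) :
    weight H α (u + v) j = weight H α u j + ∑ k, H.zero j k * v k := by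
  simp only [weight, Pi.add_apply, mul_add, Finset.sum_add_distrib, add_assoc]

/-- The pairing of zero modes `∑ c_j [a_{j,0}, Q_k] u_k`. -/
def zeroPairing (c u : J → ℂ) : ℂ := ∑ j, ∑ k, c j * H.zero j k * u k

theorem sum_mul_weight_add (c u v : J → ℂ) :
    ∑ j, c j * weight H α (u + v) j = ∑ j, c j * weight H α u j + zeroPairing H c v := by
  rw [zeroPairing, ← Finset.sum_add_distrib]
  refine Finset.sum_congr rfl fun j _ => ?_
  rw [weight_add, mul_add, Finset.mul_sum]
  congr 1
  exact Finset.sum_congr rfl fun k _ => by ring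

theorem zExponent_add_charge (V : Vertex J) (u v : J → ℂ) :
    zExponent H α V (u + v) = zExponent H α V u + zeroPairing H V.power v :=
  sum_mul_weight_add H α V.power u v

theorem zExponent_shift_add (l : ℂ) (V W : Vertex J) (u : J → ℂ) :
    zExponent H α (V.shift l + W) u = zExponent H α V u + zExponent H α W u := by
  rw [zExponent, zExponent, zExponent, ← Finset.sum_add_distrib]
  refine Finset.sum_congr rfl fun j _ => ?_
  rw [← add_mul]
  rfl

theorem sum_modes_zero_shift_add (l : ℂ) (V W : Vertex J) (u : J → ℂ) :
    ∑ j, (V.shift l + W).modes 0 j * weight H α u j =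
      ∑ j, V.modes 0 j * weight H α u j + ∑ j, W.modes 0 j * weight H α u j +
        l * zExponent H α V u := by
  rw [zExponent, Finset.mul_sum, ← Finset.sum_add_distrib, ← Finset.sum_add_distrib]
  refine Finset.sum_congr rfl fun j _ => ?_
  have : (V.shift l + W).modes 0 j = V.modes 0 j + l * V.power j + W.modes 0 j := by
    change (V.shift l).modes 0 j + W.modes 0 j = _
    simp [Vertex.shift, Vertex.modes]
  rw [this]
  ring

/-- `hV` makes the powers of z in V integral and independent of the sector, and `hW` says that the
charge of V does not change the exponents of W. The zero modes then contribute only scalars on each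
sector, and the statement reduces to `oscCoeff_commutator`. -/
theorem commutator_vertexField {ι : Type*} (s : Finset ι) (c l : ι → ℂ) (V W : Vertex J) (m : ℤ)
    (hV : ∀ u, zExponent H α V u = m) (hW : zeroPairing H W.power V.charge = 0)
    (hpos : ∀ k : ℕ, k ≠ 0 → Complex.exp (zeroPairing H (V.modes 0) W.charge) *
        PowerSeries.coeff k (expSeries (modePairing H V W)) =
      ∑ x ∈ s, c x * Complex.exp (k * l x))
    (hneg : ∀ k : ℕ, k ≠ 0 → Complex.exp (zeroPairing H (W.modes 0) V.charge) *
        PowerSeries.coeff k (expSeries (modePairing H W V)) =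
      -∑ x ∈ s, c x * Complex.exp (-k * l x))
    (hzero : Complex.exp (zeroPairing H (V.modes 0) W.charge) -
      Complex.exp (zeroPairing H (W.modes 0) V.charge) = ∑ x ∈ s, c x) :
    commutator (vertexField H α V) (vertexField H α W) =
      ∑ x ∈ s, c x • deltaTimes (l x) (vertexField H α (V.shift (l x) + W)) := by
  funext κ κ'
  rw [Finset.sum_apply, Finset.sum_apply]
  refine Finsupp.lhom_ext fun u p => ?_
  rw [LinearMap.sum_apply]
  simp only [commutator, LinearMap.sub_apply, Module.End.mul_apply, Pi.smul_apply,
    LinearMap.smul_apply]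
  by_cases hκ : ∃ d : ℤ, κ = m + d
  swap
  · have h0 (v : J → ℂ) (p : Osc J) : vertexField H α V κ (Finsupp.single v p) = 0 := by
      apply vertexField_single_of_not_exists
      rwa [hV]
    have h1 : ¬∃ k : ℤ, κ = -(k : ℂ) := by
      rintro ⟨k, hk⟩
      exact hκ ⟨-k - m, by rw [hk]; push_cast; ring⟩
    have h2 : vertexField H α V κ (vertexField H α W κ' (Finsupp.single u p)) = 0 := by
      by_cases h : ∃ d : ℤ, κ' = zExponent H α W u + d
      · obtain ⟨d, hd⟩ := h
        rw [vertexField_single H α W u p κ' d hd, map_smul, h0, smul_zero]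
      · rw [vertexField_single_of_not_exists H α W u p κ' h, map_zero]
    rw [h0, map_zero, h2, sub_zero]
    refine (Finset.sum_eq_zero fun x _ => ?_).symm
    rw [deltaTimes, if_neg h1, LinearMap.zero_apply, smul_zero]
  obtain ⟨d, rfl⟩ := hκ
  have h1 : ∃ k : ℤ, (m + d : ℂ) = -(k : ℂ) := ⟨-m - d, by push_cast; ring⟩
  have hWV : zExponent H α W (u + V.charge) = zExponent H α W u := by
    rw [zExponent_add_charge, hW, add_zero]
  have hVu (v : J → ℂ) (p : Osc J) := vertexField_single H α V v p (m + d) d (by rw [hV])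
  simp only [deltaTimes, if_pos h1]
  by_cases he : ∃ e : ℤ, κ' = zExponent H α W u + e
  swap
  · rw [vertexField_single_of_not_exists H α W u p κ' he, map_zero, hVu, map_smul,
      vertexField_single_of_not_exists H α W _ _ κ' (by rwa [hWV]), smul_zero, sub_zero]
    refine (Finset.sum_eq_zero fun x _ => ?_).symm
    rw [LinearMap.smul_apply, vertexField_single_of_not_exists, smul_zero, smul_zero]
    rintro ⟨k, hk⟩
    rw [zExponent_shift_add, hV] at hk
    refine he ⟨k - d, ?_⟩
    push_cast
    linear_combination hk
  obtain ⟨e, he⟩ := he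
  rw [vertexField_single H α W u p κ' e he, hVu, map_smul, map_smul, hVu,
    vertexField_single H α W _ _ κ' e (by rw [hWV, he])]
  have hR (x : ι) : vertexField H α (V.shift (l x) + W) (κ' + (m + d)) (Finsupp.single u p) =
      Complex.exp (∑ j, V.modes 0 j * weight H α u j + ∑ j, W.modes 0 j * weight H α u j +
        l x * m) • Finsupp.single (u + V.charge + W.charge)
          (oscCoeff H (V.shift (l x) + W) (d + e) p) := by
    rw [vertexField_single H α _ u p _ (d + e) (by
      rw [zExponent_shift_add, hV, he]; push_cast; ring), sum_modes_zero_shift_add, hV]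
    congr 2
    rw [add_assoc]
    rfl
  simp only [LinearMap.smul_apply, hR]
  rw [sum_mul_weight_add, sum_mul_weight_add, add_right_comm u W.charge]
  have key := congrArg (fun y => Complex.exp (∑ j, V.modes 0 j * weight H α u j +
      ∑ j, W.modes 0 j * weight H α u j) • Finsupp.single (u + V.charge + W.charge) y)
    (oscCoeff_commutator H s c l _ _ V W hpos hneg hzero d e p)
  simp only [Finsupp.single_sub, smul_sub, Finsupp.smul_single, Finsupp.single_finsetSum,
    Finset.smul_sum, smul_smul] at key ⊢
  convert key using 1
  · congr 2
    · rw [Complex.exp_add, Complex.exp_add]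
      congr 1
      ring
    · rw [Complex.exp_add, Complex.exp_add]
      congr 1
      ring
  · refine Finset.sum_congr rfl fun x _ => ?_
    congr 2
    rw [mul_left_comm _ (c x), ← Complex.exp_add, ← Complex.exp_add]
    congr 2
    ring

/-! ### Rational contractions with at most two poles, and their delta functions -/

theorem expSeries_one_pole (τ ε : ℂ) (f : ℕ → ℂ) (hf : ∀ r, r ≠ 0 → f r = (τ ^ r - ε ^ r) / r)
    (k : ℕ) (hk : k ≠ 0) :
    PowerSeries.coeff k (expSeries f) = τ ^ k - ε * τ ^ (k - 1) := by
  have h : expSeries f = expSeries fun r => τ ^ r / r + -(ε ^ r / r) :=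
    expSeries_congr fun r hr => by rw [hf r hr]; ring
  rw [h, expSeries_add, expSeries_geometric, expSeries_neg_geometric]
  obtain ⟨k, rfl⟩ := Nat.exists_eq_succ_of_ne_zero hk
  rw [mul_sub, mul_one, ← mul_assoc, mul_comm _ (PowerSeries.C ε), mul_assoc, map_sub,
    PowerSeries.coeff_C_mul, PowerSeries.coeff_succ_mul_X]
  simp

/-- The series is (1 - ε₁X)(1 - ε₂X)/((1 - τ₁X)(1 - τ₂X)). By `hprod` its numerator and denominator
have the same constant and quadratic coefficients, so it has the form 1 + ρ/(1 - τ₁X) - ρ/(1 - τ₂X);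
`hρ` is the comparison of the linear coefficients. -/
theorem expSeries_two_poles (τ₁ τ₂ ε₁ ε₂ ρ : ℂ) (f : ℕ → ℂ)
    (hf : ∀ r, r ≠ 0 → f r = (τ₁ ^ r + τ₂ ^ r - ε₁ ^ r - ε₂ ^ r) / r)
    (hprod : ε₁ * ε₂ = τ₁ * τ₂) (hρ : ρ * (τ₁ - τ₂) = τ₁ + τ₂ - ε₁ - ε₂) (k : ℕ) (hk : k ≠ 0) :
    PowerSeries.coeff k (expSeries f) = ρ * (τ₁ ^ k - τ₂ ^ k) := by
  have h : expSeries f = expSeries fun r => τ₁ ^ r / r + (τ₂ ^ r / r +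
      (-(ε₁ ^ r / r) + -(ε₂ ^ r / r))) :=
    expSeries_congr fun r hr => by rw [hf r hr]; ring
  rw [h, expSeries_add, expSeries_add, expSeries_add, expSeries_geometric, expSeries_geometric,
    expSeries_neg_geometric, expSeries_neg_geometric]
  have h1 := mk_pow_mul τ₁
  have h2 := mk_pow_mul τ₂
  have h3 := congrArg (PowerSeries.C (R := ℂ)) hprod
  have h4 := congrArg (PowerSeries.C (R := ℂ)) hρ
  simp only [map_mul, map_sub, map_add] at h3 h4
  have key : (PowerSeries.mk fun n => τ₁ ^ n) * ((PowerSeries.mk fun n => τ₂ ^ n) *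
      ((1 - PowerSeries.C ε₁ * PowerSeries.X) * (1 - PowerSeries.C ε₂ * PowerSeries.X))) =
      1 + PowerSeries.C ρ * ((PowerSeries.mk fun n => τ₁ ^ n) - PowerSeries.mk fun n => τ₂ ^ n) := by
    generalize (PowerSeries.mk fun n => τ₁ ^ n) = m₁ at *
    generalize (PowerSeries.mk fun n => τ₂ ^ n) = m₂ at *
    linear_combination (m₁ * m₂ * PowerSeries.X ^ 2) * h3 - m₁ * m₂ * PowerSeries.X * h4 +
      (1 - PowerSeries.C τ₂ * PowerSeries.X) * m₂ * h1 + h2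
      - PowerSeries.C ρ * m₂ * h1 + PowerSeries.C ρ * m₁ * h2
  rw [key]
  simp [PowerSeries.coeff_one, hk]

theorem commutator_vertexField_eq_zero (V W : Vertex J) (m : ℤ)
    (hV : ∀ u, zExponent H α V u = m) (hW : zeroPairing H W.power V.charge = 0)
    (hF : Complex.exp (zeroPairing H (V.modes 0) W.charge) = 1)
    (hG : Complex.exp (zeroPairing H (W.modes 0) V.charge) = 1)
    (hVW : ∀ r : ℕ, r ≠ 0 → modePairing H V W r = 0)
    (hWV : ∀ r : ℕ, r ≠ 0 → modePairing H W V r = 0) :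
    commutator (vertexField H α V) (vertexField H α W) = 0 := by
  have h (f : ℕ → ℂ) (hf : ∀ r : ℕ, r ≠ 0 → f r = 0) (k : ℕ) (hk : k ≠ 0) :
      PowerSeries.coeff k (expSeries f) = 0 := by
    rw [expSeries_congr (g := fun _ => 0) hf, expSeries_zero, PowerSeries.coeff_one, if_neg hk]
  rw [commutator_vertexField H α (∅ : Finset ℕ) (fun _ => 0) (fun _ => 0) V W m hV hW]
  · simp
  · intro k hk
    simp [h _ hVW k hk]
  · intro k hk
    simp [h _ hWV k hk]
  · simp [hF, hG]

/-- Re-expanding (1 - εx)/(1 - τx) at infinity produces the constant ε/τ. The zero mode factor τ/ε =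
e^{l-e} of `hF` compensates it, so both orders expand one rational function, and the residue is the
difference τ/ε - 1 of its values at 0 and infinity. -/
theorem commutator_vertexField_one_pole (V W : Vertex J) (m : ℤ) (l e : ℂ)
    (hV : ∀ u, zExponent H α V u = m) (hW : zeroPairing H W.power V.charge = 0)
    (hF : Complex.exp (zeroPairing H (V.modes 0) W.charge) = Complex.exp (l - e))
    (hG : Complex.exp (zeroPairing H (W.modes 0) V.charge) = 1)
    (hVW : ∀ r : ℕ, r ≠ 0 →
      modePairing H V W r = (Complex.exp (r * l) - Complex.exp (r * e)) / r)
    (hWV : ∀ r : ℕ, r ≠ 0 →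
      modePairing H W V r = (Complex.exp (-r * l) - Complex.exp (-r * e)) / r) :
    commutator (vertexField H α V) (vertexField H α W) =
      (Complex.exp (l - e) - 1) • deltaTimes l (vertexField H α (V.shift l + W)) := by
  rw [commutator_vertexField H α {()} (fun _ => Complex.exp (l - e) - 1) (fun _ => l) V W m hV hW]
  · simp
  · intro k hk
    rw [expSeries_one_pole (Complex.exp l) (Complex.exp e) _ (fun r hr => by
      rw [hVW r hr, Complex.exp_nat_mul, Complex.exp_nat_mul]) k hk, hF]
    obtain ⟨k, rfl⟩ : ∃ j, k = j + 1 := ⟨k - 1, by omega⟩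
    rw [Finset.sum_singleton, Nat.add_sub_cancel, Complex.exp_nat_mul, Complex.exp_sub]
    have := Complex.exp_ne_zero e
    field_simp
    ring
  · intro k hk
    rw [expSeries_one_pole (Complex.exp (-l)) (Complex.exp (-e)) _ (fun r hr => by
      rw [hWV r hr, ← Complex.exp_nat_mul, ← Complex.exp_nat_mul]; simp) k hk, hG]
    obtain ⟨k, rfl⟩ : ∃ j, k = j + 1 := ⟨k - 1, by omega⟩
    rw [Finset.sum_singleton, Nat.add_sub_cancel, neg_mul_comm, Complex.exp_nat_mul,
      Complex.exp_sub, Complex.exp_neg, Complex.exp_neg]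
    have := Complex.exp_ne_zero e
    have := Complex.exp_ne_zero l
    rw [pow_succ]
    generalize (Complex.exp l)⁻¹ ^ k = y
    field_simp
    ring
  · simp [hF, hG]

theorem commutator_vertexField_two_poles (V W : Vertex J) (m : ℤ) (l₁ l₂ e₁ e₂ ρ : ℂ)
    (hV : ∀ u, zExponent H α V u = m) (hW : zeroPairing H W.power V.charge = 0)
    (hF : Complex.exp (zeroPairing H (V.modes 0) W.charge) = 1)
    (hG : Complex.exp (zeroPairing H (W.modes 0) V.charge) = 1)
    (hVW : ∀ r : ℕ, r ≠ 0 → modePairing H V W r = (Complex.exp (r * l₁) + Complex.exp (r * l₂)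
      - Complex.exp (r * e₁) - Complex.exp (r * e₂)) / r)
    (hWV : ∀ r : ℕ, r ≠ 0 → modePairing H W V r = (Complex.exp (-r * l₁) + Complex.exp (-r * l₂)
      - Complex.exp (-r * e₁) - Complex.exp (-r * e₂)) / r)
    (hprod : e₁ + e₂ = l₁ + l₂)
    (hρ : ρ * (Complex.exp l₁ - Complex.exp l₂) =
      Complex.exp l₁ + Complex.exp l₂ - Complex.exp e₁ - Complex.exp e₂) :
    commutator (vertexField H α V) (vertexField H α W) =
      ρ • deltaTimes l₁ (vertexField H α (V.shift l₁ + W)) +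
        (-ρ) • deltaTimes l₂ (vertexField H α (V.shift l₂ + W)) := by
  have h1 : Complex.exp e₁ * Complex.exp e₂ = Complex.exp l₁ * Complex.exp l₂ := by
    rw [← Complex.exp_add, ← Complex.exp_add, hprod]
  rw [commutator_vertexField H α Finset.univ (fun b : Bool => if b then ρ else -ρ)
    (fun b => if b then l₁ else l₂) V W m hV hW]
  · rw [Fintype.sum_bool, if_pos rfl, if_pos rfl, if_neg Bool.false_ne_true,
      if_neg Bool.false_ne_true]
  · intro k hk
    rw [expSeries_two_poles (Complex.exp l₁) (Complex.exp l₂) (Complex.exp e₁) (Complex.exp e₂) ρ _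
      (fun r hr => by rw [hVW r hr]; simp only [Complex.exp_nat_mul]) h1 hρ k hk, hF]
    simp only [Fintype.sum_bool, if_true, Bool.false_eq_true, if_false, Complex.exp_nat_mul]
    ring
  · intro k hk
    -- In the opposite order poles and zeros are inverted. Since the products of the poles and of
    -- the zeros agree, dividing the relation for ρ by that product gives the same relation with -ρ.
    rw [expSeries_two_poles (Complex.exp (-l₁)) (Complex.exp (-l₂)) (Complex.exp (-e₁))
      (Complex.exp (-e₂)) (-ρ) _
      (fun r hr => by rw [hWV r hr]; simp only [← Complex.exp_nat_mul]; simp) _ _ k hk, hG]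
    · simp only [Fintype.sum_bool, if_true, Bool.false_eq_true, if_false, neg_mul]
      simp only [← mul_neg, Complex.exp_nat_mul]
      ring
    · rw [← Complex.exp_add, ← Complex.exp_add, ← neg_add, ← neg_add, hprod]
    · simp only [Complex.exp_neg]
      have a1 := Complex.exp_ne_zero l₁
      have a2 := Complex.exp_ne_zero l₂
      have a3 := Complex.exp_ne_zero e₁
      have a4 := Complex.exp_ne_zero e₂
      have a5 : (Complex.exp e₁)⁻¹ + (Complex.exp e₂)⁻¹ =
          (Complex.exp e₁ + Complex.exp e₂) * (Complex.exp l₁ * Complex.exp l₂)⁻¹ := by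
        rw [← h1]
        field_simp
        ring
      rw [sub_sub, a5]
      field_simp
      linear_combination hρ
  · simp [hF, hG]

end FockModule

/-! ### The Cartan matrices are invertible -/

section Matrices

variable {n : ℕ}

/-- The common shape of the symmetrized Cartan matrix and of its limit. -/
def ospMatrix (n : ℕ) (a b g e : ℂ) : Matrix (Color n) (Color n) ℂ := fun i j =>
  if (i : ℕ) ≤ 1 ∧ (j : ℕ) ≤ 1 then
    if i = j then a else b
  else if i = j then g
  else if ((i : ℕ) ≤ 1 ∧ (j : ℕ) = 2) ∨ ((i : ℕ) = 2 ∧ (j : ℕ) ≤ 1) then e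
  else if (i : ℕ) + 1 = j ∨ (j : ℕ) + 1 = i then e
  else 0

/-- The indicator function of the color `k`; it vanishes if there is no such color. -/
def colorIndicator (n k : ℕ) (j : Color n) : ℂ := if (j : ℕ) = k then 1 else 0

theorem sum_colorIndicator_mul (k : ℕ) (v : Color n → ℂ) :
    ∑ j, colorIndicator n k j * v j = if h : k < n + 1 then v ⟨k, h⟩ else 0 := by
  simp only [colorIndicator, ite_mul, one_mul, zero_mul]
  split_ifs with h
  · rw [Finset.sum_eq_single ⟨k, h⟩]
    · simp
    · intro j _ hj
      rw [if_neg]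
      intro h'
      exact hj (Fin.ext h')
    · simp
  · refine Finset.sum_eq_zero fun j _ => if_neg ?_
    have := j.2
    omega

theorem ospMatrix_fermionic (a b g e : ℂ) (i j : Color n) (hi : (i : ℕ) ≤ 1) :
    ospMatrix n a b g e i j =
      a * colorIndicator n i j + b * colorIndicator n (1 - i) j + e * colorIndicator n 2 j := by
  simp only [ospMatrix, colorIndicator, Fin.ext_iff]
  split_ifs <;> first | omega | simp

theorem ospMatrix_bosonic (a b g e : ℂ) (i j : Color n) (hi : 2 ≤ (i : ℕ)) :
    ospMatrix n a b g e i j =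
      g * colorIndicator n i j + e * colorIndicator n (i + 1) j +
        e * if (i : ℕ) = 2 then colorIndicator n 0 j + colorIndicator n 1 j
          else colorIndicator n (i - 1) j := by
  simp only [ospMatrix, colorIndicator, Fin.ext_iff]
  split_ifs <;> first | omega | simp

theorem ospMatrix_symm (a b g e : ℂ) (i j : Color n) :
    ospMatrix n a b g e i j = ospMatrix n a b g e j i := by
  simp only [ospMatrix, Fin.ext_iff]
  split_ifs <;> first | omega | rfl

/-- A kernel vector is followed along the Dynkin diagram from the end n towards the fermionic fork.
The bosonic rows make it proportional to the solution u of the three-term recursion, and the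
fermionic rows allow this only for the zero vector. -/
theorem det_ospMatrix_ne_zero (hn : 1 ≤ n) (a b g e : ℂ) (u : ℕ → ℂ) (hab : a ≠ b) (he : e ≠ 0)
    (hu0 : u 0 = 0) (hu1 : u 1 ≠ 0) (hu : ∀ k, e * u (k + 2) + g * u (k + 1) + e * u k = 0)
    (hlast : (a + b) * u n + 2 * e * u (n - 1) ≠ 0) :
    (ospMatrix n a b g e).det ≠ 0 := by
  intro hdet
  obtain ⟨v, hv0, hv⟩ := Matrix.exists_mulVec_eq_zero_iff.2 hdet
  apply hv0
  set v' : ℕ → ℂ := fun k => if h : k < n + 1 then v ⟨k, h⟩ else 0 with hv'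
  have hval (j : Color n) : v' j = v j := dif_pos j.2
  -- The color 2 sees both fermionic colors with the same coefficient. Merging them into one node 1
  -- turns the fork into a chain, so the recursion also holds at k = 2.
  set w : ℕ → ℂ := fun k => if k = 1 then v' 0 + v' 1 else v' k with hw
  have hfer (i : Color n) (hi : (i : ℕ) ≤ 1) : a * v' i + b * v' (1 - i) + e * v' 2 = 0 := by
    have h := congrFun hv i
    simp only [Matrix.mulVec, dotProduct, ospMatrix_fermionic a b g e i _ hi, add_mul,
      Finset.sum_add_distrib, mul_assoc, ← Finset.mul_sum, sum_colorIndicator_mul] at h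
    exact h
  have hbos (k : ℕ) (hk : 2 ≤ k) (hkn : k ≤ n) : g * w k + e * w (k + 1) + e * w (k - 1) = 0 := by
    have hk' : k < n + 1 := by omega
    have h := congrFun hv ⟨k, hk'⟩
    simp only [Matrix.mulVec, dotProduct, ospMatrix_bosonic a b g e ⟨k, hk'⟩ _ hk, add_mul,
      Finset.sum_add_distrib, mul_assoc, ← Finset.mul_sum] at h
    by_cases h2 : k = 2
    · subst h2
      simp only [if_true, add_mul, Finset.sum_add_distrib, sum_colorIndicator_mul] at h
      exact h
    · simp only [if_neg h2, sum_colorIndicator_mul] at h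
      simp only [hw]
      rw [if_neg (by omega), if_neg (by omega), if_neg (by omega)]
      exact h
  have hwn : w (n + 1) = 0 := by simp [hw, hv', show n ≠ 0 by omega]
  -- The boundary value w (n + 1) = 0 matches u 0 = 0. Two consecutive values are carried along
  -- because the recursion has order two.
  have hrec : ∀ k, k + 1 ≤ n → w (n + 1 - k) * u 1 = u k * w n ∧
      w (n - k) * u 1 = u (k + 1) * w n := by
    intro k
    induction k with
    | zero =>
      intro _
      refine ⟨?_, ?_⟩
      · rw [Nat.sub_zero, hwn, hu0]
        ring
      · rw [Nat.sub_zero]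
        ring
    | succ k ih =>
      intro hk
      obtain ⟨h1, h2⟩ := ih (by omega)
      refine ⟨by rw [← h2]; congr 2; omega, ?_⟩
      have h := hbos (n - k) (by omega) (by omega)
      rw [show n - k + 1 = n + 1 - k by omega, show n - k - 1 = n - (k + 1) by omega] at h
      have := hu k
      apply mul_left_cancel₀ he
      linear_combination u 1 * h - g * h2 - e * h1 - w n * this
  -- The difference of the two fermionic rows forces equal fermionic entries, as a ≠ b; their sum
  -- involves only w 1 and w 2 and is the condition tested by `hlast`.
  have hf0 := hfer ⟨0, by omega⟩ (by simp)
  have hf1 := hfer ⟨1, by omega⟩ (by simp)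
  simp only [Nat.sub_zero, Nat.sub_self] at hf0 hf1
  have hdiff : v' 0 = v' 1 := by
    have : (a - b) * (v' 0 - v' 1) = 0 := by linear_combination hf0 - hf1
    rcases mul_eq_zero.1 this with h | h
    · exact absurd (sub_eq_zero.1 h) hab
    · exact sub_eq_zero.1 h
  have hw1 : w 1 * u 1 = u n * w n := by
    have := (hrec (n - 1) (by omega)).2
    rwa [show n - (n - 1) = 1 by omega, show n - 1 + 1 = n by omega] at this
  have hw2 : w 2 * u 1 = u (n - 1) * w n := by
    have := (hrec (n - 1) (by omega)).1
    rwa [show n + 1 - (n - 1) = 2 by omega] at this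
  have hwn0 : w n = 0 := by
    have h1 : w 1 = v' 0 + v' 1 := by simp [hw]
    have h2 : w 2 = v' 2 := by simp [hw]
    rw [h1] at hw1
    rw [h2] at hw2
    have : ((a + b) * u n + 2 * e * u (n - 1)) * w n = 0 := by
      linear_combination u 1 * (hf0 + hf1) - (a + b) * hw1 - 2 * e * hw2
    exact (mul_eq_zero.1 this).resolve_left hlast
  have hwk (k : ℕ) (hk : 1 ≤ k) (hkn : k ≤ n) : w k = 0 := by
    have := (hrec (n - k) (by omega)).2
    rw [hwn0, mul_zero, show n - (n - k) = k by omega] at this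
    exact (mul_eq_zero.1 this).resolve_right hu1
  have hv1 : v' 1 = 0 := by
    have : v' 0 + v' 1 = 0 := by simpa [hw] using hwk 1 le_rfl hn
    rw [hdiff] at this
    linear_combination this / 2
  funext j
  rw [← hval, Pi.zero_apply]
  rcases Nat.lt_or_ge j 2 with hj | hj
  · interval_cases hjj : (j : ℕ)
    · rw [hdiff, hv1]
    · exact hv1
  · have := hwk j (by omega) (by have := j.2; omega)
    simp only [hw] at this
    rwa [if_neg (by omega)] at this

theorem zeroCartan_eq (γ : ℂ) : zeroCartan n γ = ospMatrix n 1 (2 * γ - 1) (2 * γ) (-γ) := rfl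

theorem symCartan_eq (x y : ℂ) : symCartan n x y =
    ospMatrix n (t₃ x y * t₃ x y) (t₃ x y * (y * x⁻¹ - x * y⁻¹))
      (-((x - x⁻¹) * t₃ x y) * (y + y⁻¹)) (t₃ x y * (x - x⁻¹)) := by
  funext i j
  simp only [symCartan, cartan, ospMatrix, Fin.ext_iff]
  split_ifs <;> first | omega | ring

end Matrices

/-! ### Generic parameters and nondegeneracy of B^{[r]} and K -/

section Parameters

variable (P : Params)

/-- The number `s₁^{ra} q^{rb}`. -/
def Params.mono (r a b : ℤ) : ℂ := Complex.exp (r * (a * P.l₁ + b * P.l₂))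

theorem mono_mul (r a b a' b' : ℤ) :
    P.mono r a b * P.mono r a' b' = P.mono r (a + a') (b + b') := by
  rw [Params.mono, Params.mono, Params.mono, ← Complex.exp_add]
  congr 1
  push_cast
  ring

theorem mono_neg (r a b : ℤ) : P.mono (-r) a b = P.mono r (-a) (-b) := by
  rw [Params.mono, Params.mono]
  congr 1
  push_cast
  ring

theorem mono_inv (r a b : ℤ) : (P.mono r a b)⁻¹ = P.mono r (-a) (-b) := by
  rw [Params.mono, Params.mono, ← Complex.exp_neg]
  congr 1
  push_cast
  ring

theorem mono_zero (r : ℤ) : P.mono r 0 0 = 1 := by simp [Params.mono]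

theorem mono_ne_one {r : ℤ} (hr : r ≠ 0) {a b : ℤ} (h : a ≠ 0 ∨ b ≠ 0) : P.mono r a b ≠ 1 := by
  intro h1
  have := P.generic (r * a) (r * b) (by
    rw [← h1, Params.mono]
    congr 1
    push_cast
    ring)
  simp only [mul_eq_zero, hr, false_or] at this
  tauto

theorem mono_sub_ne_zero {r : ℤ} (hr : r ≠ 0) {a b a' b' : ℤ} (h : a ≠ a' ∨ b ≠ b') :
    P.mono r a b - P.mono r a' b' ≠ 0 := by
  intro h1
  apply mono_ne_one P hr (a := a - a') (b := b - b')
  · rcases h with h | h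
    · exact Or.inl (sub_ne_zero.2 h)
    · exact Or.inr (sub_ne_zero.2 h)
  · rw [sub_eq_add_neg a, sub_eq_add_neg b, ← mono_mul, ← mono_inv, sub_eq_zero.1 h1]
    exact mul_inv_cancel₀ (Complex.exp_ne_zero _)

/-- If x = -y then x² = y², which genericity excludes for the doubled exponents. -/
theorem mono_add_ne_zero {r : ℤ} (hr : r ≠ 0) {a b a' b' : ℤ} (h : a ≠ a' ∨ b ≠ b') :
    P.mono r a b + P.mono r a' b' ≠ 0 := by
  intro h1
  have h2 : P.mono r (a + a) (b + b) - P.mono r (a' + a') (b' + b') ≠ 0 :=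
    mono_sub_ne_zero P hr (by omega)
  apply h2
  rw [← mono_mul, ← mono_mul]
  linear_combination (P.mono r a b - P.mono r a' b') * h1

theorem s₁_zpow (r : ℤ) : P.s₁ ^ r = P.mono r 1 0 := by
  rw [Params.s₁, ← Complex.exp_int_mul]
  simp [Params.mono]

theorem q_zpow (r : ℤ) : P.q ^ r = P.mono r 0 1 := by
  rw [Params.q, ← Complex.exp_int_mul]
  simp [Params.mono]

theorem t₃Pow_eq (r : ℤ) : t₃Pow P r = P.mono r (-1) (-1) - P.mono r 1 1 := by
  rw [t₃Pow, t₃, s₁_zpow, q_zpow, mono_mul, mono_inv]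
  simp

theorem t₃Pow_ne_zero {r : ℤ} (hr : r ≠ 0) : t₃Pow P r ≠ 0 := by
  rw [t₃Pow_eq]
  exact mono_sub_ne_zero P hr (by omega)

theorem symCartanPow_eq (n : ℕ) (r : ℤ) : symCartanPow P n r =
    ospMatrix n (t₃Pow P r * t₃Pow P r) (t₃Pow P r * (P.mono r (-1) 1 - P.mono r 1 (-1)))
      (-(t₃Pow P r * (P.mono r 1 0 - P.mono r (-1) 0) * (P.mono r 0 1 + P.mono r 0 (-1))))
      (t₃Pow P r * (P.mono r 1 0 - P.mono r (-1) 0)) := by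
  rw [symCartanPow, symCartan_eq, ← t₃Pow, s₁_zpow, q_zpow, mono_inv, mono_inv, mono_mul, mono_mul]
  congr 1
  simp only [neg_zero]
  ring

theorem t₃Pow_neg (r : ℤ) : t₃Pow P (-r) = -t₃Pow P r := by
  rw [t₃Pow_eq, t₃Pow_eq, mono_neg, mono_neg]
  simp

theorem symCartanPow_neg (n : ℕ) (r : ℤ) : symCartanPow P n (-r) = symCartanPow P n r := by
  rw [symCartanPow_eq, symCartanPow_eq, t₃Pow_neg]
  simp only [mono_neg, neg_neg, neg_zero]
  congr 1 <;> ring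

theorem symCartanPow_transpose (n : ℕ) (r : ℤ) :
    (symCartanPow P n r).transpose = symCartanPow P n r := by
  funext i j
  rw [Matrix.transpose_apply, symCartanPow_eq, ospMatrix_symm]

/-- The recursion is solved by u_k = q^{rk} - q^{-rk}. The condition a ≠ b amounts to (s₁ + s₁⁻¹)(q
- q⁻¹) ≠ 0, and the closing quantity is -t₃ t₁ (q - q⁻¹)(qⁿ + q⁻ⁿ), all taken at r-th powers;
genericity makes every factor nonzero. -/
theorem isUnit_det_symCartanPow {n : ℕ} (hn : 1 ≤ n) {r : ℤ} (hr : r ≠ 0) :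
    IsUnit (symCartanPow P n r).det := by
  rw [isUnit_iff_ne_zero, symCartanPow_eq]
  have h3 := t₃Pow_ne_zero P hr
  have h1 : P.mono r 1 0 - P.mono r (-1) 0 ≠ 0 := mono_sub_ne_zero P hr (by omega)
  have hy : P.mono r 0 1 - P.mono r 0 (-1) ≠ 0 := mono_sub_ne_zero P hr (by omega)
  apply det_ospMatrix_ne_zero hn (u := fun k : ℕ => P.mono r 0 k - P.mono r 0 (-k))
  · intro h
    have h' := mul_left_cancel₀ h3 h
    have h'' : (P.mono r 1 0 + P.mono r (-1) 0) * (P.mono r 0 1 - P.mono r 0 (-1)) = 0 := by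
      rw [t₃Pow_eq] at h'
      simp only [add_mul, mul_sub, mono_mul]
      simp only [add_zero, zero_add]
      linear_combination -h'
    rcases mul_eq_zero.1 h'' with h | h
    · exact mono_add_ne_zero P hr (by omega) h
    · exact hy h
  · exact mul_ne_zero h3 h1
  · simp
  · simpa using hy
  · intro k
    have h : (P.mono r 0 1 + P.mono r 0 (-1)) *
        (P.mono r 0 ((k + 1 : ℕ) : ℤ) - P.mono r 0 (-((k + 1 : ℕ) : ℤ))) =
        P.mono r 0 ((k + 2 : ℕ) : ℤ) - P.mono r 0 (-((k + 2 : ℕ) : ℤ)) +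
          (P.mono r 0 k - P.mono r 0 (-k)) := by
      simp only [add_mul, mul_sub, mono_mul]
      push_cast
      ring_nf
    linear_combination -(t₃Pow P r * (P.mono r 1 0 - P.mono r (-1) 0)) * h
  · obtain ⟨m, rfl⟩ : ∃ m, n = m + 1 := ⟨n - 1, by omega⟩
    have h : t₃Pow P r + (P.mono r (-1) 1 - P.mono r 1 (-1)) =
        -((P.mono r 1 0 - P.mono r (-1) 0) * (P.mono r 0 1 + P.mono r 0 (-1))) := by
      rw [t₃Pow_eq]
      simp only [sub_mul, mul_add, mono_mul]
      simp only [add_zero, zero_add]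
      ring
    have h' : (P.mono r 0 1 + P.mono r 0 (-1)) *
          (P.mono r 0 ((m + 1 : ℕ) : ℤ) - P.mono r 0 (-((m + 1 : ℕ) : ℤ))) -
          2 * (P.mono r 0 m - P.mono r 0 (-m)) =
        (P.mono r 0 1 - P.mono r 0 (-1)) *
          (P.mono r 0 ((m + 1 : ℕ) : ℤ) + P.mono r 0 (-((m + 1 : ℕ) : ℤ))) := by
      simp only [add_mul, mul_sub, sub_mul, mul_add, mono_mul]
      push_cast
      ring_nf
    have h4 : P.mono r 0 ((m + 1 : ℕ) : ℤ) + P.mono r 0 (-((m + 1 : ℕ) : ℤ)) ≠ 0 :=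
      mono_add_ne_zero P hr (Or.inr (by omega))
    have h5 := mul_ne_zero (mul_ne_zero h3 h1) (mul_ne_zero hy h4)
    intro h6
    apply h5
    rw [Nat.add_sub_cancel] at h6
    linear_combination -h6 +
      t₃Pow P r * (P.mono r 0 ((m + 1 : ℕ) : ℤ) - P.mono r 0 (-((m + 1 : ℕ) : ℤ))) * h -
      t₃Pow P r * (P.mono r 1 0 - P.mono r (-1) 0) * h'

theorem l₁_ne_zero : P.l₁ ≠ 0 := by
  intro h
  have := P.generic 1 0 (by simp [h])
  omega

theorem l₂_ne_zero : P.l₂ ≠ 0 := by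
  intro h
  have := P.generic 0 1 (by simp [h])
  omega

theorem l₁_add_l₂_ne_zero : P.l₁ + P.l₂ ≠ 0 := by
  intro h
  have := P.generic 1 1 (by simp [h])
  omega

theorem γ_ne_zero : P.γ ≠ 0 := div_ne_zero (l₁_ne_zero P) (l₁_add_l₂_ne_zero P)

theorem γ_mul : P.γ * (P.l₁ + P.l₂) = P.l₁ := div_mul_cancel₀ _ (l₁_add_l₂_ne_zero P)

/-- In the limit the recursion is solved by u_k = k. The condition a ≠ b becomes γ ≠ 1, that is ℓ₂ ≠
0, and the closing quantity is 2γ. -/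
theorem isUnit_det_zeroCartan {n : ℕ} (hn : 1 ≤ n) : IsUnit (zeroCartan n P.γ).det := by
  rw [isUnit_iff_ne_zero, zeroCartan_eq]
  have hγ := γ_ne_zero P
  apply det_ospMatrix_ne_zero hn (u := fun k : ℕ => (k : ℂ))
  · intro h
    apply l₂_ne_zero P
    have h1 : P.γ = 1 := by linear_combination -h / 2
    have h2 := γ_mul P
    rw [h1] at h2
    linear_combination h2
  · exact neg_ne_zero.2 hγ
  · simp
  · simp
  · intro k
    push_cast
    ring
  · obtain ⟨m, rfl⟩ : ∃ m, n = m + 1 := ⟨n - 1, by omega⟩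
    rw [Nat.add_sub_cancel]
    intro h
    apply hγ
    push_cast at h
    linear_combination h / 2

theorem zeroCartan_transpose (n : ℕ) (γ : ℂ) : (zeroCartan n γ).transpose = zeroCartan n γ := by
  funext i j
  rw [Matrix.transpose_apply, zeroCartan_eq, ospMatrix_symm]

end Parameters

/-! ### Pairings of bosonized monomials -/

theorem shift_shift {J : Type*} (l l' : ℂ) (V : Vertex J) :
    (V.shift l).shift l' = V.shift (l + l') := by
  refine Prod.ext rfl (Prod.ext rfl ?_)
  funext r j
  by_cases hr : r = 0
  · simp [Vertex.shift, Vertex.modes, Vertex.power, hr]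
    ring
  · simp only [Vertex.shift, Vertex.modes, hr, if_false, add_zero]
    rw [← mul_assoc, ← Complex.exp_add]
    congr 2
    ring

theorem shift_add {J : Type*} (l : ℂ) (V W : Vertex J) :
    (V + W).shift l = V.shift l + W.shift l := by
  refine Prod.ext rfl (Prod.ext rfl ?_)
  funext r j
  simp only [Vertex.shift, Vertex.modes, Vertex.power, Prod.fst_add, Prod.snd_add, Pi.add_apply]
  split_ifs <;> ring

/-- `Vertex.shift` as a homomorphism. -/
def shiftHom {J : Type*} (l : ℂ) : Vertex J →+ Vertex J :=
  AddMonoidHom.mk' (Vertex.shift l) (shift_add l)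

theorem shiftHom_apply {J : Type*} (l : ℂ) (V : Vertex J) : shiftHom l V = V.shift l := rfl

section Pairings

open Matrix

variable (P : Params) (n : ℕ)

/-- `bosonize` as a homomorphism. -/
def bosonizeHom : Mono n →+ Vertex (Color n) :=
  Finsupp.liftAddHom fun k =>
    zmultiplesHom _ ((Y P n k.1).shift (k.2.1 * P.l₁ + k.2.2 * P.l₂))

theorem bosonizeHom_apply (m : Mono n) : bosonizeHom P n m = bosonize P n m := rfl

/-- The coefficients of the `Y_{i,r}` in the `r`-th mode of a monomial. -/
def evalMode (r : ℤ) : Mono n →+ (Color n → ℂ) :=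
  Finsupp.liftAddHom fun k =>
    zmultiplesHom _ fun j => colorIndicator n k.1 j * P.mono r (-k.2.1) (-k.2.2)

/-- The coefficient of `x_{i,r}` in the `r`-th mode of `Y_i`. -/
def yFactor (r : ℤ) (i : Color n) : ℂ :=
  if (i : ℕ) ≤ 1 then -1 else P.mono r (-1) 0 - P.mono r 1 0

/-- The coefficients of the `x_{i,0}` in the constant part of the zero mode of a monomial. -/
def evalZero : Mono n →+ (Color n → ℂ) :=
  Finsupp.liftAddHom fun k =>
    zmultiplesHom _ fun j => colorIndicator n k.1 j *
      if (j : ℕ) ≤ 1 then -(k.2.1 * P.l₁ + k.2.2 * P.l₂) else 2 * P.l₁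

/-- The coefficients of the `Q_{x_i}` in a monomial. -/
def evalCharge : Mono n →+ (Color n → ℂ) :=
  Finsupp.liftAddHom fun k =>
    zmultiplesHom _ fun j => colorIndicator n k.1 j * if (j : ℕ) ≤ 1 then -1 else 0

variable {n}

theorem apply_var {G : Type*} [AddCommGroup G] (F : Mono n →+ (Color n → G))
    (i : ℕ) (a b : ℤ) (j : Color n) :
    F (var n i a b) j = if h : i < n + 1 then F (Finsupp.single (⟨i, h⟩, a, b) 1) j else 0 := by
  rw [var]
  split_ifs
  · rfl
  · simp

theorem colorIndicator_eq_zero {i : ℕ} (h : ¬i < n + 1) (j : Color n) :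
    colorIndicator n i j = 0 := if_neg (by have := j.2; omega)

theorem evalMode_var (r : ℤ) (i : ℕ) (a b : ℤ) (j : Color n) :
    evalMode P n r (var n i a b) j = colorIndicator n i j * P.mono r (-a) (-b) := by
  rw [apply_var]
  split_ifs with h
  · simp [evalMode]
  · rw [colorIndicator_eq_zero h, zero_mul]

theorem evalZero_var (i : ℕ) (a b : ℤ) (j : Color n) :
    evalZero P n (var n i a b) j = colorIndicator n i j *
      if (j : ℕ) ≤ 1 then -(a * P.l₁ + b * P.l₂) else 2 * P.l₁ := by
  rw [apply_var]
  split_ifs with h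
  · simp [evalZero, *]
  · simp [evalZero, *]
  · rw [colorIndicator_eq_zero h, zero_mul]
  · rw [colorIndicator_eq_zero h, zero_mul]

theorem evalCharge_var (i : ℕ) (a b : ℤ) (j : Color n) :
    evalCharge n (var n i a b) j = colorIndicator n i j * if (j : ℕ) ≤ 1 then -1 else 0 := by
  rw [apply_var]
  split_ifs with h
  · simp [evalCharge, *]
  · simp [evalCharge, *]
  · rw [colorIndicator_eq_zero h, zero_mul]
  · rw [colorIndicator_eq_zero h, zero_mul]

theorem Y_modes {r : ℤ} (hr : r ≠ 0) (i k : Color n) :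
    (Y P n i).modes r k = yFactor P n r i * (t₃Pow P r ^ 2 * (symCartanPow P n r)⁻¹ i k) := by
  have hX (l : ℂ) : ((X P n i).shift l).modes r k =
      Complex.exp (-(r : ℂ) * l) * (t₃Pow P r ^ 2 * (symCartanPow P n r)⁻¹ i k) := by
    simp [Vertex.shift, Vertex.modes, X, hr]
  rw [Y, yFactor]
  split_ifs with h
  · change -(X P n i).modes r k = _
    simp [Vertex.modes, X, hr]
  · change ((X P n i).shift P.l₁).modes r k - ((X P n i).shift (-P.l₁)).modes r k = _
    rw [hX, hX, sub_mul, Params.mono, Params.mono]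
    congr 2 <;> · congr 1; push_cast; ring

theorem Y_modes_zero (i k : Color n) (l : ℂ) :
    ((Y P n i).shift l).modes 0 k =
      (if (i : ℕ) ≤ 1 then -l else 2 * P.l₁) * (zeroCartan n P.γ)⁻¹ i k := by
  rw [Y]
  split_ifs with h
  · have : ((-X P n i).shift l).modes 0 k = -(X P n i).modes 0 k + l * -(X P n i).power k := by
      simp [Vertex.shift, Vertex.modes, Vertex.power]
    rw [this]
    simp [Vertex.modes, Vertex.power, X]
  · have h1 (l' : ℂ) : ((X P n i).shift l').modes 0 k = l' * (zeroCartan n P.γ)⁻¹ i k := by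
      simp [Vertex.shift, Vertex.modes, Vertex.power, X]
    have : (((X P n i).shift P.l₁ - (X P n i).shift (-P.l₁)).shift l).modes 0 k =
        (((X P n i).shift P.l₁).modes 0 k - ((X P n i).shift (-P.l₁)).modes 0 k) +
          l * ((X P n i).power k - (X P n i).power k) := by
      simp [Vertex.shift, Vertex.modes, Vertex.power]
    rw [this, h1, h1]
    ring

theorem Y_power (i k : Color n) :
    (Y P n i).power k = (if (i : ℕ) ≤ 1 then -1 else 0) * (zeroCartan n P.γ)⁻¹ i k := by
  rw [Y]
  split_ifs with h
  · change -(X P n i).power k = _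
    simp [Vertex.power, X]
  · change (X P n i).power k - (X P n i).power k = _
    simp

theorem Y_charge (i k : Color n) : (Y P n i).charge k = (Y P n i).power k := by
  rw [Y]
  split_ifs with h <;> rfl

theorem vecMul_colorIndicator (i : Color n) (f : Color n → ℂ) (M : Matrix (Color n) (Color n) ℂ) :
    (fun j => colorIndicator n i j * f j) ᵥ* M = fun k => f i * M i k := by
  funext k
  simp only [vecMul, dotProduct, mul_assoc, sum_colorIndicator_mul]
  rw [dif_pos i.2]

theorem bosonize_modes {r : ℤ} (hr : r ≠ 0) (m : Mono n) :
    (bosonize P n m).modes r = (t₃Pow P r ^ 2) •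
      ((fun i => evalMode P n r m i * yFactor P n r i) ᵥ* (symCartanPow P n r)⁻¹) := by
  rw [← bosonizeHom_apply]
  induction m using Finsupp.induction_linear with
  | zero =>
    simp only [map_zero, Pi.zero_apply, zero_mul]
    funext k
    simp [vecMul, dotProduct, Vertex.modes]
  | add m m' h h' =>
    have h1 : (bosonizeHom P n (m + m')).modes r =
        (bosonizeHom P n m).modes r + (bosonizeHom P n m').modes r := by
      rw [map_add]
      rfl
    have h2 : (fun i => evalMode P n r (m + m') i * yFactor P n r i) =
        (fun i => evalMode P n r m i * yFactor P n r i) +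
          fun i => evalMode P n r m' i * yFactor P n r i := by
      funext i
      rw [map_add, Pi.add_apply, add_mul]
      rfl
    rw [h1, h, h', h2, add_vecMul, smul_add]
  | single k z =>
    have h1 : (bosonizeHom P n (Finsupp.single k z)).modes r = fun j => (z : ℂ) *
        (P.mono r (-k.2.1) (-k.2.2) * (Y P n k.1).modes r j) := by
      rw [bosonizeHom, Finsupp.liftAddHom_apply_single, zmultiplesHom_apply]
      funext j
      change z • (((Y P n k.1).shift _).modes r j) = _
      rw [zsmul_eq_mul]
      congr 1
      simp only [Vertex.shift, Vertex.modes, hr, if_false, add_zero, Params.mono]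
      congr 2
      push_cast
      ring
    have h2 : (fun i => evalMode P n r (Finsupp.single k z) i * yFactor P n r i) =
        fun i => colorIndicator n k.1 i *
          (z * P.mono r (-k.2.1) (-k.2.2) * yFactor P n r i) := by
      funext i
      rw [evalMode, Finsupp.liftAddHom_apply_single, zmultiplesHom_apply, Pi.smul_apply,
        zsmul_eq_mul]
      ring
    rw [h1, h2, vecMul_colorIndicator]
    funext j
    rw [Y_modes P hr, Pi.smul_apply, smul_eq_mul]
    ring

theorem bosonize_modes_zero (m : Mono n) :
    (bosonize P n m).modes 0 = evalZero P n m ᵥ* (zeroCartan n P.γ)⁻¹ := by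
  rw [← bosonizeHom_apply]
  induction m using Finsupp.induction_linear with
  | zero =>
    rw [map_zero, map_zero, zero_vecMul]
    rfl
  | add m m' h h' =>
    rw [map_add, map_add, add_vecMul, ← h, ← h']
    rfl
  | single k z =>
    have h2 : evalZero P n (Finsupp.single k z) =
        fun i => colorIndicator n k.1 i *
          (z * if (i : ℕ) ≤ 1 then -(k.2.1 * P.l₁ + k.2.2 * P.l₂) else 2 * P.l₁) := by
      funext i
      rw [evalZero, Finsupp.liftAddHom_apply_single, zmultiplesHom_apply, Pi.smul_apply,
        zsmul_eq_mul]
      ring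
    rw [h2, vecMul_colorIndicator]
    funext j
    rw [bosonizeHom, Finsupp.liftAddHom_apply_single, zmultiplesHom_apply]
    change z • (((Y P n k.1).shift _).modes 0 j) = _
    rw [zsmul_eq_mul, Y_modes_zero]
    ring

theorem bosonize_power (m : Mono n) :
    (bosonize P n m).power = evalCharge n m ᵥ* (zeroCartan n P.γ)⁻¹ := by
  rw [← bosonizeHom_apply]
  induction m using Finsupp.induction_linear with
  | zero =>
    rw [map_zero, map_zero, zero_vecMul]
    rfl
  | add m m' h h' =>
    rw [map_add, map_add, add_vecMul, ← h, ← h']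
    rfl
  | single k z =>
    have h2 : evalCharge n (Finsupp.single k z) =
        fun i => colorIndicator n k.1 i * (z * if (i : ℕ) ≤ 1 then -1 else 0) := by
      funext i
      rw [evalCharge, Finsupp.liftAddHom_apply_single, zmultiplesHom_apply, Pi.smul_apply,
        zsmul_eq_mul]
      ring
    rw [h2, vecMul_colorIndicator]
    funext j
    rw [bosonizeHom, Finsupp.liftAddHom_apply_single, zmultiplesHom_apply]
    change z • ((Y P n k.1).power j) = _
    rw [zsmul_eq_mul, Y_power]
    ring

theorem bosonize_charge (m : Mono n) : (bosonize P n m).charge = (bosonize P n m).power := by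
  rw [← bosonizeHom_apply]
  induction m using Finsupp.induction_linear with
  | zero => rw [map_zero]; rfl
  | add m m' h h' =>
    rw [map_add]
    change (bosonizeHom P n m).charge + (bosonizeHom P n m').charge =
      (bosonizeHom P n m).power + (bosonizeHom P n m').power
    rw [h, h']
  | single k z =>
    rw [bosonizeHom, Finsupp.liftAddHom_apply_single, zmultiplesHom_apply]
    funext j
    change z • ((Y P n k.1).charge j) = z • ((Y P n k.1).power j)
    rw [Y_charge]

theorem bosonize_shift (m : Mono n) (a b : ℤ) :
    (bosonize P n m).shift (a * P.l₁ + b * P.l₂) =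
      bosonize P n (Finsupp.mapDomain (fun k => (k.1, k.2.1 + a, k.2.2 + b)) m) := by
  rw [← bosonizeHom_apply, ← bosonizeHom_apply, ← shiftHom_apply]
  induction m using Finsupp.induction_linear with
  | zero => rw [Finsupp.mapDomain_zero, map_zero, map_zero]
  | add m m' h h' => rw [Finsupp.mapDomain_add, map_add, map_add, map_add, ← h, ← h']
  | single k z =>
    rw [Finsupp.mapDomain_single, bosonizeHom, Finsupp.liftAddHom_apply_single,
      Finsupp.liftAddHom_apply_single, zmultiplesHom_apply, zmultiplesHom_apply, map_zsmul,
      shiftHom_apply, shift_shift]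
    congr 2
    push_cast
    ring

/-- The bilinear form `r ⟨m(z) m'(w)⟩_r` on monomials. -/
def monoPairing (r : ℤ) (m m' : Mono n) : ℂ :=
  -t₃Pow P r ^ 2 * (((fun i => evalMode P n r m i * yFactor P n r i) ᵥ* (symCartanPow P n r)⁻¹) ⬝ᵥ
    fun i => evalMode P n (-r) m' i * yFactor P n (-r) i)

theorem symCartanPow_inv_transpose (r : ℤ) :
    ((symCartanPow P n r)⁻¹)ᵀ = (symCartanPow P n r)⁻¹ := by
  rw [transpose_nonsing_inv, symCartanPow_transpose]

theorem zeroCartan_inv_transpose (γ : ℂ) : ((zeroCartan n γ)⁻¹)ᵀ = (zeroCartan n γ)⁻¹ := by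
  rw [transpose_nonsing_inv, zeroCartan_transpose]

/-- B^{[r]} is symmetric and even in r, and the odd function t₃^{[r]} enters through its square.
Reversing the order of two vertex operators thus inverts the poles and zeros of their contraction.
-/
theorem monoPairing_symm (r : ℤ) (m m' : Mono n) :
    monoPairing P r m m' = monoPairing P (-r) m' m := by
  rw [monoPairing, monoPairing, neg_neg, t₃Pow_neg, neg_sq, symCartanPow_neg, dotProduct_comm,
    ← dotProduct_mulVec, ← vecMul_transpose, symCartanPow_inv_transpose]

/-- Each mode vector carries a factor B⁻¹ and the commutator a factor B, so exactly one inverse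
survives, as in `monoPairing`. -/
theorem modePairing_bosonize (hn : 1 ≤ n) (m m' : Mono n) (r : ℕ) (hr : r ≠ 0) :
    modePairing (screeningAlgebra P n) (bosonize P n m) (bosonize P n m') r =
      monoPairing P r m m' / r := by
  have hr' : (r : ℤ) ≠ 0 := by exact_mod_cast hr
  have h3 := t₃Pow_ne_zero P hr'
  have hB := isUnit_det_symCartanPow P hn hr'
  have h (f g : Color n → ℂ) : ∑ j, ∑ k, f j * (screeningAlgebra P n).comm r j k * g k =
      -(1 / (r : ℂ)) * (t₃Pow P r ^ 2)⁻¹ * (f ⬝ᵥ (symCartanPow P n r *ᵥ g)) := by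
    simp only [dotProduct, mulVec, Finset.mul_sum, screeningAlgebra]
    refine Finset.sum_congr rfl fun j _ => Finset.sum_congr rfl fun k _ => ?_
    ring
  rw [modePairing, h, bosonize_modes P hr', bosonize_modes P (neg_ne_zero.2 hr'), t₃Pow_neg, neg_sq,
    symCartanPow_neg, smul_dotProduct, mulVec_smul, dotProduct_smul, ← mulVec_transpose _
    (fun i => evalMode P n (-(r : ℤ)) m' i * yFactor P n (-(r : ℤ)) i), symCartanPow_inv_transpose,
    mulVec_mulVec, mul_nonsing_inv _ hB, one_mulVec, monoPairing, smul_eq_mul, smul_eq_mul]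
  field_simp

theorem zeroPairing_bosonize (hn : 1 ≤ n) (c : Color n → ℂ) (m : Mono n) :
    zeroPairing (screeningAlgebra P n) (c ᵥ* (zeroCartan n P.γ)⁻¹) (bosonize P n m).charge =
      (c ᵥ* (zeroCartan n P.γ)⁻¹) ⬝ᵥ evalCharge n m := by
  have hK := isUnit_det_zeroCartan P hn
  have h (f g : Color n → ℂ) : zeroPairing (screeningAlgebra P n) f g =
      f ⬝ᵥ (zeroCartan n P.γ *ᵥ g) := by
    simp only [zeroPairing, dotProduct, mulVec, Finset.mul_sum, screeningAlgebra]
    refine Finset.sum_congr rfl fun j _ => Finset.sum_congr rfl fun k _ => ?_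
    ring
  rw [h, bosonize_charge, bosonize_power, ← mulVec_transpose _ (evalCharge n m),
    zeroCartan_inv_transpose, mulVec_mulVec, mul_nonsing_inv _ hK, one_mulVec]

theorem monoPairing_add_left (r : ℤ) (m m' m'' : Mono n) :
    monoPairing P r (m + m') m'' = monoPairing P r m m'' + monoPairing P r m' m'' := by
  have h2 : (fun i => evalMode P n r (m + m') i * yFactor P n r i) =
      (fun i => evalMode P n r m i * yFactor P n r i) +
        fun i => evalMode P n r m' i * yFactor P n r i := by
    funext i
    rw [map_add, Pi.add_apply, add_mul]
    rfl
  rw [monoPairing, h2, add_vecMul, add_dotProduct, mul_add]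
  rfl

/-- `monoPairing` as a homomorphism in its first argument. -/
def monoPairingHom (r : ℤ) (m' : Mono n) : Mono n →+ ℂ :=
  AddMonoidHom.mk' (fun m => monoPairing P r m m') fun m m'' => monoPairing_add_left P r m m'' m'

/-- `monoPairing` as a homomorphism in its second argument. -/
def monoPairingHomRight (r : ℤ) (m : Mono n) : Mono n →+ ℂ :=
  AddMonoidHom.mk' (fun m' => monoPairing P r m m') fun m' m'' => by
    rw [monoPairing_symm, monoPairing_add_left, ← monoPairing_symm, ← monoPairing_symm]

/-- A row of M times M⁻¹ is a basis vector. This is why the inverse Cartan matrix never has to be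
computed for affine roots. -/
theorem vecMul_row_inv {M : Matrix (Color n) (Color n) ℂ} (hM : IsUnit M.det) (c : ℂ) (k : Color n)
    (f : Color n → ℂ) (hf : ∀ j, f j = c * M k j) (g : Color n → ℂ) :
    (f ᵥ* M⁻¹) ⬝ᵥ g = c * g k := by
  have h : f = c • (Pi.single k (1 : ℂ) ᵥ* M) := by
    funext j
    simp [hf]
  rw [h, smul_vecMul, vecMul_vecMul, mul_nonsing_inv _ hM, vecMul_one, smul_dotProduct]
  simp

theorem monoPairing_of_row (hn : 1 ≤ n) {r : ℤ} (hr : r ≠ 0) (c : ℂ) (k : Color n) (m m' : Mono n)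
    (h : ∀ j, evalMode P n r m j * yFactor P n r j = c * symCartanPow P n r k j) :
    monoPairing P r m m' =
      -t₃Pow P r ^ 2 * c * (evalMode P n (-r) m' k * yFactor P n (-r) k) := by
  rw [monoPairing, vecMul_row_inv (isUnit_det_symCartanPow P hn hr) c k _ h, mul_assoc]

end Pairings

/-! ### Affine roots and their pairings -/

section Roots

open Matrix

variable (P : Params) {n : ℕ}

/-- The monomial of the affine root of the bosonic color `i`, at `s₁^a q^k`. -/
def rootBos (n i : ℕ) (a k : ℤ) : Mono n :=
  var n i a (k + 1) + var n i a (k - 1) - var n (i + 1) a k +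
    if i = 2 then var n 1 (a + 1) k - var n 1 (a - 1) k + (var n 0 (a + 1) k - var n 0 (a - 1) k)
    else -var n (i - 1) a k

/-- The monomial of the affine root of the fermionic color `c`, at `s₁^a q^k`; here `c'` is the
other fermionic color. -/
def rootFer (n c c' : ℕ) (a k : ℤ) : Mono n :=
  var n 2 a k + var n c (a + 1) (k + 1) - var n c (a - 1) (k - 1) - var n c' (a - 1) (k + 1)
    + var n c' (a + 1) (k - 1)

/-- The function `t₁^{[r]}`. -/
def t₁Pow (r : ℤ) : ℂ := P.mono r 1 0 - P.mono r (-1) 0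

theorem t₁Pow_neg (r : ℤ) : t₁Pow P (-r) = -t₁Pow P r := by
  simp [t₁Pow, mono_neg]

theorem colorIndicator_mul_yFactor (r : ℤ) (i : ℕ) (j : Color n) :
    colorIndicator n i j * yFactor P n r j =
      colorIndicator n i j * if i ≤ 1 then -1 else -t₁Pow P r := by
  rw [colorIndicator, yFactor, t₁Pow]
  split_ifs <;> first | omega | ring

/-- After multiplication by `yFactor` the mode vector of the root is row i of B^{[r]} divided by
t₃^{[r]}, up to the shift monomial. The exponents in `rootBos` are chosen exactly for this. -/
theorem monoPairing_rootBos (hn : 1 ≤ n) {r : ℤ} (hr : r ≠ 0) (i : Color n) (hi : 2 ≤ (i : ℕ))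
    (a k : ℤ) (m : Mono n) :
    monoPairing P r (rootBos n i a k) m =
      -(P.mono r (-a) (-k) * t₃Pow P r * t₁Pow P r * evalMode P n (-r) m i) := by
  have h3 := t₃Pow_ne_zero P hr
  have hy : yFactor P n (-r) i = t₁Pow P r := by
    rw [yFactor, if_neg (by omega), t₁Pow, mono_neg, mono_neg]
    simp
  rw [monoPairing_of_row P hn hr (P.mono r (-a) (-k) / t₃Pow P r) i _ m, hy]
  · field_simp
  intro j
  have e1 : P.mono r (-a) (-(k + 1)) = P.mono r (-a) (-k) * P.mono r 0 (-1) := by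
    rw [mono_mul]; congr 1 <;> ring
  have e2 : P.mono r (-a) (-(k - 1)) = P.mono r (-a) (-k) * P.mono r 0 1 := by
    rw [mono_mul]; congr 1 <;> ring
  have e3 : P.mono r (-(a + 1)) (-k) = P.mono r (-a) (-k) * P.mono r (-1) 0 := by
    rw [mono_mul]; congr 1 <;> ring
  have e4 : P.mono r (-(a - 1)) (-k) = P.mono r (-a) (-k) * P.mono r 1 0 := by
    rw [mono_mul]; congr 1 <;> ring
  have hI (i : ℕ) (x : ℂ) : colorIndicator n i j * x * yFactor P n r j =
      colorIndicator n i j * (x * if i ≤ 1 then -1 else -t₁Pow P r) := by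
    rw [mul_right_comm, colorIndicator_mul_yFactor]
    ring
  rw [symCartanPow_eq, ospMatrix_bosonic _ _ _ _ i j hi, ← t₁Pow, rootBos]
  have hi1 : ¬(i : ℕ) ≤ 1 := by omega
  have hi2 : ¬(i : ℕ) + 1 ≤ 1 := by omega
  by_cases h2 : (i : ℕ) = 2
  · simp only [if_pos h2, map_add, map_sub, Pi.add_apply, Pi.sub_apply, evalMode_var, add_mul,
      sub_mul, hI, if_neg hi1, if_neg hi2, e1, e2, e3, e4, le_refl, zero_le, if_true]
    rw [t₁Pow]
    field_simp
    ring
  · have hi3 : ¬(i : ℕ) - 1 ≤ 1 := by omega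
    simp only [if_neg h2, map_add, map_sub, map_neg, Pi.add_apply, Pi.sub_apply, Pi.neg_apply,
      evalMode_var, add_mul, sub_mul, neg_mul, hI, if_neg hi1, if_neg hi2, if_neg hi3, e1, e2]
    field_simp
    ring

/-- The same mechanism with a fermionic row of B^{[r]}; the sign of the factor is opposite because
`yFactor` is -1 there. -/
theorem monoPairing_rootFer (hn : 1 ≤ n) {r : ℤ} (hr : r ≠ 0) (c : Color n) (c' : ℕ)
    (hc : (c : ℕ) + c' = 1) (a k : ℤ) (m : Mono n) :
    monoPairing P r (rootFer n c c' a k) m =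
      -(P.mono r (-a) (-k) * t₃Pow P r * evalMode P n (-r) m c) := by
  have h3 := t₃Pow_ne_zero P hr
  have hc1 : (c : ℕ) ≤ 1 := by omega
  have hc1' : c' ≤ 1 := by omega
  have hy : yFactor P n (-r) c = -1 := by rw [yFactor, if_pos hc1]
  rw [monoPairing_of_row P hn hr (-(P.mono r (-a) (-k) / t₃Pow P r)) c _ m, hy]
  · field_simp
  intro j
  have e1 : P.mono r (-(a + 1)) (-(k + 1)) = P.mono r (-a) (-k) * P.mono r (-1) (-1) := by
    rw [mono_mul]; congr 1 <;> ring
  have e2 : P.mono r (-(a - 1)) (-(k - 1)) = P.mono r (-a) (-k) * P.mono r 1 1 := by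
    rw [mono_mul]; congr 1 <;> ring
  have e3 : P.mono r (-(a - 1)) (-(k + 1)) = P.mono r (-a) (-k) * P.mono r 1 (-1) := by
    rw [mono_mul]; congr 1 <;> ring
  have e4 : P.mono r (-(a + 1)) (-(k - 1)) = P.mono r (-a) (-k) * P.mono r (-1) 1 := by
    rw [mono_mul]; congr 1 <;> ring
  have hI (i : ℕ) (x : ℂ) : colorIndicator n i j * x * yFactor P n r j =
      colorIndicator n i j * (x * if i ≤ 1 then -1 else -t₁Pow P r) := by
    rw [mul_right_comm, colorIndicator_mul_yFactor]
    ring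
  rw [symCartanPow_eq, ospMatrix_fermionic _ _ _ _ c j hc1, ← t₁Pow, rootFer,
    show 1 - (c : ℕ) = c' by omega]
  simp only [map_add, map_sub, Pi.add_apply, Pi.sub_apply, evalMode_var, add_mul, sub_mul, hI,
    if_pos hc1, if_pos hc1', show ¬2 ≤ 1 by omega, if_false, e1, e2, e3, e4]
  field_simp
  rw [t₃Pow_eq]
  ring

/-- The pairing of the zero modes of a monomial with the charge of a monomial. -/
def zeroMonoPairing (m m' : Mono n) : ℂ :=
  (evalZero P n m ᵥ* (zeroCartan n P.γ)⁻¹) ⬝ᵥ evalCharge n m'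

/-- `zeroMonoPairing` as a homomorphism in its first argument. -/
def zeroMonoPairingHom (m' : Mono n) : Mono n →+ ℂ :=
  AddMonoidHom.mk' (fun m => zeroMonoPairing P m m') fun m m'' => by
    rw [zeroMonoPairing, map_add, add_vecMul, add_dotProduct]
    rfl

/-- On zero modes the root is a multiple of row i of K; the factor 2(ℓ₁ + ℓ₂) comes from γ(ℓ₁ + ℓ₂)
= ℓ₁. -/
theorem zeroMonoPairing_rootBos (hn : 1 ≤ n) (i : Color n) (hi : 2 ≤ (i : ℕ)) (a k : ℤ)
    (m : Mono n) :
    zeroMonoPairing P (rootBos n i a k) m = 2 * (P.l₁ + P.l₂) * evalCharge n m i := by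
  rw [zeroMonoPairing, vecMul_row_inv (isUnit_det_zeroCartan P hn) (2 * (P.l₁ + P.l₂)) i]
  intro j
  have hγ := γ_mul P
  have hI (i : ℕ) (x y : ℂ) : (colorIndicator n i j * if (j : ℕ) ≤ 1 then x else y) =
      colorIndicator n i j * if i ≤ 1 then x else y := by
    rw [colorIndicator]
    split_ifs <;> first | omega | ring
  have hi1 : ¬(i : ℕ) ≤ 1 := by omega
  have hi2 : ¬(i : ℕ) + 1 ≤ 1 := by omega
  rw [zeroCartan_eq, ospMatrix_bosonic _ _ _ _ i j hi, rootBos]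
  by_cases h2 : (i : ℕ) = 2
  · simp only [if_pos h2, map_add, map_sub, Pi.add_apply, Pi.sub_apply, evalZero_var,
      hI, if_neg hi1, if_neg hi2, le_refl, zero_le, if_true]
    push_cast
    linear_combination (-4 * colorIndicator n i j + 2 * colorIndicator n (i + 1) j +
      2 * (colorIndicator n 0 j + colorIndicator n 1 j)) * hγ
  · have hi3 : ¬(i : ℕ) - 1 ≤ 1 := by omega
    simp only [if_neg h2, map_add, map_sub, map_neg, Pi.add_apply, Pi.sub_apply, Pi.neg_apply,
      evalZero_var, hI, if_neg hi1, if_neg hi2, if_neg hi3]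
    linear_combination (-4 * colorIndicator n i j + 2 * colorIndicator n (i + 1) j +
      2 * colorIndicator n (i - 1) j) * hγ

theorem zeroMonoPairing_rootFer (hn : 1 ≤ n) (c : Color n) (c' : ℕ)
    (hc : (c : ℕ) + c' = 1) (a k : ℤ) (m : Mono n) :
    zeroMonoPairing P (rootFer n c c' a k) m = -2 * (P.l₁ + P.l₂) * evalCharge n m c := by
  rw [zeroMonoPairing, vecMul_row_inv (isUnit_det_zeroCartan P hn) (-2 * (P.l₁ + P.l₂)) c]
  intro j
  have hγ := γ_mul P
  have hI (i : ℕ) (x y : ℂ) : (colorIndicator n i j * if (j : ℕ) ≤ 1 then x else y) =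
      colorIndicator n i j * if i ≤ 1 then x else y := by
    rw [colorIndicator]
    split_ifs <;> first | omega | ring
  have hc1 : (c : ℕ) ≤ 1 := by omega
  have hc1' : c' ≤ 1 := by omega
  rw [zeroCartan_eq, ospMatrix_fermionic _ _ _ _ c j hc1, rootFer, show 1 - (c : ℕ) = c' by omega]
  simp only [map_add, map_sub, Pi.add_apply, Pi.sub_apply, evalZero_var, hI,
    if_pos hc1, if_pos hc1', show ¬2 ≤ 1 by omega, if_false]
  push_cast
  linear_combination (4 * colorIndicator n c' j - 2 * colorIndicator n 2 j) * hγ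

end Roots

/-! ### Identities between monomials -/

section Monomials

variable {n : ℕ}

/-- This identity and the next three link all monomials of V_χ into one chain with affine roots as
steps. The pairings below are inductions along this chain. -/
theorem boxMono_eq_sub (i : ℕ) (hi : 1 ≤ i) :
    boxMono n i = boxMono n (i + 1) - rootBos n (i + 1) 0 (n - i) := by
  simp only [boxMono, rootBos, show i + 1 ≠ 1 by omega, if_false]
  by_cases h : i = 1
  · subst h
    simp only [if_true]
    push_cast
    ring_nf
    abel
  · simp only [h, show i + 1 ≠ 2 by omega, if_false, Nat.add_sub_cancel]
    push_cast
    ring_nf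
    abel

theorem boxMonoMid_eq_add (c c' : ℕ) (hc : c + c' = 1) :
    boxMonoMid n c c' = boxMono n 1 + rootFer n c c' 0 n := by
  rcases (by omega : c = 0 ∧ c' = 1 ∨ c = 1 ∧ c' = 0) with ⟨rfl, rfl⟩ | ⟨rfl, rfl⟩ <;>
  · simp only [boxMono, boxMonoMid, rootFer, if_true]
    ring_nf
    abel

theorem boxMonoBar_one (c c' : ℕ) (hc : c + c' = 1) :
    boxMonoBar n 1 = boxMonoMid n c c' + rootFer n c' c 0 n := by
  rcases (by omega : c = 0 ∧ c' = 1 ∨ c = 1 ∧ c' = 0) with ⟨rfl, rfl⟩ | ⟨rfl, rfl⟩ <;>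
  · simp only [boxMonoBar, boxMonoMid, rootFer, if_true]
    ring_nf
    abel

theorem boxMonoBar_succ (i : ℕ) (hi : 1 ≤ i) :
    boxMonoBar n (i + 1) = boxMonoBar n i - rootBos n (i + 1) 0 (n + i) := by
  simp only [boxMonoBar, rootBos, show i + 1 ≠ 1 by omega, if_false]
  by_cases h : i = 1
  · subst h
    simp only [if_true]
    push_cast
    ring_nf
    abel
  · simp only [h, show i + 1 ≠ 2 by omega, if_false, Nat.add_sub_cancel]
    push_cast
    ring_nf
    abel

/-- The number of elements of `S` in `[i, n]`. -/
def tailCount (n : ℕ) (S : Finset ℕ) (i : ℕ) : ℤ := ∑ j ∈ Finset.Icc i n, bit S j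

theorem tailCount_eq_add {S : Finset ℕ} {i : ℕ} (hi : i ≤ n) :
    tailCount n S i = bit S i + tailCount n S (i + 1) := by
  rw [tailCount, tailCount, ← Finset.insert_Icc_add_one_left_eq_Icc hi, Finset.sum_insert]
  simp

theorem tailCount_eq_zero {S : Finset ℕ} {i : ℕ} (hi : n < i) : tailCount n S i = 0 := by
  rw [tailCount, Finset.Icc_eq_empty (by omega), Finset.sum_empty]

theorem bit_eq_zero_or_one (S : Finset ℕ) (i : ℕ) : bit S i = 0 ∨ bit S i = 1 := by
  rw [bit]
  split_ifs <;> simp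

/-- The part of `xiMono` that does not depend on the positions of the elements of `S`. -/
def vacMono (n c c' : ℕ) (N : ℤ) : Mono n := var n c 0 (2 * N) - var n c' 2 (2 * N)

/-- The contribution to `xiMono` of an element `j` of `S`, the `N`-th one from above. -/
def partMono (n j : ℕ) (N : ℤ) : Mono n :=
  if j = 1 then
    -var n 1 0 (2 * N) + var n 1 2 (2 * N) - var n 0 0 (2 * N) + var n 0 2 (2 * N)
      + var n 2 1 (2 * N - 1)
  else -var n j 1 (j + 2 * N - 1) + var n (j + 1) 1 (j + 2 * N - 2)

/-- The exponent -ν_i + ν_{i-1} of color i is split: the part ν_{i-1} is attributed to the element i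
- 1 of S. Since the bits are 0 or 1, the arguments may be rewritten through the number of elements
of S from the given one upwards. -/
theorem xiMono_eq (hn : 1 ≤ n) (c c' : ℕ) (hc : c + c' = 1) (S : Finset ℕ) :
    xiMono n c c' S = vacMono n c c' (tailCount n S 1) +
      ∑ j ∈ Finset.Icc 1 n, bit S j • partMono n j (tailCount n S j) := by
  have h1 : ∀ i ∈ Finset.Icc 2 n, (-bit S i + bit S (i - 1)) •
      var n i 1 (i + 2 * ∑ j ∈ Finset.Icc (i + 1) n, bit S j + bit S i - bit S (i - 1)) =
      bit S (i - 1) • var n i 1 (i + 2 * tailCount n S i - 1)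
        + bit S i • -var n i 1 (i + 2 * tailCount n S i - 1) := by
    intro i hi
    have hi' := Finset.mem_Icc.1 hi
    rw [← tailCount, tailCount_eq_add hi'.2]
    rcases bit_eq_zero_or_one S i with h | h <;> rcases bit_eq_zero_or_one S (i - 1) with h' | h' <;>
      rw [h, h']
    · simp
    · simp
    · simp only [add_zero, neg_smul, one_smul, zero_smul, zero_add, smul_neg]
      congr 2
      ring
    · simp
  have h2 : ∑ i ∈ Finset.Icc 2 n, bit S (i - 1) • var n i 1 (i + 2 * tailCount n S i - 1) =
      bit S 1 • var n 2 1 (2 * tailCount n S 1 - 1) +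
      ∑ j ∈ Finset.Icc 2 n, bit S j • var n (j + 1) 1 (j + 2 * tailCount n S j - 2) := by
    have h3 : ∑ i ∈ Finset.Icc 2 n, bit S (i - 1) • var n i 1 (i + 2 * tailCount n S i - 1) =
        ∑ i ∈ Finset.Icc 2 (n + 1),
          bit S (i - 1) • var n i 1 (i + 2 * tailCount n S (i - 1) - 3) := by
      -- The added index n + 1 contributes nothing, since `var` is trivial beyond the color n.
      rw [← Finset.insert_Icc_right_eq_Icc_add_one (by omega), Finset.sum_insert (by simp)]
      rw [var, dif_neg (by omega), smul_zero, zero_add]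
      refine Finset.sum_congr rfl fun i hi => ?_
      have hi' := Finset.mem_Icc.1 hi
      rw [tailCount_eq_add (n := n) (i := i - 1) (by omega), show i - 1 + 1 = i by omega]
      rcases bit_eq_zero_or_one S (i - 1) with h | h <;> rw [h]
      · simp
      · congr 2
        ring
    rw [h3]
    have h4 : ∑ i ∈ Finset.Icc 2 (n + 1),
          bit S (i - 1) • var n i 1 (i + 2 * tailCount n S (i - 1) - 3) =
        ∑ j ∈ Finset.Icc 1 n, bit S j • var n (j + 1) 1 (j + 2 * tailCount n S j - 2) := by
      refine Finset.sum_nbij' (fun i => i - 1) (fun j => j + 1) ?_ ?_ ?_ ?_ ?_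
      · intro i hi
        simp only [Finset.mem_Icc] at hi ⊢
        omega
      · intro i hi
        simp only [Finset.mem_Icc] at hi ⊢
        omega
      · intro i hi
        simp only [Finset.mem_Icc] at hi
        omega
      · intro i hi
        simp
      · intro i hi
        simp only [Finset.mem_Icc] at hi
        obtain ⟨j, rfl⟩ : ∃ j, i = j + 1 := ⟨i - 1, by omega⟩
        rw [Nat.add_sub_cancel]
        congr 2
        push_cast
        ring
    rw [h4, ← Finset.insert_Icc_add_one_left_eq_Icc hn, Finset.sum_insert (by simp)]
    congr 3
    push_cast
    ring
  have h5 : ∀ j ∈ Finset.Icc 2 n, bit S j • partMono n j (tailCount n S j) =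
      bit S j • -var n j 1 (j + 2 * tailCount n S j - 1) +
        bit S j • var n (j + 1) 1 (j + 2 * tailCount n S j - 2) := by
    intro j hj
    have hj' := Finset.mem_Icc.1 hj
    rw [partMono, if_neg (by omega), smul_add]
  have h6 : var n c (2 * bit S 1) (2 * ∑ j ∈ Finset.Icc 1 n, bit S j)
      - var n c' (2 - 2 * bit S 1) (2 * ∑ j ∈ Finset.Icc 1 n, bit S j) +
      bit S 1 • var n 2 1 (2 * tailCount n S 1 - 1) =
      vacMono n c c' (tailCount n S 1) + bit S 1 • partMono n 1 (tailCount n S 1) := by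
    rw [← tailCount, partMono, if_pos rfl, vacMono]
    rcases (by omega : c = 0 ∧ c' = 1 ∨ c = 1 ∧ c' = 0) with ⟨rfl, rfl⟩ | ⟨rfl, rfl⟩ <;>
      rcases bit_eq_zero_or_one S 1 with h | h <;> rw [h]
    · simp
    · simp only [one_smul, mul_one, sub_self]
      abel
    · simp
    · simp only [one_smul, mul_one, sub_self]
      abel
  have h7 : ∑ j ∈ Finset.Icc 1 n, bit S j • partMono n j (tailCount n S j) =
      bit S 1 • partMono n 1 (tailCount n S 1) +
        ∑ j ∈ Finset.Icc 2 n, bit S j • partMono n j (tailCount n S j) := by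
    rw [← Finset.insert_Icc_add_one_left_eq_Icc hn, Finset.sum_insert (by simp)]
    rfl
  rw [xiMono, Finset.sum_congr rfl h1, Finset.sum_add_distrib, h2, h7, Finset.sum_congr rfl h5,
    Finset.sum_add_distrib, ← add_assoc (vacMono _ _ _ _), ← h6]
  abel

end Monomials

/-! ### The pairings of the monomials of the two currents -/

section Values

variable (P : Params) {n : ℕ}

theorem evalMode_xiMono_bosonic (r : ℤ) (c c' : ℕ) (hc : c + c' = 1) (S : Finset ℕ) (i : Color n)
    (hi : 2 ≤ (i : ℕ)) :
    evalMode P n (-r) (xiMono n c c' S) i =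
      (bit S (i - 1) - bit S i : ℤ) * P.mono r 1 (i + 2 * tailCount n S i - 1) := by
  have hin : (i : ℕ) ≤ n := by have := i.2; omega
  have h0 (k : ℕ) (hk : k ≤ 1) : colorIndicator n k i = 0 := if_neg (by omega)
  rw [xiMono, map_sub, map_add, map_sum, Pi.sub_apply, Pi.add_apply, Finset.sum_apply,
    evalMode_var, evalMode_var, h0 c (by omega), h0 c' (by omega), zero_mul, zero_mul, add_zero,
    sub_zero, Finset.sum_eq_single_of_mem (i : ℕ) (Finset.mem_Icc.2 ⟨hi, hin⟩)]
  · rw [map_zsmul, Pi.smul_apply, evalMode_var, zsmul_eq_mul, mono_neg, ← tailCount,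
      tailCount_eq_add (n := n) hin, colorIndicator, if_pos rfl, one_mul, neg_neg, neg_neg]
    rcases bit_eq_zero_or_one S i with h | h <;>
      rcases bit_eq_zero_or_one S (i - 1) with h' | h' <;> rw [h, h']
    · simp
    · congr 2
      ring
    · congr 2
      ring
    · simp
  · intro j _ hj
    rw [map_zsmul, Pi.smul_apply, evalMode_var, colorIndicator, if_neg (Ne.symm hj), zero_mul,
      smul_zero]

theorem apply_xiMono_fermionic {G : Type*} [AddCommGroup G] (F : Mono n →+ (Color n → G))
    (hF : ∀ k a b, ∀ j : Color n, (j : ℕ) ≠ k → F (var n k a b) j = 0)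
    (c c' : ℕ) (S : Finset ℕ) (i : Color n) (hi : (i : ℕ) ≤ 1) :
    F (xiMono n c c' S) i = F (var n c (2 * bit S 1) (2 * tailCount n S 1)) i -
      F (var n c' (2 - 2 * bit S 1) (2 * tailCount n S 1)) i := by
  rw [xiMono, map_sub, map_add, map_sum, Pi.sub_apply, Pi.add_apply, Finset.sum_apply,
    Finset.sum_eq_zero, zero_add, ← tailCount]
  intro k hk
  have := Finset.mem_Icc.1 hk
  rw [map_zsmul, Pi.smul_apply, hF _ _ _ _ (by omega), smul_zero]

theorem evalMode_xiMono_fermionic (r : ℤ) (c c' : ℕ) (S : Finset ℕ) (i : Color n)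
    (hi : (i : ℕ) ≤ 1) :
    evalMode P n (-r) (xiMono n c c' S) i =
      colorIndicator n c i * P.mono r (2 * bit S 1) (2 * tailCount n S 1) -
      colorIndicator n c' i * P.mono r (2 - 2 * bit S 1) (2 * tailCount n S 1) := by
  rw [apply_xiMono_fermionic _ _ c c' S i hi, evalMode_var, evalMode_var, mono_neg, mono_neg]
  · simp only [neg_neg]
  · intro k a b j hj
    rw [evalMode_var, colorIndicator, if_neg hj, zero_mul]

theorem evalCharge_xiMono (c c' : ℕ) (hc : c + c' = 1) (S : Finset ℕ) :
    evalCharge n (xiMono n c c' S) = fun i => colorIndicator n c' i - colorIndicator n c i := by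
  funext i
  rcases Nat.lt_or_ge i 2 with hi | hi
  · rw [apply_xiMono_fermionic _ _ c c' S i (by omega), evalCharge_var, evalCharge_var,
      if_pos (by omega)]
    · ring
    · intro k a b j hj
      rw [evalCharge_var, colorIndicator, if_neg hj, zero_mul]
  · have h0 (k : ℕ) (hk : k ≤ 1) : colorIndicator n k i = 0 := if_neg (by omega)
    have h1 (k : ℕ) (a b : ℤ) : evalCharge n (var n k a b) i = 0 := by
      rw [evalCharge_var, if_neg (by omega), mul_zero]
    rw [xiMono, map_sub, map_add, map_sum, Pi.sub_apply, Pi.add_apply, Finset.sum_apply, h1, h1,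
      h0 c (by omega), h0 c' (by omega)]
    simp only [map_zsmul, Pi.smul_apply, h1, smul_zero, Finset.sum_const_zero, add_zero, sub_zero]

theorem partMono_one (c c' : ℕ) (hc : c + c' = 1) (N : ℤ) :
    partMono n 1 N + vacMono n c c' N - vacMono n c c' (N - 1) =
      rootFer n c c' 1 (2 * N - 1) := by
  rcases (by omega : c = 0 ∧ c' = 1 ∨ c = 1 ∧ c' = 0) with ⟨rfl, rfl⟩ | ⟨rfl, rfl⟩ <;>
  · simp only [partMono, vacMono, rootFer, if_true]
    ring_nf
    abel

theorem partMono_succ (i : ℕ) (hi : 1 ≤ i) (N : ℤ) :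
    partMono n (i + 1) N = partMono n i N - rootBos n (i + 1) 1 (i + 2 * N - 1) := by
  simp only [partMono, rootBos, show i + 1 ≠ 1 by omega, if_false]
  by_cases h : i = 1
  · subst h
    simp only [if_true]
    push_cast
    ring_nf
    abel
  · simp only [h, show i + 1 ≠ 2 by omega, if_false, Nat.add_sub_cancel]
    push_cast
    ring_nf
    abel

/-- Over the elements of S the counts run through 1, …, |S|, so the vacuum factors telescope. Each
summand is then a combination of affine roots, by `partMono_one` and `partMono_succ`. -/
theorem xiMono_eq_vacMono_add (hn : 1 ≤ n) (c c' : ℕ) (hc : c + c' = 1) (S : Finset ℕ) :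
    xiMono n c c' S = vacMono n c c' 0 +
      ∑ j ∈ Finset.Icc 1 n, bit S j • (partMono n j (tailCount n S j) +
        vacMono n c c' (tailCount n S j) - vacMono n c c' (tailCount n S j - 1)) := by
  have h1 : ∀ k ≤ n, vacMono n c c' (tailCount n S (n + 1 - k)) = vacMono n c c' 0 +
      ∑ j ∈ Finset.Icc (n + 1 - k) n, bit S j • (vacMono n c c' (tailCount n S j) -
        vacMono n c c' (tailCount n S j - 1)) := by
    intro k
    induction k with
    | zero =>
      intro _
      rw [Nat.sub_zero, tailCount_eq_zero (by omega), Finset.Icc_eq_empty (by omega),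
        Finset.sum_empty, add_zero]
    | succ k ih =>
      intro hk
      have h := ih (by omega)
      have e : n + 1 - k = n + 1 - (k + 1) + 1 := by omega
      rw [e] at h
      rw [← Finset.insert_Icc_add_one_left_eq_Icc (show n + 1 - (k + 1) ≤ n by omega),
        Finset.sum_insert (by simp), tailCount_eq_add (show n + 1 - (k + 1) ≤ n by omega)]
      rw [add_left_comm, ← h]
      rcases bit_eq_zero_or_one S (n + 1 - (k + 1)) with h' | h' <;> rw [h']
      · simp
      · simp
  have h2 := h1 n le_rfl
  rw [Nat.add_sub_cancel_left] at h2
  rw [xiMono_eq hn c c' hc, h2, add_assoc, ← Finset.sum_add_distrib]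
  congr 1
  refine Finset.sum_congr rfl fun j _ => ?_
  rw [← smul_add]
  congr 1
  abel

/-- The sum of the `r`-th powers of the poles minus that of the zeros of a contraction. -/
def theta (r b : ℤ) : ℂ := P.mono r 1 (b + 1) * t₃Pow P r * t₁Pow P r

/-- The poles are s₁q^b and s₁q^{b+2}, the zeros s₁⁻¹q^b and s₁³q^{b+2}. The two products agree, as
`expSeries_two_poles` requires. -/
theorem theta_eq (r b : ℤ) : theta P r b =
    P.mono r 1 b + P.mono r 1 (b + 2) - P.mono r (-1) b - P.mono r 3 (b + 2) := by
  rw [theta, t₃Pow_eq, t₁Pow]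
  simp only [mul_sub, sub_mul, mono_mul]
  ring_nf

theorem evalMode_boxMono_top (r : ℤ) (hn : 2 ≤ n) (i : Color n) :
    evalMode P n r (boxMono n n) i = colorIndicator n n i := by
  rw [boxMono, if_neg (by omega), map_add, map_neg, Pi.add_apply, Pi.neg_apply, evalMode_var,
    evalMode_var, colorIndicator_eq_zero (by omega), sub_self, neg_zero, mono_zero]
  ring

theorem evalMode_boxMono_one (r : ℤ) (i : Color 1) :
    evalMode P 1 r (boxMono 1 1) i = t₁Pow P r := by
  have h2 : colorIndicator 1 2 i = 0 := colorIndicator_eq_zero (by omega) i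
  have h01 : colorIndicator 1 0 i + colorIndicator 1 1 i = 1 := by
    fin_cases i <;> simp [colorIndicator]
  rw [boxMono, if_pos rfl]
  simp only [map_add, map_neg, map_sub, Pi.add_apply, Pi.neg_apply, Pi.sub_apply, evalMode_var,
    h2, t₁Pow]
  simp only [Nat.cast_one, sub_self, neg_zero, neg_neg]
  linear_combination (P.mono r 1 0 - P.mono r (-1) 0) * h01

/-- The element j contributes one fermionic root and bosonic roots of the colors 2, …, j. For n ≥ 2
the mode vector of M_n lives on the color n alone, so only j = n is seen; for n = 1 it is the
fermionic root that contributes. -/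
theorem monoPairing_top_part (hn : 1 ≤ n) {r : ℤ} (hr : r ≠ 0) (c c' : ℕ) (hc : c + c' = 1)
    (j : ℕ) (hj : 1 ≤ j) (hjn : j ≤ n) (N : ℤ) :
    monoPairing P r (boxMono n n) (partMono n j N + vacMono n c c' N - vacMono n c c' (N - 1)) =
      if j = n then theta P r (2 * N + n - 3) else 0 := by
  have hr' : -r ≠ 0 := neg_ne_zero.2 hr
  induction j, hj using Nat.le_induction with
  | base =>
    rw [partMono_one c c' hc, monoPairing_symm,
      monoPairing_rootFer P hn hr' ⟨c, by omega⟩ c' hc, neg_neg]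
    split_ifs with h
    · subst h
      rw [evalMode_boxMono_one, theta, mono_neg, t₃Pow_neg]
      push_cast
      ring_nf
    · rw [evalMode_boxMono_top P r (by omega), colorIndicator, if_neg, mul_zero, neg_zero]
      change ¬c = n
      omega
  | succ j hj ih =>
    have h := ih (by omega)
    rw [if_neg (by omega)] at h
    have e : partMono n (j + 1) N + vacMono n c c' N - vacMono n c c' (N - 1) =
        (partMono n j N + vacMono n c c' N - vacMono n c c' (N - 1)) -
          rootBos n (j + 1) 1 (j + 2 * N - 1) := by
      rw [partMono_succ j hj]
      abel
    have h2 := map_sub (monoPairingHomRight P r (boxMono n n))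
      (partMono n j N + vacMono n c c' N - vacMono n c c' (N - 1))
      (rootBos n (j + 1) 1 (j + 2 * N - 1))
    rw [← e] at h2
    refine h2.trans ?_
    change monoPairing P r _ _ - monoPairing P r _ _ = _
    have h3 := monoPairing_rootBos P hn hr' ⟨j + 1, by omega⟩ (by change 2 ≤ j + 1; omega) 1
      (j + 2 * N - 1) (boxMono n n)
    rw [h, zero_sub, monoPairing_symm, h3, neg_neg, neg_neg, evalMode_boxMono_top P r (by omega),
      colorIndicator]
    change _ * (if j + 1 = n then (1 : ℂ) else 0) = _
    split_ifs with h
    · have e1 : P.mono (-r) (-1) (-(j + 2 * N - 1)) = P.mono r 1 (2 * N + n - 3 + 1) := by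
        rw [mono_neg, ← h]
        congr 1
        · push_cast
          ring
      rw [e1, theta, t₃Pow_neg, t₁Pow_neg]
      ring
    · rw [mul_zero]

theorem monoPairingHomRight_apply (r : ℤ) (m m' : Mono n) :
    monoPairingHomRight P r m m' = monoPairing P r m m' := rfl

theorem monoPairing_top (hn : 1 ≤ n) {r : ℤ} (hr : r ≠ 0) (c c' : ℕ) (hc : c + c' = 1)
    (S : Finset ℕ) :
    monoPairing P r (boxMono n n) (xiMono n c c' S) -
      monoPairing P r (boxMono n n) (vacMono n c c' 0) =
      bit S n * theta P r (2 * tailCount n S n + n - 3) := by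
  rw [xiMono_eq_vacMono_add hn c c' hc, ← monoPairingHomRight_apply,
    map_add (monoPairingHomRight P r (boxMono n n)), map_sum, monoPairingHomRight_apply,
    add_sub_cancel_left, Finset.sum_eq_single_of_mem n (Finset.mem_Icc.2 ⟨hn, le_rfl⟩)]
  · rw [map_zsmul, zsmul_eq_mul, monoPairingHomRight_apply,
      monoPairing_top_part P hn hr c c' hc n hn le_rfl, if_pos rfl]
  · intro j hj hjn
    have hj' := Finset.mem_Icc.1 hj
    rw [map_zsmul, zsmul_eq_mul, monoPairingHomRight_apply,
      monoPairing_top_part P hn hr c c' hc j hj'.1 hj'.2, if_neg hjn, mul_zero]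

theorem monoPairing_sub_left (r : ℤ) (m m' m'' : Mono n) :
    monoPairing P r (m - m') m'' = monoPairing P r m m'' - monoPairing P r m' m'' :=
  map_sub (monoPairingHom P r m'') m m'

/-- The pairing of a monomial with `xiMono`, relative to the pairing of the leading monomials. -/
def relPairing (n : ℕ) (c c' : ℕ) (S : Finset ℕ) (r : ℤ) (m : Mono n) : ℂ :=
  monoPairing P r m (xiMono n c c' S) - monoPairing P r (boxMono n n) (vacMono n c c' 0)

theorem relPairing_add (c c' : ℕ) (S : Finset ℕ) (r : ℤ) (m m' : Mono n) :
    relPairing P n c c' S r (m + m') =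
      relPairing P n c c' S r m + monoPairing P r m' (xiMono n c c' S) := by
  rw [relPairing, relPairing, monoPairing_add_left]
  ring

theorem relPairing_sub (c c' : ℕ) (S : Finset ℕ) (r : ℤ) (m m' : Mono n) :
    relPairing P n c c' S r (m - m') =
      relPairing P n c c' S r m - monoPairing P r m' (xiMono n c c' S) := by
  rw [relPairing, relPairing, monoPairing_sub_left]
  ring

/-- Descending from M_{k+1} to M_k subtracts a root of color k + 1. That root reads the exponent ν_k
- ν_{k+1}, which replaces the factor ν_{k+1} by ν_k. -/
theorem relPairing_boxMono (hn : 1 ≤ n) {r : ℤ} (hr : r ≠ 0) (c c' : ℕ) (hc : c + c' = 1)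
    (S : Finset ℕ) (i : ℕ) (hi : 1 ≤ i) (hin : i ≤ n) :
    relPairing P n c c' S r (boxMono n i) =
      bit S i * theta P r (2 * tailCount n S i - n + 2 * i - 3) := by
  induction hin using Nat.decreasingInduction with
  | self =>
    rw [relPairing, monoPairing_top P hn hr c c' hc]
    congr 2
    ring
  | of_succ k hk ih =>
    have h3 := monoPairing_rootBos P hn hr ⟨k + 1, by omega⟩ (by change 2 ≤ k + 1; omega) 0
      (n - k) (xiMono n c c' S)
    rw [evalMode_xiMono_bosonic P r c c' hc S _ (by change 2 ≤ k + 1; omega)] at h3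
    simp only [Nat.add_sub_cancel] at h3
    rw [boxMono_eq_sub k hi, relPairing_sub, ih (by omega), h3,
      tailCount_eq_add (n := n) (i := k) (by omega), theta, theta]
    have e1 : P.mono r (-0) (-((n : ℤ) - k)) *
        P.mono r 1 (((k + 1 : ℕ) : ℤ) + 2 * tailCount n S (k + 1) - 1) =
        P.mono r 1 (2 * tailCount n S (k + 1) - n + 2 * ((k + 1 : ℕ) : ℤ) - 3 + 1) := by
      rw [mono_mul]
      congr 1
      push_cast
      ring
    -- For ν_k = 1 the count grows by one and makes up for the drop of the index; for ν_k = 0 both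
    -- sides vanish.
    have e2 : (bit S k : ℂ) * P.mono r 1 (2 * (bit S k + tailCount n S (k + 1)) - n + 2 * k - 3 + 1) =
        bit S k * P.mono r 1 (2 * tailCount n S (k + 1) - n + 2 * ((k + 1 : ℕ) : ℤ) - 3 + 1) := by
      rcases bit_eq_zero_or_one S k with h | h <;> rw [h]
      · simp
      · congr 2
        push_cast
        ring
    push_cast at e1 e2 ⊢
    linear_combination ((bit S k : ℂ) - bit S (k + 1)) * t₃Pow P r * t₁Pow P r * e1
      - t₃Pow P r * t₁Pow P r * e2

/-- For ν_1 = 1 the fermionic root cancels one pole and one zero of M_1; for ν_1 = 0 it creates a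
pole and a zero. In both cases a single pole remains, and its quotient by the zero is s₁²q². -/
theorem relPairing_boxMonoMid_self (hn : 1 ≤ n) {r : ℤ} (hr : r ≠ 0) (c c' : ℕ) (hc : c + c' = 1)
    (S : Finset ℕ) :
    relPairing P n c c' S r (boxMonoMid n c c') =
      P.mono r 1 (2 * tailCount n S 1 - n + 1) - P.mono r (-1) (2 * tailCount n S 1 - n - 1) := by
  have h := monoPairing_rootFer P hn hr ⟨c, by omega⟩ c' hc 0 n (xiMono n c c' S)
  rw [evalMode_xiMono_fermionic P r c c' S _ (by change c ≤ 1; omega), colorIndicator,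
    colorIndicator, if_pos rfl, if_neg (by change ¬c = c'; omega)] at h
  rw [boxMonoMid_eq_add c c' hc, relPairing_add, h, relPairing_boxMono P hn hr c c' hc S 1 le_rfl hn,
    theta_eq, t₃Pow_eq]
  simp only [one_mul, zero_mul, sub_zero, mul_sub, sub_mul, mono_mul]
  rcases bit_eq_zero_or_one S 1 with h' | h' <;> rw [h']
  · push_cast
    ring_nf
  · push_cast
    ring_nf

theorem relPairing_boxMonoMid_swap (hn : 1 ≤ n) {r : ℤ} (hr : r ≠ 0) (c c' : ℕ) (hc : c + c' = 1)
    (S : Finset ℕ) :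
    relPairing P n c c' S r (boxMonoMid n c' c) =
      P.mono r 1 (2 * tailCount n S 1 - n - 1) - P.mono r 3 (2 * tailCount n S 1 - n + 1) := by
  have h := monoPairing_rootFer P hn hr ⟨c', by omega⟩ c (by change c' + c = 1; omega) 0 n
    (xiMono n c c' S)
  rw [evalMode_xiMono_fermionic P r c c' S _ (by change c' ≤ 1; omega), colorIndicator,
    colorIndicator, if_neg (by change ¬c' = c; omega), if_pos rfl] at h
  rw [boxMonoMid_eq_add c' c (by omega), relPairing_add, h,
    relPairing_boxMono P hn hr c c' hc S 1 le_rfl hn, theta_eq, t₃Pow_eq]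
  simp only [one_mul, zero_mul, zero_sub, mul_sub, sub_mul, mono_mul, mul_neg]
  rcases bit_eq_zero_or_one S 1 with h' | h' <;> rw [h']
  · push_cast
    ring_nf
  · push_cast
    ring_nf

/-- The second fermionic root turns ν_1 into 1 - ν_1. Each later bosonic root replaces 1 - ν_k by 1
- ν_{k+1}, as on the first half of the chain. -/
theorem relPairing_boxMonoBar (hn : 1 ≤ n) {r : ℤ} (hr : r ≠ 0) (c c' : ℕ) (hc : c + c' = 1)
    (S : Finset ℕ) (i : ℕ) (hi : 1 ≤ i) (hin : i ≤ n) :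
    relPairing P n c c' S r (boxMonoBar n i) =
      (1 - bit S i : ℤ) * theta P r (2 * tailCount n S i - n - 1) := by
  induction i, hi using Nat.le_induction with
  | base =>
    have h := monoPairing_rootFer P hn hr ⟨c', by omega⟩ c (by change c' + c = 1; omega) 0 n
      (xiMono n c c' S)
    rw [evalMode_xiMono_fermionic P r c c' S _ (by change c' ≤ 1; omega), colorIndicator,
      colorIndicator, if_neg (by change ¬c' = c; omega), if_pos rfl] at h
    rw [boxMonoBar_one c c' hc, relPairing_add, h, relPairing_boxMonoMid_self P hn hr c c' hc,
      theta_eq, t₃Pow_eq]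
    simp only [one_mul, zero_mul, zero_sub, mul_sub, sub_mul, mono_mul, mul_neg]
    rcases bit_eq_zero_or_one S 1 with h' | h' <;> rw [h']
    · push_cast
      ring_nf
    · push_cast
      ring_nf
  | succ k hk ih =>
    have h3 := monoPairing_rootBos P hn hr ⟨k + 1, by omega⟩ (by change 2 ≤ k + 1; omega) 0
      (n + k) (xiMono n c c' S)
    rw [evalMode_xiMono_bosonic P r c c' hc S _ (by change 2 ≤ k + 1; omega)] at h3
    simp only [Nat.add_sub_cancel] at h3
    rw [boxMonoBar_succ k hk, relPairing_sub, ih (by omega), h3,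
      tailCount_eq_add (n := n) (i := k) (by omega), theta, theta]
    have e1 : P.mono r (-0) (-((n : ℤ) + k)) *
        P.mono r 1 (((k + 1 : ℕ) : ℤ) + 2 * tailCount n S (k + 1) - 1) =
        P.mono r 1 (2 * tailCount n S (k + 1) - n - 1 + 1) := by
      rw [mono_mul]
      congr 1
      push_cast
      ring
    have e2 : ((1 - bit S k : ℤ) : ℂ) *
        P.mono r 1 (2 * (bit S k + tailCount n S (k + 1)) - n - 1 + 1) =
        (1 - bit S k : ℤ) * P.mono r 1 (2 * tailCount n S (k + 1) - n - 1 + 1) := by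
      rcases bit_eq_zero_or_one S k with h | h <;> rw [h]
      · congr 2
        ring
      · simp
    push_cast at e1 e2 ⊢
    linear_combination ((bit S k : ℂ) - bit S (k + 1)) * t₃Pow P r * t₁Pow P r * e1
      + t₃Pow P r * t₁Pow P r * e2

end Values

/-! ### Commutators of the terms of the two currents -/

section Charges

open Matrix

variable (P : Params) {n : ℕ}

theorem evalCharge_var_of_le {i : ℕ} (hi : i ≤ 1) (a b : ℤ) :
    evalCharge n (var n i a b) = -colorIndicator n i := by
  funext j
  rw [evalCharge_var, Pi.neg_apply, colorIndicator]
  split_ifs <;> first | omega | ring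

theorem evalCharge_var_of_lt {i : ℕ} (hi : 2 ≤ i) (a b : ℤ) : evalCharge n (var n i a b) = 0 := by
  funext j
  rw [evalCharge_var, Pi.zero_apply, colorIndicator]
  split_ifs <;> first | omega | ring

theorem evalCharge_boxMono (i : ℕ) (hi : 1 ≤ i) : evalCharge n (boxMono n i) = 0 := by
  rw [boxMono]
  split_ifs with h
  · simp only [map_add, map_sub, map_neg, evalCharge_var_of_lt le_rfl,
      evalCharge_var_of_le le_rfl, evalCharge_var_of_le zero_le_one]
    abel
  · rw [map_add, map_neg, evalCharge_var_of_lt (by omega), evalCharge_var_of_lt (by omega),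
      neg_zero, add_zero]

theorem evalCharge_boxMonoBar (i : ℕ) (hi : 1 ≤ i) : evalCharge n (boxMonoBar n i) = 0 := by
  rw [boxMonoBar]
  split_ifs with h
  · simp only [map_add, map_sub, map_neg, evalCharge_var_of_lt le_rfl,
      evalCharge_var_of_le le_rfl, evalCharge_var_of_le zero_le_one]
    abel
  · rw [map_add, map_neg, evalCharge_var_of_lt (by omega), evalCharge_var_of_lt (by omega),
      neg_zero, add_zero]

theorem evalCharge_boxMonoMid (c c' : ℕ) (hc : c + c' = 1) :
    evalCharge n (boxMonoMid n c c') = 0 := by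
  simp only [boxMonoMid, map_add, map_sub, map_neg, evalCharge_var_of_le (show c ≤ 1 by omega),
    evalCharge_var_of_le (show c' ≤ 1 by omega)]
  abel

theorem evalCharge_vacMono (c c' : ℕ) (hc : c + c' = 1) (S : Finset ℕ) :
    evalCharge n (vacMono n c c' 0) = evalCharge n (xiMono n c c' S) := by
  rw [evalCharge_xiMono c c' hc, vacMono, map_sub, evalCharge_var_of_le (by omega),
    evalCharge_var_of_le (by omega)]
  funext j
  simp only [Pi.sub_apply, Pi.neg_apply]
  ring

theorem zeroMonoPairing_add_left (m m' m'' : Mono n) :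
    zeroMonoPairing P (m + m') m'' = zeroMonoPairing P m m'' + zeroMonoPairing P m' m'' :=
  map_add (zeroMonoPairingHom P m'') m m'

theorem zeroMonoPairing_sub_left (m m' m'' : Mono n) :
    zeroMonoPairing P (m - m') m'' = zeroMonoPairing P m m'' - zeroMonoPairing P m' m'' :=
  map_sub (zeroMonoPairingHom P m'') m m'

/-- The charges of the terms of V_ξ and V_η sit on the fermionic colors, which bosonic roots do not
see. Only the fermionic steps change the zero mode factor, and the values ±2(ℓ₁ + ℓ₂) found for the
middle monomials are the logarithms of the quotients of pole by zero. -/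
theorem zeroMonoPairing_boxMono (hn : 1 ≤ n) (c c' : ℕ) (hc : c + c' = 1) (S : Finset ℕ) (i : ℕ)
    (hi : 1 ≤ i) (hin : i ≤ n) :
    zeroMonoPairing P (boxMono n i) (xiMono n c c' S) =
      zeroMonoPairing P (boxMono n n) (vacMono n c c' 0) := by
  induction hin using Nat.decreasingInduction with
  | self => rw [zeroMonoPairing, zeroMonoPairing, evalCharge_vacMono c c' hc S]
  | of_succ k hk ih =>
    rw [boxMono_eq_sub k hi, zeroMonoPairing_sub_left, ih (by omega),
      zeroMonoPairing_rootBos P hn ⟨k + 1, by omega⟩ (by change 2 ≤ k + 1; omega),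
      evalCharge_xiMono c c' hc]
    simp only [colorIndicator]
    rw [if_neg (by omega), if_neg (by omega)]
    ring

theorem zeroMonoPairing_boxMonoMid_self (hn : 1 ≤ n) (c c' : ℕ) (hc : c + c' = 1) (S : Finset ℕ) :
    zeroMonoPairing P (boxMonoMid n c c') (xiMono n c c' S) =
      zeroMonoPairing P (boxMono n n) (vacMono n c c' 0) + 2 * (P.l₁ + P.l₂) := by
  rw [boxMonoMid_eq_add c c' hc, zeroMonoPairing_add_left,
    zeroMonoPairing_boxMono P hn c c' hc S 1 le_rfl hn,
    zeroMonoPairing_rootFer P hn ⟨c, by omega⟩ c' hc, evalCharge_xiMono c c' hc]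
  simp only [colorIndicator]
  rw [if_neg (by omega), if_pos trivial]
  ring

theorem zeroMonoPairing_boxMonoMid_swap (hn : 1 ≤ n) (c c' : ℕ) (hc : c + c' = 1) (S : Finset ℕ) :
    zeroMonoPairing P (boxMonoMid n c' c) (xiMono n c c' S) =
      zeroMonoPairing P (boxMono n n) (vacMono n c c' 0) - 2 * (P.l₁ + P.l₂) := by
  rw [boxMonoMid_eq_add c' c (by omega), zeroMonoPairing_add_left,
    zeroMonoPairing_boxMono P hn c c' hc S 1 le_rfl hn,
    zeroMonoPairing_rootFer P hn ⟨c', by omega⟩ c (by change c' + c = 1; omega),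
    evalCharge_xiMono c c' hc]
  simp only [colorIndicator]
  rw [if_pos trivial, if_neg (by omega)]
  ring

theorem zeroMonoPairing_boxMonoBar (hn : 1 ≤ n) (c c' : ℕ) (hc : c + c' = 1) (S : Finset ℕ) (i : ℕ)
    (hi : 1 ≤ i) (hin : i ≤ n) :
    zeroMonoPairing P (boxMonoBar n i) (xiMono n c c' S) =
      zeroMonoPairing P (boxMono n n) (vacMono n c c' 0) := by
  induction i, hi using Nat.le_induction with
  | base =>
    rw [boxMonoBar_one c c' hc, zeroMonoPairing_add_left,
      zeroMonoPairing_boxMonoMid_self P hn c c' hc,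
      zeroMonoPairing_rootFer P hn ⟨c', by omega⟩ c (by change c' + c = 1; omega),
      evalCharge_xiMono c c' hc]
    simp only [colorIndicator]
    rw [if_pos trivial, if_neg (by omega)]
    ring
  | succ k hk ih =>
    rw [boxMonoBar_succ k hk, zeroMonoPairing_sub_left, ih (by omega),
      zeroMonoPairing_rootBos P hn ⟨k + 1, by omega⟩ (by change 2 ≤ k + 1; omega),
      evalCharge_xiMono c c' hc]
    simp only [colorIndicator]
    rw [if_neg (by omega), if_neg (by omega)]
    ring

end Charges

/-! ### Consequences of trivial contractions and of integral powers of z -/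

section Contraction

variable {J J' : Type*} [Fintype J] [Fintype J']

/-- With all higher coefficients equal to zero, the recursion reduces to (k + 1) f_{k+1} = 0. -/
theorem eq_zero_of_expSeries_eq_one {f : ℕ → ℂ} (h : expSeries f = 1) {r : ℕ} (hr : r ≠ 0) :
    f r = 0 := by
  obtain ⟨k, rfl⟩ : ∃ k, r = k + 1 := ⟨r - 1, by omega⟩
  have h1 := coeff_succ_expSeries f k
  rw [h, Finset.sum_eq_single (0, k), PowerSeries.coeff_one, PowerSeries.coeff_one,
    if_neg (by omega), if_pos rfl, mul_zero, one_mul, zero_eq_mul] at h1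
  · exact h1.resolve_left (Nat.cast_add_one_ne_zero k)
  · rintro ⟨i, j⟩ hij hne
    rw [Finset.HasAntidiagonal.mem_antidiagonal] at hij
    rw [PowerSeries.coeff_one, if_neg, zero_mul]
    rintro rfl
    exact hne (by simp at hij; rw [hij])
  · intro hk
    exact absurd (Finset.HasAntidiagonal.mem_antidiagonal.2 (zero_add k)) hk

theorem HasContraction.of_one {H : Heisenberg J} {V W : Vertex J} (h : HasContraction H V W 1 1) :
    zeroPairing H V.power W.charge = 0 ∧ Complex.exp (zeroPairing H (V.modes 0) W.charge) = 1 ∧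
      ∀ r : ℕ, r ≠ 0 → modePairing H V W r = 0 := by
  obtain ⟨h1, h2⟩ := h
  rw [one_mul] at h2
  change PowerSeries.C (Complex.exp (zeroPairing H (V.modes 0) W.charge)) *
    expSeries (modePairing H V W) = 1 at h2
  have h3 := congrArg (PowerSeries.coeff 0) h2
  rw [PowerSeries.coeff_C_mul, coeff_zero_expSeries, mul_one, PowerSeries.coeff_one,
    if_pos rfl] at h3
  rw [h3, map_one, one_mul] at h2
  exact ⟨h1, h3, fun r hr => eq_zero_of_expSeries_eq_one h2 hr⟩

theorem zeroPairing_prod (H : Heisenberg J) (H' : Heisenberg J') (c u : J ⊕ J' → ℂ) :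
    zeroPairing (H.prod H') c u = zeroPairing H (fun j => c (.inl j)) (fun j => u (.inl j)) +
      zeroPairing H' (fun j => c (.inr j)) (fun j => u (.inr j)) := by
  simp [zeroPairing, Heisenberg.prod]

theorem modePairing_prod (H : Heisenberg J) (H' : Heisenberg J') (V V' : Vertex J)
    (U U' : Vertex J') (r : ℕ) :
    modePairing (H.prod H') (U.inr + V.inl) (U'.inr + V'.inl) r =
      modePairing H V V' r + modePairing H' U U' r := by
  have h (U : Vertex J') (V : Vertex J) (r : ℤ) :
      (U.inr + V.inl : Vertex (J ⊕ J')).modes r = Sum.elim (V.modes r) (U.modes r) := by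
    funext j
    cases j
    · exact zero_add _
    · exact add_zero _
  simp [modePairing, Heisenberg.prod, h]

/-- The exponent is an affine function of the sector u, and its linear part would take integer
values on a complex vector space. A nonzero value could be rescaled to 1/2, so the linear part
vanishes. -/
theorem exists_zExponent_eq {H : Heisenberg J} {α : J → ℂ} {V : Vertex J}
    (h : ∀ u, ∃ m : ℤ, zExponent H α V u = m) : ∃ m : ℤ, ∀ u, zExponent H α V u = m := by
  obtain ⟨m, hm⟩ := h 0
  refine ⟨m, fun u => ?_⟩
  have h1 (x : ℂ) (v : J → ℂ) : zeroPairing H V.power (x • v) = x * zeroPairing H V.power v := by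
    simp only [zeroPairing, Finset.mul_sum, Pi.smul_apply, smul_eq_mul]
    exact Finset.sum_congr rfl fun j _ => Finset.sum_congr rfl fun k _ => by ring
  have h2 (v : J → ℂ) : ∃ k : ℤ, zeroPairing H V.power v = k := by
    obtain ⟨m', hm'⟩ := h (0 + v)
    rw [zExponent_add_charge, hm] at hm'
    exact ⟨m' - m, by push_cast; linear_combination hm'⟩
  have h3 (v : J → ℂ) : zeroPairing H V.power v = 0 := by
    by_contra hv
    obtain ⟨k, hk⟩ := h2 ((2 * zeroPairing H V.power v)⁻¹ • v)
    rw [h1, mul_inv, mul_assoc, inv_mul_cancel₀ hv] at hk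
    have h4 : (1 : ℂ) = ((2 * k : ℤ) : ℂ) := by
      push_cast
      rw [← hk]
      norm_num
    have h5 : (1 : ℤ) = 2 * k := by exact_mod_cast h4
    omega
  have h4 := zExponent_add_charge H α V 0 u
  rw [zero_add, h3, add_zero, hm] at h4
  exact h4

end Contraction

/-! ### Commutators of one term of `T` with one term of `E` or `F` -/

section TermCommutators

open Matrix

variable {A : Type*} (P : Params) (n : ℕ) (R : Auxiliary A)

/-- The vertex operator `:U(z) m(z):`, for `U` in the auxiliary bosons. -/
def dressed (U : Vertex A) (m : Mono n) : Vertex (Color n ⊕ A) :=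
  U.inr + (bosonize P n m).inl

variable {n}

theorem dressed_power_of_evalCharge_eq_zero (U : Vertex A) {m : Mono n}
    (hm : evalCharge n m = 0) : (dressed P n U m).power = (U.inr : Vertex (Color n ⊕ A)).power := by
  funext j
  change (U.inr : Vertex (Color n ⊕ A)).power j + (bosonize P n m).inl.power j = _
  have : (bosonize P n m).power = 0 := by rw [bosonize_power, hm, zero_vecMul]
  cases j <;> simp [Vertex.inl, Vertex.power] at this ⊢
  exact congrFun this _

theorem topT_eq_dressed : topT P n R = dressed P n R.W (boxMono n n) := rfl

/-- The monomial `m(s₁^a q^t z)`. -/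
def monoShift (a t : ℤ) : Mono n →+ Mono n :=
  Finsupp.mapDomain.addMonoidHom fun k => (k.1, k.2.1 + a, k.2.2 + t)

theorem inl_shift {J J' : Type*} (l : ℂ) (V : Vertex J) :
    (V.inl : Vertex (J ⊕ J')).shift l = (V.shift l).inl := by
  refine Prod.ext rfl (Prod.ext rfl ?_)
  funext r j
  cases j <;> simp [Vertex.shift, Vertex.inl, Vertex.modes, Vertex.power]

theorem inr_shift {J J' : Type*} (l : ℂ) (V : Vertex J') :
    (V.inr : Vertex (J ⊕ J')).shift l = (V.shift l).inr := by
  refine Prod.ext rfl (Prod.ext rfl ?_)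
  funext r j
  cases j <;> simp [Vertex.shift, Vertex.inr, Vertex.modes, Vertex.power]

theorem inl_add {J J' : Type*} (V W : Vertex J) :
    ((V + W).inl : Vertex (J ⊕ J')) = V.inl + W.inl := by
  refine Prod.ext ?_ (Prod.ext ?_ ?_)
  · funext j
    cases j
    · rfl
    · exact (add_zero _).symm
  · funext j
    cases j
    · rfl
    · exact (add_zero _).symm
  · funext r j
    cases j
    · rfl
    · exact (add_zero _).symm

theorem inr_add {J J' : Type*} (V W : Vertex J') :
    ((V + W).inr : Vertex (J ⊕ J')) = V.inr + W.inr := by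
  refine Prod.ext ?_ (Prod.ext ?_ ?_)
  · funext j
    cases j
    · exact (add_zero _).symm
    · rfl
  · funext j
    cases j
    · exact (add_zero _).symm
    · rfl
  · funext r j
    cases j
    · exact (add_zero _).symm
    · rfl

theorem dressed_add (U V : Vertex A) (m m' : Mono n) :
    dressed P n U m + dressed P n V m' = dressed P n (U + V) (m + m') := by
  rw [dressed, dressed, dressed, inr_add, ← bosonizeHom_apply, ← bosonizeHom_apply,
    ← bosonizeHom_apply, map_add, inl_add]
  abel

theorem dressed_shift (U : Vertex A) (m : Mono n) (a t : ℤ) :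
    (dressed P n U m).shift (a * P.l₁ + t * P.l₂) =
      dressed P n (U.shift (a * P.l₁ + t * P.l₂)) (monoShift a t m) := by
  rw [dressed, shift_add, inl_shift, inr_shift, bosonize_shift]
  rfl

/-- The logarithm `ℓ₁ + t ℓ₂` of `s₁ q^t`. -/
def poleLog (t : ℤ) : ℂ := P.l₁ + t * P.l₂

theorem dressed_shift_add (V U : Vertex A) (m m' : Mono n) (t : ℤ) :
    (dressed P n V m).shift (poleLog P t) + dressed P n U m' =
      dressed P n (V.shift (poleLog P t) + U) (monoShift 1 t m + m') := by
  have h := dressed_shift P V m 1 t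
  rw [Int.cast_one, one_mul, ← poleLog] at h
  rw [h, dressed_add]

theorem mono_one_eq_exp (r b : ℤ) : P.mono r 1 b = Complex.exp (r * poleLog P b) := by
  rw [Params.mono, poleLog, Int.cast_one, one_mul]

theorem q_sub_inv_ne_zero : P.q - P.q⁻¹ ≠ 0 := by
  have h := mono_sub_ne_zero P one_ne_zero (a := 0) (b := 1) (a' := 0) (b' := -1) (by omega)
  have h1 : P.q = P.mono 1 0 1 := by rw [← q_zpow, zpow_one]
  rwa [h1, mono_inv, neg_zero]

/-- The residue constant of a two-pole contraction: poles minus zeros is s₁q^{b+1} t₁ t₃, while the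
difference of the poles is -s₁q^{b+1}(q - q⁻¹). The quotient -a depends neither on b nor on the
term. -/
theorem neg_a_mul (b : ℤ) : -P.a * (Complex.exp (poleLog P b) - Complex.exp (poleLog P (b + 2))) =
    theta P 1 b := by
  have hq := q_sub_inv_ne_zero P
  have h1 : P.q = P.mono 1 0 1 := by rw [← q_zpow, zpow_one]
  have h2 : P.s₁ = P.mono 1 1 0 := by rw [← s₁_zpow, zpow_one]
  have h3 : P.s₃ = P.mono 1 (-1) (-1) := by
    rw [Params.s₃, h1, h2, mono_mul, mono_inv]
    norm_num
  have h4 : Complex.exp (poleLog P b) - Complex.exp (poleLog P (b + 2)) =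
      -(P.mono 1 1 (b + 1) * (P.q - P.q⁻¹)) := by
    have e (t : ℤ) : Complex.exp (poleLog P t) = P.mono 1 1 t := by
      rw [mono_one_eq_exp, Int.cast_one, one_mul]
    rw [e, e, h1, mono_inv, mul_sub, mono_mul, mono_mul, neg_sub]
    ring_nf
  have h5 (x y : ℂ) : -(x / (P.q - P.q⁻¹)) * -(y * (P.q - P.q⁻¹)) = y * x := by
    rw [neg_mul_neg, mul_comm y, ← mul_assoc, div_mul_cancel₀ _ hq, mul_comm]
  rw [h4, Params.a, h5, theta, t₃Pow_eq, t₁Pow, h2, h3, mono_inv, mono_inv]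
  norm_num
  ring

variable [Fintype A]

theorem modePairing_dressed (hn : 1 ≤ n) (U U' : Vertex A) (m m' : Mono n) {r : ℕ} (hr : r ≠ 0) :
    modePairing (algebra P n R) (dressed P n U m) (dressed P n U' m') r =
      modePairing R.alg U U' r + monoPairing P r m m' / r := by
  rw [algebra, dressed, dressed, modePairing_prod, modePairing_bosonize P hn _ _ _ hr, add_comm]

theorem zeroPairing_modes_dressed (hn : 1 ≤ n) (U U' : Vertex A) (m m' : Mono n) :
    zeroPairing (algebra P n R) ((dressed P n U m).modes 0) (dressed P n U' m').charge =
      zeroPairing R.alg (U.modes 0) U'.charge + zeroMonoPairing P m m' := by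
  rw [zeroMonoPairing, ← zeroPairing_bosonize P hn, ← bosonize_modes_zero, algebra,
    zeroPairing_prod, add_comm]
  congr 2 <;> funext j
  · exact add_zero _
  · exact add_zero _
  · exact zero_add _
  · exact zero_add _

theorem zeroPairing_power_dressed (hn : 1 ≤ n) (U U' : Vertex A) (m m' : Mono n) :
    zeroPairing (algebra P n R) (dressed P n U m).power (dressed P n U' m').charge =
      zeroPairing R.alg U.power U'.charge +
        (evalCharge n m ᵥ* (zeroCartan n P.γ)⁻¹) ⬝ᵥ evalCharge n m' := by
  rw [← zeroPairing_bosonize P hn, ← bosonize_power, algebra, zeroPairing_prod, add_comm]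
  congr 2 <;> funext j
  · exact add_zero _
  · exact add_zero _
  · exact zero_add _
  · exact zero_add _

/-- The conditions on an auxiliary vertex operator `U` under which `:W'(z) m(z):` and
`:U(z) ξ(z):` have the relative contraction `relPairing`. -/
structure IsDressing (c c' : ℕ) (U : Vertex A) : Prop where
  top : HasContraction (algebra P n R) (topT P n R) (dressed P n U (vacMono n c c' 0)) 1 1
  top_symm : HasContraction (algebra P n R) (dressed P n U (vacMono n c c' 0)) (topT P n R) 1 1

theorem IsRationalization.isDressing_lam (h : IsRationalization P n R) :
    IsDressing P (n := n) R 1 0 R.Lam := ⟨h.top_lam, h.lam_top⟩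

theorem IsRationalization.isDressing_lamBar (h : IsRationalization P n R) :
    IsDressing P (n := n) R 0 1 R.LamBar := ⟨h.top_lamBar, h.lamBar_top⟩

variable {P R} {c c' : ℕ} {U : Vertex A}

/-- The auxiliary bosons contribute the same amount to every pair of terms. The trivial contraction
with T_n identifies it as minus the pairing of M_n with the vacuum monomial, which is the
subtraction in `relPairing`. -/
theorem IsDressing.modePairing_eq (h : IsDressing P (n := n) R c c' U) (hn : 1 ≤ n) (S : Finset ℕ)
    (m : Mono n) {r : ℕ} (hr : r ≠ 0) :
    modePairing (algebra P n R) (dressed P n R.W m) (dressed P n U (xiMono n c c' S)) r =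
      relPairing P n c c' S r m / r := by
  have h1 := h.top.of_one.2.2 r hr
  rw [topT_eq_dressed, modePairing_dressed P R hn _ _ _ _ hr] at h1
  rw [modePairing_dressed P R hn _ _ _ _ hr, relPairing, sub_div]
  linear_combination h1

theorem IsDressing.modePairing_symm_eq (h : IsDressing P (n := n) R c c' U) (hn : 1 ≤ n)
    (S : Finset ℕ) (m : Mono n) {r : ℕ} (hr : r ≠ 0) :
    modePairing (algebra P n R) (dressed P n U (xiMono n c c' S)) (dressed P n R.W m) r =
      relPairing P n c c' S (-r) m / r := by
  have h1 := h.top_symm.of_one.2.2 r hr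
  rw [topT_eq_dressed, modePairing_dressed P R hn _ _ _ _ hr, monoPairing_symm] at h1
  rw [modePairing_dressed P R hn _ _ _ _ hr, monoPairing_symm, relPairing, sub_div]
  linear_combination h1

theorem IsDressing.exp_zeroPairing (h : IsDressing P (n := n) R c c' U) (hn : 1 ≤ n) (S : Finset ℕ)
    (m : Mono n) (x : ℂ) (hx : zeroMonoPairing P m (xiMono n c c' S) =
      zeroMonoPairing P (boxMono n n) (vacMono n c c' 0) + x) :
    Complex.exp (zeroPairing (algebra P n R) ((dressed P n R.W m).modes 0)
      (dressed P n U (xiMono n c c' S)).charge) = Complex.exp x := by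
  have h1 := h.top.of_one.2.1
  rw [topT_eq_dressed, zeroPairing_modes_dressed P R hn] at h1
  rw [zeroPairing_modes_dressed P R hn, hx, ← add_assoc, Complex.exp_add, h1, one_mul]

theorem IsDressing.exp_zeroPairing_symm (h : IsDressing P (n := n) R c c' U) (hn : 1 ≤ n)
    (m m' : Mono n) (hm : evalCharge n m = 0) :
    Complex.exp (zeroPairing (algebra P n R) ((dressed P n U m').modes 0)
      (dressed P n R.W m).charge) = 1 := by
  have h1 := h.top_symm.of_one.2.1
  rw [topT_eq_dressed, zeroPairing_modes_dressed P R hn, zeroMonoPairing,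
    evalCharge_boxMono n hn, dotProduct_zero] at h1
  rw [zeroPairing_modes_dressed P R hn, zeroMonoPairing, hm, dotProduct_zero, h1]

theorem IsDressing.zeroPairing_power (h : IsDressing P (n := n) R c c' U) (hn : 1 ≤ n)
    (m m' : Mono n) (hm : evalCharge n m = 0) :
    zeroPairing (algebra P n R) (dressed P n U m').power (dressed P n R.W m).charge = 0 := by
  have h1 := h.top_symm.of_one.1
  rw [topT_eq_dressed, zeroPairing_power_dressed P R hn,
    evalCharge_boxMono n hn, dotProduct_zero] at h1
  rw [zeroPairing_power_dressed P R hn, hm, dotProduct_zero, h1]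

variable (P R U)

/-- The term `δ(s₁ q^t w/z) :W'(s₁ q^t w) U(w) m(w):`. -/
def residue (α : Color n ⊕ A → ℂ) (t : ℤ) (m : Mono n) : ℂ → ℂ → Module.End ℂ (Fock (Color n ⊕ A)) :=
  deltaTimes (poleLog P t) (vertexField (algebra P n R) α
    (dressed P n (R.W.shift (poleLog P t) + U) m))

/-- The commutator of a term of `T` and a term of `E` or `F`. -/
def termCommutator (α : Color n ⊕ A → ℂ) (c c' : ℕ) (m : Mono n) (S : Finset ℕ) :
    ℂ → ℂ → Module.End ℂ (Fock (Color n ⊕ A)) :=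
  commutator (vertexField (algebra P n R) α (dressed P n R.W m))
    (vertexField (algebra P n R) α (dressed P n U (xiMono n c c' S)))

variable {P R U} {α : Color n ⊕ A → ℂ}

theorem exists_zExponent_dressed
    (hα : ∀ u, ∃ k : ℤ, zExponent (algebra P n R) α R.W.inr u = k) {m : Mono n}
    (hm : evalCharge n m = 0) :
    ∃ k : ℤ, ∀ u, zExponent (algebra P n R) α (dressed P n R.W m) u = k := by
  refine exists_zExponent_eq fun u => ?_
  rw [zExponent, dressed_power_of_evalCharge_eq_zero P R.W hm]
  exact hα u

theorem IsDressing.termCommutator_eq_zero (h : IsDressing P (n := n) R c c' U) (hn : 1 ≤ n)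
    (hα : ∀ u, ∃ k : ℤ, zExponent (algebra P n R) α R.W.inr u = k)
    (S : Finset ℕ) (m : Mono n) (hm : evalCharge n m = 0)
    (h0 : zeroMonoPairing P m (xiMono n c c' S) =
      zeroMonoPairing P (boxMono n n) (vacMono n c c' 0))
    (hr : ∀ r : ℤ, r ≠ 0 → relPairing P n c c' S r m = 0) :
    termCommutator P R U α c c' m S = 0 := by
  obtain ⟨k, hk⟩ := exists_zExponent_dressed hα hm
  refine commutator_vertexField_eq_zero _ _ _ _ k hk (h.zeroPairing_power hn m _ hm) ?_
    (h.exp_zeroPairing_symm hn m _ hm) ?_ ?_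
  · rw [h.exp_zeroPairing hn S m 0 (by rw [h0, add_zero]), Complex.exp_zero]
  · intro r hr0
    rw [h.modePairing_eq hn S m hr0, hr _ (Nat.cast_ne_zero.2 hr0), zero_div]
  · intro r hr0
    rw [h.modePairing_symm_eq hn S m hr0, hr _ (neg_ne_zero.2 (Nat.cast_ne_zero.2 hr0)), zero_div]

theorem IsDressing.termCommutator_of_two_poles (h : IsDressing P (n := n) R c c' U) (hn : 1 ≤ n)
    (hα : ∀ u, ∃ k : ℤ, zExponent (algebra P n R) α R.W.inr u = k)
    (S : Finset ℕ) (m : Mono n) (hm : evalCharge n m = 0)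
    (h0 : zeroMonoPairing P m (xiMono n c c' S) =
      zeroMonoPairing P (boxMono n n) (vacMono n c c' 0)) (b : ℤ)
    (hr : ∀ r : ℤ, r ≠ 0 → relPairing P n c c' S r m = theta P r b) :
    termCommutator P R U α c c' m S =
      (-P.a) • residue P R U α b (monoShift 1 b m + xiMono n c c' S) +
      P.a • residue P R U α (b + 2) (monoShift 1 (b + 2) m + xiMono n c c' S) := by
  obtain ⟨k, hk⟩ := exists_zExponent_dressed hα hm
  have hθ (r : ℤ) : theta P r b = Complex.exp (r * poleLog P b) +
      Complex.exp (r * poleLog P (b + 2)) - Complex.exp (r * (-P.l₁ + b * P.l₂)) -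
      Complex.exp (r * (3 * P.l₁ + (b + 2) * P.l₂)) := by
    rw [theta_eq, mono_one_eq_exp, mono_one_eq_exp, Params.mono, Params.mono]
    push_cast
    rw [neg_one_mul]
  rw [residue, residue, ← dressed_shift_add, ← dressed_shift_add]
  have hc := commutator_vertexField_two_poles (algebra P n R) α (dressed P n R.W m)
    (dressed P n U (xiMono n c c' S)) k (poleLog P b) (poleLog P (b + 2)) (-P.l₁ + b * P.l₂)
    (3 * P.l₁ + (b + 2) * P.l₂) (-P.a) hk (h.zeroPairing_power hn m _ hm) ?_
    (h.exp_zeroPairing_symm hn m _ hm) ?_ ?_ ?_ ?_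
  · rw [neg_neg] at hc
    exact hc
  · rw [h.exp_zeroPairing hn S m 0 (by rw [h0, add_zero]), Complex.exp_zero]
  · intro r hr0
    rw [h.modePairing_eq hn S m hr0, hr _ (Nat.cast_ne_zero.2 hr0), hθ]
    rfl
  · intro r hr0
    rw [h.modePairing_symm_eq hn S m hr0, hr _ (neg_ne_zero.2 (Nat.cast_ne_zero.2 hr0)), hθ]
    push_cast
    rfl
  · rw [poleLog, poleLog]
    push_cast
    ring
  · rw [neg_a_mul, hθ, Int.cast_one]
    simp only [one_mul]

/-- The pole is s₁q^t and the zero s₁^x q^y. `h0` requires the zero mode factor to be their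
quotient, which `commutator_vertexField_one_pole` needs. -/
theorem IsDressing.termCommutator_of_one_pole (h : IsDressing P (n := n) R c c' U) (hn : 1 ≤ n)
    (hα : ∀ u, ∃ k : ℤ, zExponent (algebra P n R) α R.W.inr u = k)
    (S : Finset ℕ) (m : Mono n) (hm : evalCharge n m = 0) (t x y : ℤ)
    (h0 : zeroMonoPairing P m (xiMono n c c' S) =
      zeroMonoPairing P (boxMono n n) (vacMono n c c' 0) + ((1 - x) * P.l₁ + (t - y) * P.l₂))
    (hr : ∀ r : ℤ, r ≠ 0 → relPairing P n c c' S r m = P.mono r 1 t - P.mono r x y) :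
    termCommutator P R U α c c' m S =
      (P.mono 1 (1 - x) (t - y) - 1) • residue P R U α t (monoShift 1 t m + xiMono n c c' S) := by
  obtain ⟨k, hk⟩ := exists_zExponent_dressed hα hm
  have he : P.mono 1 (1 - x) (t - y) = Complex.exp (poleLog P t - (x * P.l₁ + y * P.l₂)) := by
    rw [Params.mono, poleLog]
    congr 1
    push_cast
    ring
  rw [residue, ← dressed_shift_add, he]
  refine commutator_vertexField_one_pole (algebra P n R) α (dressed P n R.W m)
    (dressed P n U (xiMono n c c' S)) k (poleLog P t) (x * P.l₁ + y * P.l₂) hk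
    (h.zeroPairing_power hn m _ hm) ?_ (h.exp_zeroPairing_symm hn m _ hm) ?_ ?_
  · rw [h.exp_zeroPairing hn S m _ h0, poleLog]
    congr 1
    ring
  · intro r hr0
    rw [h.modePairing_eq hn S m hr0, hr _ (Nat.cast_ne_zero.2 hr0), mono_one_eq_exp, Params.mono]
    rfl
  · intro r hr0
    rw [h.modePairing_symm_eq hn S m hr0, hr _ (neg_ne_zero.2 (Nat.cast_ne_zero.2 hr0)),
      mono_one_eq_exp, Params.mono]
    push_cast
    rfl

theorem IsDressing.termCommutator_boxMono (h : IsDressing P (n := n) R c c' U) (hn : 1 ≤ n)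
    (hα : ∀ u, ∃ k : ℤ, zExponent (algebra P n R) α R.W.inr u = k) (hc : c + c' = 1)
    (S : Finset ℕ) (i : ℕ) (hi : 1 ≤ i) (hin : i ≤ n) (hS : i ∈ S) :
    termCommutator P R U α c c' (boxMono n i) S =
      (-P.a) • residue P R U α (2 * tailCount n S i - n + 2 * i - 3)
        (monoShift 1 (2 * tailCount n S i - n + 2 * i - 3) (boxMono n i) + xiMono n c c' S) +
      P.a • residue P R U α (2 * tailCount n S i - n + 2 * i - 1)
        (monoShift 1 (2 * tailCount n S i - n + 2 * i - 1) (boxMono n i) + xiMono n c c' S) := by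
  have e : (2 * tailCount n S i - n + 2 * i - 1 : ℤ) = 2 * tailCount n S i - n + 2 * i - 3 + 2 := by
    ring
  rw [e]
  refine h.termCommutator_of_two_poles hn hα S _ (evalCharge_boxMono i hi)
    (zeroMonoPairing_boxMono P hn c c' hc S i hi hin) _ fun r hr => ?_
  rw [relPairing_boxMono P hn hr c c' hc S i hi hin, bit, if_pos hS, Int.cast_one, one_mul]

theorem IsDressing.termCommutator_boxMono_eq_zero (h : IsDressing P (n := n) R c c' U) (hn : 1 ≤ n)
    (hα : ∀ u, ∃ k : ℤ, zExponent (algebra P n R) α R.W.inr u = k) (hc : c + c' = 1)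
    (S : Finset ℕ) (i : ℕ) (hi : 1 ≤ i) (hin : i ≤ n) (hS : i ∉ S) :
    termCommutator P R U α c c' (boxMono n i) S = 0 := by
  refine h.termCommutator_eq_zero hn hα S _ (evalCharge_boxMono i hi)
    (zeroMonoPairing_boxMono P hn c c' hc S i hi hin) fun r hr => ?_
  rw [relPairing_boxMono P hn hr c c' hc S i hi hin, bit, if_neg hS, Int.cast_zero, zero_mul]

theorem IsDressing.termCommutator_boxMonoBar (h : IsDressing P (n := n) R c c' U) (hn : 1 ≤ n)
    (hα : ∀ u, ∃ k : ℤ, zExponent (algebra P n R) α R.W.inr u = k) (hc : c + c' = 1)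
    (S : Finset ℕ) (i : ℕ) (hi : 1 ≤ i) (hin : i ≤ n) (hS : i ∉ S) :
    termCommutator P R U α c c' (boxMonoBar n i) S =
      (-P.a) • residue P R U α (2 * tailCount n S i - n - 1)
        (monoShift 1 (2 * tailCount n S i - n - 1) (boxMonoBar n i) + xiMono n c c' S) +
      P.a • residue P R U α (2 * tailCount n S i - n + 1)
        (monoShift 1 (2 * tailCount n S i - n + 1) (boxMonoBar n i) + xiMono n c c' S) := by
  have e : (2 * tailCount n S i - n + 1 : ℤ) = 2 * tailCount n S i - n - 1 + 2 := by ring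
  rw [e]
  refine h.termCommutator_of_two_poles hn hα S _ (evalCharge_boxMonoBar i hi)
    (zeroMonoPairing_boxMonoBar P hn c c' hc S i hi hin) _ fun r hr => ?_
  rw [relPairing_boxMonoBar P hn hr c c' hc S i hi hin, bit, if_neg hS, sub_zero, Int.cast_one,
    one_mul]

theorem IsDressing.termCommutator_boxMonoBar_eq_zero (h : IsDressing P (n := n) R c c' U)
    (hn : 1 ≤ n) (hα : ∀ u, ∃ k : ℤ, zExponent (algebra P n R) α R.W.inr u = k) (hc : c + c' = 1)
    (S : Finset ℕ) (i : ℕ) (hi : 1 ≤ i) (hin : i ≤ n) (hS : i ∈ S) :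
    termCommutator P R U α c c' (boxMonoBar n i) S = 0 := by
  refine h.termCommutator_eq_zero hn hα S _ (evalCharge_boxMonoBar i hi)
    (zeroMonoPairing_boxMonoBar P hn c c' hc S i hi hin) fun r hr => ?_
  rw [relPairing_boxMonoBar P hn hr c c' hc S i hi hin, bit, if_pos hS, sub_self, Int.cast_zero,
    zero_mul]

theorem IsDressing.termCommutator_boxMonoMid_self (h : IsDressing P (n := n) R c c' U) (hn : 1 ≤ n)
    (hα : ∀ u, ∃ k : ℤ, zExponent (algebra P n R) α R.W.inr u = k) (hc : c + c' = 1)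
    (S : Finset ℕ) :
    termCommutator P R U α c c' (boxMonoMid n c c') S =
      (P.mono 1 2 2 - 1) • residue P R U α (2 * tailCount n S 1 - n + 1)
        (monoShift 1 (2 * tailCount n S 1 - n + 1) (boxMonoMid n c c') + xiMono n c c' S) := by
  have h1 := h.termCommutator_of_one_pole hn hα S _ (evalCharge_boxMonoMid c c' hc)
    (2 * tailCount n S 1 - n + 1) (-1) (2 * tailCount n S 1 - n - 1) ?_
    fun r hr => relPairing_boxMonoMid_self P hn hr c c' hc S
  · rw [h1]
    congr 3
    ring
  · rw [zeroMonoPairing_boxMonoMid_self P hn c c' hc]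
    push_cast
    ring

theorem IsDressing.termCommutator_boxMonoMid_swap (h : IsDressing P (n := n) R c c' U) (hn : 1 ≤ n)
    (hα : ∀ u, ∃ k : ℤ, zExponent (algebra P n R) α R.W.inr u = k) (hc : c + c' = 1)
    (S : Finset ℕ) :
    termCommutator P R U α c c' (boxMonoMid n c' c) S =
      (P.mono 1 (-2) (-2) - 1) • residue P R U α (2 * tailCount n S 1 - n - 1)
        (monoShift 1 (2 * tailCount n S 1 - n - 1) (boxMonoMid n c' c) + xiMono n c c' S) := by
  have h1 := h.termCommutator_of_one_pole hn hα S _ (evalCharge_boxMonoMid c' c (by omega))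
    (2 * tailCount n S 1 - n - 1) 3 (2 * tailCount n S 1 - n + 1) ?_
    fun r hr => relPairing_boxMonoMid_swap P hn hr c c' hc S
  · rw [h1]
    congr 3
    ring
  · rw [zeroMonoPairing_boxMonoMid_swap P hn c c' hc]
    push_cast
    ring

end TermCommutators

/-! ### Monomials of the residues -/

section ResidueMonomials

variable {n : ℕ}

theorem monoShift_var (a t : ℤ) (i : ℕ) (x y : ℤ) :
    monoShift a t (var n i x y) = var n i (x + a) (y + t) := by
  rw [var, var]
  split_ifs
  · exact Finsupp.mapDomain_single
  · exact map_zero _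

theorem var_eq_zero (a b : ℤ) : var n (n + 1) a b = 0 := by
  rw [var, dif_neg (lt_irrefl _)]

theorem monoShift_vacMono (c c' : ℕ) (N d : ℤ) :
    monoShift 0 (2 * d) (vacMono n c c' N) = vacMono n c c' (N + d) := by
  simp only [vacMono, map_sub, monoShift_var, add_zero, mul_add]

theorem monoShift_partMono (j : ℕ) (N d : ℤ) :
    monoShift 0 (2 * d) (partMono n j N) = partMono n j (N + d) := by
  rw [partMono, partMono]
  split_ifs <;>
  · simp only [map_sub, map_add, map_neg, monoShift_var, add_zero]
    ring_nf

/-- The factor of the residues of the first half of the current at the position `j`. -/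
def gapMono (n c c' j : ℕ) (N : ℤ) : Mono n :=
  if j = 1 then
    monoShift 1 (2 * N - n + 1) (boxMonoMid n c c') + vacMono n c c' N - vacMono n c c' (N + 1)
  else var n j 1 (j + 2 * N - 1) - var n j 1 (j + 2 * N + 1)

/-- Here N counts the elements above i, so i itself carries the count N + 1. At the lower pole M_i
absorbs the factor of i and leaves a gap at i; at the upper pole (`monoShift_boxMono_upper`) the gap
is at i + 1. The gap at position 1 is defined by the middle monomial so that the pattern continues
there. -/
theorem monoShift_boxMono_lower (c c' : ℕ) (hc : c + c' = 1) (i : ℕ) (hi : 1 ≤ i) (N : ℤ) :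
    monoShift 1 (2 * N + 2 * i - n - 1) (boxMono n i) + partMono n i (N + 1) =
      gapMono n c c' i N := by
  rw [boxMono, partMono, gapMono]
  by_cases h : i = 1
  · subst h
    rcases (by omega : c = 0 ∧ c' = 1 ∨ c = 1 ∧ c' = 0) with ⟨rfl, rfl⟩ | ⟨rfl, rfl⟩ <;>
    · simp only [if_true, boxMonoMid, vacMono, map_sub, map_add, map_neg, monoShift_var]
      push_cast
      ring_nf
      abel
  · simp only [h, if_false, map_add, map_neg, monoShift_var]
    ring_nf
    abel

theorem monoShift_boxMono_upper (c c' : ℕ) (i : ℕ) (hi : 1 ≤ i) (N : ℤ) :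
    monoShift 1 (2 * N + 2 * i - n + 1) (boxMono n i) + partMono n i (N + 1) =
      gapMono n c c' (i + 1) N := by
  rw [boxMono, partMono, gapMono, if_neg (show i + 1 ≠ 1 by omega)]
  by_cases h : i = 1
  · subst h
    simp only [if_true, map_sub, map_add, map_neg, monoShift_var]
    push_cast
    ring_nf
    abel
  · simp only [h, if_false, map_add, map_neg, monoShift_var]
    push_cast
    ring_nf
    abel

/-- The upper pole for N and the lower pole for N + 1 coincide. Both sides are the sum of the two
parts and the same shifted M_i. -/
theorem partMono_add_gapMono (c c' : ℕ) (hc : c + c' = 1) (i : ℕ) (hi : 1 ≤ i) (N : ℤ) :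
    partMono n i (N + 1) + gapMono n c c' i (N + 1) = partMono n i (N + 2) +
      gapMono n c c' (i + 1) N := by
  rw [← monoShift_boxMono_lower c c' hc i hi, ← monoShift_boxMono_upper c c' i hi]
  ring_nf
  abel

/-- On the second half no gap is needed: at a pole, M_{\bar i} supplies precisely the factor of an
element i, so the residue is a shifted form of a term containing i. -/
theorem monoShift_boxMonoBar (i : ℕ) (N : ℤ) :
    monoShift 1 (2 * N - n - 1) (boxMonoBar n i) = partMono n i N := by
  rw [boxMonoBar, partMono]
  split_ifs
  · simp only [map_sub, map_add, map_neg, monoShift_var]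
    ring_nf
  · simp only [map_add, map_neg, monoShift_var]
    ring_nf

theorem monoShift_boxMonoMid_swap (c c' : ℕ) (hc : c + c' = 1) (N : ℤ) :
    monoShift 1 (2 * N - n - 1) (boxMonoMid n c' c) + vacMono n c c' N =
      vacMono n c c' (N - 1) := by
  rcases (by omega : c = 0 ∧ c' = 1 ∨ c = 1 ∧ c' = 0) with ⟨rfl, rfl⟩ | ⟨rfl, rfl⟩ <;>
  · simp only [boxMonoMid, vacMono, map_sub, map_add, map_neg, monoShift_var]
    ring_nf
    abel

theorem bit_insert (S : Finset ℕ) (i j : ℕ) (hi : i ∉ S) :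
    bit (insert i S) j = bit S j + if j = i then 1 else 0 := by
  rw [bit, bit]
  by_cases h : j = i
  · subst h
    simp [hi]
  · simp [h]

theorem tailCount_insert (S : Finset ℕ) {i : ℕ} (hi : i ∉ S) (hin : i ≤ n) (j : ℕ) :
    tailCount n (insert i S) j = tailCount n S j + if j ≤ i then 1 else 0 := by
  rw [tailCount, tailCount, Finset.sum_congr rfl fun k _ => bit_insert S i k hi,
    Finset.sum_add_distrib, Finset.sum_ite_eq']
  simp [hin]

/-- The monomial of the residue at `t = 2 N_j + 2 j - n - 1` in the first half. -/
def residueMono (n c c' : ℕ) (S : Finset ℕ) (j : ℕ) : Mono n :=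
  vacMono n c c' (tailCount n S 1 + 1) +
    ∑ l ∈ Finset.Icc 1 n, bit S l • partMono n l (tailCount n S l + if l < j then 1 else 0) +
    gapMono n c c' j (tailCount n S j)

/-- The monomial of the residue at `t = 2 N_j - n - 1` in the second half. -/
def residueMonoBar (n c c' : ℕ) (S : Finset ℕ) (j : ℕ) : Mono n :=
  vacMono n c c' (tailCount n S 1 - 1) +
    ∑ l ∈ Finset.Icc 1 n, bit S l • partMono n l (tailCount n S l - if l < j then 1 else 0)

theorem xiMono_insert (hn : 1 ≤ n) (c c' : ℕ) (hc : c + c' = 1) (S : Finset ℕ) {i : ℕ} (hi : 1 ≤ i)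
    (hin : i ≤ n) (hS : i ∉ S) :
    xiMono n c c' (insert i S) = vacMono n c c' (tailCount n S 1 + 1) +
      ∑ l ∈ Finset.Icc 1 n, bit S l • partMono n l (tailCount n S l + if l < i then 1 else 0) +
      partMono n i (tailCount n S i + 1) := by
  rw [xiMono_eq hn c c' hc, tailCount_insert S hS hin, if_pos hi, add_assoc]
  congr 1
  have h (l : ℕ) : bit (insert i S) l • partMono n l (tailCount n (insert i S) l) =
      bit S l • partMono n l (tailCount n S l + if l < i then 1 else 0) +
        if l = i then partMono n i (tailCount n S i + 1) else 0 := by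
    rw [bit_insert S i l hS, tailCount_insert S hS hin]
    by_cases h : l = i
    · subst h
      simp [bit, hS]
    · rw [if_neg h, if_neg h, add_zero, add_zero]
      simp only [show l ≤ i ↔ l < i by omega]
  rw [Finset.sum_congr rfl fun l _ => h l, Finset.sum_add_distrib, Finset.sum_ite_eq',
    if_pos (Finset.mem_Icc.2 ⟨hi, hin⟩)]

theorem sum_partMono_congr (S : Finset ℕ) {f g : ℕ → ℤ} (h : ∀ l ∈ S, f l = g l) :
    ∑ l ∈ Finset.Icc 1 n, bit S l • partMono n l (f l) =
      ∑ l ∈ Finset.Icc 1 n, bit S l • partMono n l (g l) := by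
  refine Finset.sum_congr rfl fun l _ => ?_
  by_cases hl : l ∈ S
  · rw [h l hl]
  · rw [bit, if_neg hl, zero_smul, zero_smul]

theorem residueMono_lower (hn : 1 ≤ n) (c c' : ℕ) (hc : c + c' = 1) (S : Finset ℕ) {i : ℕ}
    (hi : 1 ≤ i) (hin : i ≤ n) (hS : i ∉ S) :
    monoShift 1 (2 * tailCount n S i + 2 * i - n - 1) (boxMono n i) + xiMono n c c' (insert i S) =
      residueMono n c c' S i := by
  rw [xiMono_insert hn c c' hc S hi hin hS, residueMono, ← monoShift_boxMono_lower c c' hc i hi]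
  abel

theorem residueMono_upper (hn : 1 ≤ n) (c c' : ℕ) (hc : c + c' = 1) (S : Finset ℕ) {i : ℕ}
    (hi : 1 ≤ i) (hin : i ≤ n) (hS : i ∉ S) :
    monoShift 1 (2 * tailCount n S i + 2 * i - n + 1) (boxMono n i) + xiMono n c c' (insert i S) =
      residueMono n c c' S (i + 1) := by
  have h : tailCount n S (i + 1) = tailCount n S i := by
    rw [tailCount_eq_add hin, bit, if_neg hS, zero_add]
  rw [xiMono_insert hn c c' hc S hi hin hS, residueMono, h, ← monoShift_boxMono_upper c c' i hi,
    sum_partMono_congr S (g := fun l => tailCount n S l + if l < i + 1 then 1 else 0)]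
  · abel
  · intro l hl
    have : l ≠ i := fun h => hS (h ▸ hl)
    simp only [show l < i + 1 ↔ l < i by omega]

theorem residueMono_one (hn : 1 ≤ n) (c c' : ℕ) (hc : c + c' = 1) (S : Finset ℕ) :
    monoShift 1 (2 * tailCount n S 1 - n + 1) (boxMonoMid n c c') + xiMono n c c' S =
      residueMono n c c' S 1 := by
  have h : ∑ l ∈ Finset.Icc 1 n,
      bit S l • partMono n l (tailCount n S l + if l < 1 then 1 else 0) =
      ∑ l ∈ Finset.Icc 1 n, bit S l • partMono n l (tailCount n S l) := by
    refine Finset.sum_congr rfl fun l hl => ?_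
    have := Finset.mem_Icc.1 hl
    rw [if_neg (by omega), add_zero]
  rw [residueMono, h, xiMono_eq hn c c' hc, gapMono, if_pos rfl]
  abel

/-- The gap passes through an occupied position i: the count of i is raised by one, and this change
is absorbed by moving the gap to i + 1. -/
theorem residueMono_succ (c c' : ℕ) (hc : c + c' = 1) (S : Finset ℕ) {i : ℕ} (hi : 1 ≤ i)
    (hin : i ≤ n) (hS : i ∈ S) : residueMono n c c' S (i + 1) = residueMono n c c' S i := by
  have h : tailCount n S i = tailCount n S (i + 1) + 1 := by
    rw [tailCount_eq_add hin, bit, if_pos hS, add_comm]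
  have h1 (j : ℕ) (hj : j = i ∨ j = i + 1) :
      ∑ l ∈ Finset.Icc 1 n, bit S l • partMono n l (tailCount n S l + if l < j then 1 else 0) =
      ∑ l ∈ (Finset.Icc 1 n).erase i,
        bit S l • partMono n l (tailCount n S l + if l < i then 1 else 0) +
      partMono n i (tailCount n S i + if i < j then 1 else 0) := by
    refine (Finset.sum_erase_add _ _ (Finset.mem_Icc.2 ⟨hi, hin⟩)).symm.trans ?_
    refine congrArg₂ HAdd.hAdd ?_ ?_
    · refine Finset.sum_congr rfl fun l hl => ?_
      have := Finset.ne_of_mem_erase hl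
      simp only [show l < j ↔ l < i by omega]
    · rw [bit, if_pos hS, one_smul]
  have h2 := partMono_add_gapMono (n := n) c c' hc i hi (tailCount n S (i + 1))
  rw [residueMono, residueMono, h1 _ (Or.inl rfl), h1 _ (Or.inr rfl), if_pos (Nat.lt_succ_self i),
    if_neg (lt_irrefl i), add_zero, h, add_assoc _ (1 : ℤ), one_add_one_eq_two]
  simp only [add_assoc] at h2 ⊢
  rw [h2]

/-- At j = n + 1 the gap has the trivial color n + 1 and all counts are raised by one, which is
multiplication of the argument by q². -/
theorem residueMono_last (hn : 1 ≤ n) (c c' : ℕ) (hc : c + c' = 1) (S : Finset ℕ) :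
    residueMono n c c' S (n + 1) = monoShift 0 2 (xiMono n c c' S) := by
  have h1 := monoShift_vacMono (n := n) c c' (tailCount n S 1) 1
  rw [mul_one] at h1
  rw [residueMono, xiMono_eq hn c c' hc, gapMono, if_neg (by omega), var_eq_zero, var_eq_zero,
    sub_zero, add_zero, map_add, map_sum, h1]
  refine congrArg (HAdd.hAdd _) (Finset.sum_congr rfl fun l hl => ?_)
  have h2 := monoShift_partMono (n := n) l (tailCount n S l) 1
  rw [mul_one] at h2
  have := Finset.mem_Icc.1 hl
  rw [map_zsmul, h2, if_pos (by omega)]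

theorem residueMonoBar_last (hn : 1 ≤ n) (c c' : ℕ) (hc : c + c' = 1) (S : Finset ℕ) :
    residueMonoBar n c c' S (n + 1) = monoShift 0 (-2) (xiMono n c c' S) := by
  have h1 := monoShift_vacMono (n := n) c c' (tailCount n S 1) (-1)
  rw [mul_neg_one] at h1
  rw [residueMonoBar, xiMono_eq hn c c' hc, map_add, map_sum, h1]
  refine congrArg (HAdd.hAdd _) (Finset.sum_congr rfl fun l hl => ?_)
  have h2 := monoShift_partMono (n := n) l (tailCount n S l) (-1)
  rw [mul_neg_one] at h2
  have := Finset.mem_Icc.1 hl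
  rw [map_zsmul, h2, if_pos (by omega), sub_eq_add_neg]

theorem residueMonoBar_one (hn : 1 ≤ n) (c c' : ℕ) (hc : c + c' = 1) (S : Finset ℕ) :
    monoShift 1 (2 * tailCount n S 1 - n - 1) (boxMonoMid n c' c) + xiMono n c c' S =
      residueMonoBar n c c' S 1 := by
  rw [residueMonoBar, xiMono_eq hn c c' hc, ← add_assoc, monoShift_boxMonoMid_swap c c' hc]
  refine congrArg (HAdd.hAdd _) (Finset.sum_congr rfl fun l hl => ?_)
  have := Finset.mem_Icc.1 hl
  rw [if_neg (by omega), sub_zero]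

theorem residueMonoBar_succ (S : Finset ℕ) (c c' : ℕ) {i : ℕ} (hS : i ∉ S) :
    residueMonoBar n c c' S (i + 1) = residueMonoBar n c c' S i := by
  rw [residueMonoBar, residueMonoBar,
    sum_partMono_congr S (g := fun l => tailCount n S l - if l < i then 1 else 0)]
  intro l hl
  have : l ≠ i := fun h => hS (h ▸ hl)
  simp only [show l < i + 1 ↔ l < i by omega]

/-- The upper pole corresponds to j = i, where i keeps its count in the enlarged set; the lower pole
corresponds to j = i + 1, where that count is lowered. -/
theorem residueMonoBar_insert (hn : 1 ≤ n) (c c' : ℕ) (hc : c + c' = 1) (S : Finset ℕ) {i j : ℕ}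
    (hi : 1 ≤ i) (hin : i ≤ n) (hS : i ∉ S) (hj : j = i ∨ j = i + 1) :
    monoShift 1 (2 * (tailCount n S i + if j = i then 1 else 0) - n - 1) (boxMonoBar n i) +
      xiMono n c c' S = residueMonoBar n c c' (insert i S) j := by
  rw [monoShift_boxMonoBar, residueMonoBar, tailCount_insert S hS hin, if_pos hi,
    add_sub_cancel_right, xiMono_eq hn c c' hc, add_left_comm]
  congr 1
  have h (l : ℕ) : bit (insert i S) l •
        partMono n l (tailCount n (insert i S) l - if l < j then 1 else 0) =
      (if l = i then partMono n i (tailCount n S i + if j = i then 1 else 0) else 0) +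
      bit S l • partMono n l (tailCount n S l) := by
    rw [bit_insert S i l hS, tailCount_insert S hS hin]
    by_cases h : l = i
    · subst h
      rcases hj with rfl | rfl <;> simp [bit, hS]
    · rw [if_neg h, if_neg h, add_zero, zero_add]
      simp only [show l < j ↔ l ≤ i by omega, add_sub_cancel_right]
  rw [Finset.sum_congr rfl fun l _ => h l, Finset.sum_add_distrib, Finset.sum_ite_eq',
    if_pos (Finset.mem_Icc.2 ⟨hi, hin⟩)]

end ResidueMonomials

/-! ### Expansion of the commutators of the currents -/

section Currents

variable {J : Type*}

theorem commutator_add_left (X X' Y : Field J) :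
    commutator (X + X') Y = commutator X Y + commutator X' Y := by
  funext κ κ'
  simp only [commutator, Pi.add_apply, add_mul, mul_add]
  abel

theorem commutator_add_right (X Y Y' : Field J) :
    commutator X (Y + Y') = commutator X Y + commutator X Y' := by
  funext κ κ'
  simp only [commutator, Pi.add_apply, add_mul, mul_add]
  abel

theorem commutator_smul_smul (x y : ℂ) (X Y : Field J) :
    commutator (x • X) (y • Y) = (y * x) • commutator X Y := by
  funext κ κ'
  simp only [commutator, Pi.smul_apply, smul_mul_smul_comm, mul_comm x y]
  exact (smul_sub (y * x) (X κ * Y κ') (Y κ' * X κ)).symm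

theorem commutator_sum_left {ι : Type*} (s : Finset ι) (X : ι → Field J) (Y : Field J) :
    commutator (∑ i ∈ s, X i) Y = ∑ i ∈ s, commutator (X i) Y :=
  map_sum (AddMonoidHom.mk' (M := Field J) (fun X => commutator X Y)
    fun X X' => commutator_add_left X X' Y) X s

theorem commutator_sum_right {ι : Type*} (s : Finset ι) (X : Field J) (Y : ι → Field J) :
    commutator X (∑ i ∈ s, Y i) = ∑ i ∈ s, commutator X (Y i) :=
  map_sum (AddMonoidHom.mk' (M := Field J) (fun Y => commutator X Y)
    fun Y Y' => commutator_add_right X Y Y') Y s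

theorem deltaTimes_add (l : ℂ) (G G' : Field J) :
    deltaTimes l (G + G') = deltaTimes l G + deltaTimes l G' := by
  funext κ κ'
  simp only [deltaTimes, Pi.add_apply]
  split_ifs
  · rw [smul_add]
  · rw [add_zero]

theorem deltaTimes_smul (l x : ℂ) (G : Field J) :
    deltaTimes l (x • G) = x • deltaTimes l G := by
  funext κ κ'
  simp only [deltaTimes, Pi.smul_apply]
  split_ifs
  · rw [smul_comm]
  · rw [smul_zero]

theorem deltaTimes_sum {ι : Type*} (s : Finset ι) (l : ℂ) (G : ι → Field J) :
    deltaTimes l (∑ i ∈ s, G i) = ∑ i ∈ s, deltaTimes l (G i) :=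
  map_sum (AddMonoidHom.mk' (M := Field J) (deltaTimes l) (deltaTimes_add l)) G s

variable [Fintype J] (H : Heisenberg J) (α : J → ℂ)

theorem field_add (X Y : Current J) :
    Current.field H α (X + Y) = Current.field H α X + Current.field H α Y := by
  funext κ
  exact Finsupp.sum_add_index' (fun V => zero_smul ℂ _) fun V x y => add_smul x y _

theorem field_single (V : Vertex J) (x : ℂ) :
    Current.field H α (Finsupp.single V x) = x • vertexField H α V := by
  funext κ
  exact Finsupp.sum_single_index (zero_smul ℂ _)

theorem field_sum {ι : Type*} (s : Finset ι) (X : ι → Current J) :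
    Current.field H α (∑ i ∈ s, X i) = ∑ i ∈ s, Current.field H α (X i) :=
  map_sum (AddMonoidHom.mk' (M := Current J) (G := Field J) (Current.field H α) (field_add H α)) X s

end Currents

/-! ### Expansion of the dressed and shifted currents into vertex operators -/

section Dress

variable {A : Type*} (P : Params) (n : ℕ)

theorem dress_add (U : Vertex A) (X Y : Current (Color n)) :
    dress n U (X + Y) = dress n U X + dress n U Y := by
  rw [dress, Finsupp.mapDomain_add, Current.normalMul, Finsupp.mapDomain_add]
  rfl

theorem dress_sum (U : Vertex A) {ι : Type*} (s : Finset ι) (X : ι → Current (Color n)) :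
    dress n U (∑ i ∈ s, X i) = ∑ i ∈ s, dress n U (X i) :=
  map_sum (AddMonoidHom.mk' (dress n U) (dress_add n U)) X s

theorem dress_single (U : Vertex A) (m : Mono n) (x : ℂ) :
    dress n U (Finsupp.single (bosonize P n m) x) = Finsupp.single (dressed P n U m) x := by
  rw [dress, Finsupp.mapDomain_single, Current.normalMul, Finsupp.mapDomain_single]
  rfl

theorem dress_xiCurrent (U : Vertex A) (c c' : ℕ) :
    dress n U (xiCurrent P n c c') = ∑ S ∈ (Finset.Icc 1 n).powerset,
      Finsupp.single (dressed P n U (xiMono n c c' S)) (xiCoeff P n S) := by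
  rw [xiCurrent, dress_sum]
  exact Finset.sum_congr rfl fun S _ => dress_single P n U _ _

variable (R : Auxiliary A)

theorem T_eq : T P n R =
    ∑ i ∈ Finset.Icc 1 n,
      Finsupp.single (dressed P n R.W (boxMono n i)) (P.q ^ (2 * (i : ℤ) - 1) * P.s₁)
    + Finsupp.single (dressed P n R.W (boxMonoMid n 1 0)) ((P.s₁ - P.s₁⁻¹) / (P.q - P.q⁻¹))
    + Finsupp.single (dressed P n R.W (boxMonoMid n 0 1)) ((P.s₁ - P.s₁⁻¹) / (P.q - P.q⁻¹))
    + ∑ i ∈ Finset.Icc 1 n,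
      Finsupp.single (dressed P n R.W (boxMonoBar n i)) (P.q ^ (-2 * (i : ℤ) + 1) * P.s₁⁻¹) := by
  rw [T, chiCurrent, dress_add, dress_add, dress_add, dress_sum, dress_sum, dress_single,
    dress_single]
  simp only [dress_single]

theorem shifted_dress_xiCurrent (U : Vertex A) (c c' : ℕ) (t d : ℤ) :
    shifted n R (poleLog P t) (d * P.l₂) U (dress n U (xiCurrent P n c c')) =
      ∑ S ∈ (Finset.Icc 1 n).powerset,
        Finsupp.single (dressed P n (R.W.shift (poleLog P t) + U)
          (monoShift 0 d (xiMono n c c' S))) (xiCoeff P n S) := by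
  rw [shifted, dress_xiCurrent, Current.shift, Finsupp.mapDomain_finsetSum, Current.normalMul,
    Finsupp.mapDomain_finsetSum]
  refine Finset.sum_congr rfl fun S _ => ?_
  rw [Finsupp.mapDomain_single, Finsupp.mapDomain_single]
  congr 1
  have h := dressed_shift P U (xiMono n c c' S) 0 d
  rw [Int.cast_zero, zero_mul, zero_add] at h
  rw [h, dressed, dressed, inr_add]
  abel

end Dress

/-! ### Reindexing over subsets, and telescoping -/

section Sums

variable {M : Type*} [AddCommMonoid M]

/-- Pairs (S, i) with i ∈ S correspond to pairs (S \ {i}, i). This gathers, under one set, the terms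
whose residues cancel. -/
theorem sum_powerset_mem (s : Finset ℕ) (f : ℕ → Finset ℕ → M) :
    ∑ S ∈ s.powerset, ∑ i ∈ s with i ∈ S, f i S =
      ∑ S ∈ s.powerset, ∑ i ∈ s with i ∉ S, f i (insert i S) := by
  rw [Finset.sum_sigma', Finset.sum_sigma']
  refine Finset.sum_bij' (fun a _ => ⟨a.1.erase a.2, a.2⟩) (fun a _ => ⟨insert a.2 a.1, a.2⟩)
    ?_ ?_ ?_ ?_ ?_
  · rintro ⟨S, i⟩ h
    simp only [Finset.mem_sigma, Finset.mem_powerset, Finset.mem_filter] at h ⊢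
    exact ⟨(Finset.erase_subset _ _).trans h.1, h.2.1, Finset.notMem_erase _ _⟩
  · rintro ⟨S, i⟩ h
    simp only [Finset.mem_sigma, Finset.mem_powerset, Finset.mem_filter] at h ⊢
    exact ⟨Finset.insert_subset h.2.1 h.1, h.2.1, Finset.mem_insert_self _ _⟩
  · rintro ⟨S, i⟩ h
    simp only [Finset.mem_sigma, Finset.mem_filter] at h
    simp [Finset.insert_erase h.2.2]
  · rintro ⟨S, i⟩ h
    simp only [Finset.mem_sigma, Finset.mem_filter] at h
    simp [Finset.erase_insert h.2.2]
  · rintro ⟨S, i⟩ h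
    simp only [Finset.mem_sigma, Finset.mem_filter] at h
    simp [Finset.insert_erase h.2.2]

theorem sum_powerset_notMem (s : Finset ℕ) (f : ℕ → Finset ℕ → M) :
    ∑ S ∈ s.powerset, ∑ i ∈ s with i ∉ S, f i S =
      ∑ S ∈ s.powerset, ∑ i ∈ s with i ∈ S, f i (S.erase i) := by
  rw [sum_powerset_mem s fun i S => f i (S.erase i)]
  refine Finset.sum_congr rfl fun S _ => Finset.sum_congr rfl fun i hi => ?_
  rw [Finset.erase_insert (Finset.mem_filter.1 hi).2]

variable [Module ℂ M]

/-- Where p fails G is stationary, so the missing increments are zero and the full sum telescopes.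
The extra term removes the end at 1. -/
theorem sum_filter_add_smul (n : ℕ) (p : ℕ → Prop) [DecidablePred p] (x : ℂ) (f G : ℕ → M)
    (h : ∀ i ∈ Finset.Icc 1 n, p i → f i = x • G i + (-x) • G (i + 1))
    (h' : ∀ i ∈ Finset.Icc 1 n, ¬p i → G (i + 1) = G i) :
    ∑ i ∈ Finset.Icc 1 n with p i, f i + (-x) • G 1 = (-x) • G (n + 1) := by
  have h0 (y : M) : x • y + (-x) • y = 0 := by rw [← add_smul, add_neg_cancel, zero_smul]
  have h1 (i : ℕ) (hi : i ∈ Finset.Icc 1 n) :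
      (if p i then f i else 0) = x • G i + (-x) • G (i + 1) := by
    split_ifs with hp
    · exact h i hi hp
    · rw [h' i hi hp, h0]
  rw [Finset.sum_filter, Finset.sum_congr rfl h1]
  clear h h' h1
  induction n with
  | zero => simp
  | succ n ih =>
    rw [← Finset.insert_Icc_right_eq_Icc_add_one (by omega), Finset.sum_insert (by simp),
      add_assoc, ih, add_assoc, add_comm ((-x) • G (n + 1 + 1)), ← add_assoc, h0, zero_add]

end Sums

/-! ### Coefficients of the currents -/

section Coefficients

variable (P : Params) {n : ℕ}

theorem q_ne_zero : P.q ≠ 0 := Complex.exp_ne_zero _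

theorem s₁_ne_zero : P.s₁ ≠ 0 := Complex.exp_ne_zero _

/-- The factor q^{2-2i} cancels the dependence on i of the coefficients q^{2i-1}s₁ and q^{1-2i}s₁⁻¹
in V_χ, which is what makes the telescoping possible. -/
theorem xiCoeff_insert (S : Finset ℕ) {i : ℕ} (hi : 1 ≤ i) (hin : i ≤ n) (hS : i ∉ S) :
    xiCoeff P n (insert i S) = -(xiCoeff P n S * P.q ^ (2 - 2 * (i : ℤ))) := by
  have hi' : i ∈ Finset.Icc 1 n := Finset.mem_Icc.2 ⟨hi, hin⟩
  have h1 : ∑ j ∈ Finset.Icc 1 n, bit (insert i S) j = ∑ j ∈ Finset.Icc 1 n, bit S j + 1 := by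
    rw [Finset.sum_congr rfl fun k _ => bit_insert S i k hS, Finset.sum_add_distrib,
      Finset.sum_ite_eq', if_pos hi']
  have h2 : ∑ j ∈ Finset.Icc 1 n, ((j : ℤ) - 1) * bit (insert i S) j =
      ∑ j ∈ Finset.Icc 1 n, ((j : ℤ) - 1) * bit S j + (i - 1) := by
    rw [Finset.sum_congr rfl fun k _ => by rw [bit_insert S i k hS, mul_add],
      Finset.sum_add_distrib]
    simp only [mul_ite, mul_one, mul_zero]
    rw [Finset.sum_ite_eq', if_pos hi']
  have hq := q_ne_zero P
  rw [xiCoeff, xiCoeff, h1, h2, zpow_add₀ (by norm_num), zpow_one,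
    mul_assoc ((-1 : ℂ) ^ (∑ j ∈ Finset.Icc 1 n, bit S j)) _ (P.q ^ (2 - 2 * (i : ℤ))),
    ← zpow_add₀ hq]
  ring_nf

/-- The coefficient of the middle monomials in V_χ is the one for which the one-pole residue s₁²q² -
1 matches the two-pole residues, since s₁²q² - 1 = -s₁q(s₃ - s₃⁻¹). -/
theorem mid_coeff : (P.s₁ - P.s₁⁻¹) / (P.q - P.q⁻¹) * (P.mono 1 2 2 - 1) = -(P.a * P.q * P.s₁) := by
  have hq := q_sub_inv_ne_zero P
  have h : P.mono 1 2 2 = P.s₁ ^ 2 * P.q ^ 2 := by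
    rw [Params.mono, Params.s₁, Params.q, ← Complex.exp_nat_mul, ← Complex.exp_nat_mul,
      ← Complex.exp_add]
    congr 1
    push_cast
    ring
  have h1 := s₁_ne_zero P
  have h2 := q_ne_zero P
  rw [h, Params.a, Params.s₃]
  generalize P.q - P.q⁻¹ = d at hq
  field_simp
  ring

theorem mid_coeff_swap :
    (P.s₁ - P.s₁⁻¹) / (P.q - P.q⁻¹) * (P.mono 1 (-2) (-2) - 1) = P.a * P.s₃ := by
  have hq := q_sub_inv_ne_zero P
  have h : P.mono 1 (-2) (-2) = (P.s₁ ^ 2 * P.q ^ 2)⁻¹ := by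
    rw [Params.mono, Params.s₁, Params.q, ← Complex.exp_nat_mul, ← Complex.exp_nat_mul,
      ← Complex.exp_add, ← Complex.exp_neg]
    congr 1
    push_cast
    ring
  have h1 := s₁_ne_zero P
  have h2 := q_ne_zero P
  rw [h, Params.a, Params.s₃]
  generalize P.q - P.q⁻¹ = d at hq
  field_simp

end Coefficients

/-! ### Cancellation of residues and the commutators of the currents -/

section MainTheorem

variable {A : Type*} [Fintype A] {P : Params} {n : ℕ} {R : Auxiliary A} {c c' : ℕ} {U : Vertex A}
  {α : Color n ⊕ A → ℂ}

/-- Telescoping in j = 1, …, n + 1: G_j is the residue at s₁q^t with t = 2N_j + 2j - n - 1, where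
N_j counts the elements of S from j on. Its position and its monomial are both unchanged across i ∈
S. As N_{n+1} = 0, the surviving end lies at t = n + 1. -/
theorem IsDressing.sum_termCommutator_boxMono (h : IsDressing P (n := n) R c c' U) (hn : 1 ≤ n)
    (hα : ∀ u, ∃ k : ℤ, zExponent (algebra P n R) α R.W.inr u = k) (hc : c + c' = 1)
    (S : Finset ℕ) :
    ∑ i ∈ Finset.Icc 1 n with i ∉ S, (xiCoeff P n (insert i S) * (P.q ^ (2 * (i : ℤ) - 1) * P.s₁)) •
        termCommutator P R U α c c' (boxMono n i) (insert i S) +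
      (xiCoeff P n S * ((P.s₁ - P.s₁⁻¹) / (P.q - P.q⁻¹))) •
        termCommutator P R U α c c' (boxMonoMid n c c') S =
      (xiCoeff P n S * -(P.a * P.q * P.s₁)) •
        residue P R U α (n + 1) (monoShift 0 2 (xiMono n c c' S)) := by
  have h1 := sum_filter_add_smul n (fun i => i ∉ S) (xiCoeff P n S * (P.a * P.q * P.s₁))
    (fun i => (xiCoeff P n (insert i S) * (P.q ^ (2 * (i : ℤ) - 1) * P.s₁)) •
        termCommutator P R U α c c' (boxMono n i) (insert i S))
    (fun j => residue P R U α (2 * tailCount n S j + 2 * j - n - 1) (residueMono n c c' S j)) ?_ ?_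
  · rw [h.termCommutator_boxMonoMid_self hn hα hc, smul_smul, mul_assoc (xiCoeff P n S), mid_coeff,
      residueMono_one hn c c' hc]
    rw [residueMono_last hn c c' hc, tailCount_eq_zero (Nat.lt_succ_self n)] at h1
    have e1 : (2 * tailCount n S 1 + 2 * (1 : ℕ) - n - 1 : ℤ) = 2 * tailCount n S 1 - n + 1 := by
      push_cast
      ring
    have e2 : (2 * 0 + 2 * ((n + 1 : ℕ) : ℤ) - n - 1 : ℤ) = n + 1 := by
      push_cast
      ring
    rw [e1, e2, ← mul_neg] at h1
    exact h1
  · intro i hi hS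
    obtain ⟨hi1, hin⟩ := Finset.mem_Icc.1 hi
    have e : tailCount n S (i + 1) = tailCount n S i := by
      rw [tailCount_eq_add hin, bit, if_neg hS, zero_add]
    have e1 : (2 * (tailCount n S i + 1) - n + 2 * i - 3 : ℤ) =
        2 * tailCount n S i + 2 * i - n - 1 := by ring
    have e2 : (2 * (tailCount n S i + 1) - n + 2 * i - 1 : ℤ) =
        2 * tailCount n S i + 2 * i - n + 1 := by ring
    have e3 : (2 * tailCount n S i + 2 * ((i + 1 : ℕ) : ℤ) - n - 1 : ℤ) =
        2 * tailCount n S i + 2 * i - n + 1 := by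
      push_cast
      ring
    -- The powers of q depending on i cancel, leaving the same factor for all i.
    have e4 : xiCoeff P n (insert i S) * (P.q ^ (2 * (i : ℤ) - 1) * P.s₁) =
        -(xiCoeff P n S * (P.q * P.s₁)) := by
      have hq : P.q ^ (2 - 2 * (i : ℤ)) * P.q ^ (2 * (i : ℤ) - 1) = P.q := by
        rw [← zpow_add₀ (q_ne_zero P)]
        ring_nf
        exact zpow_one _
      rw [xiCoeff_insert P S hi1 hin hS]
      linear_combination -(xiCoeff P n S * P.s₁) * hq
    rw [h.termCommutator_boxMono hn hα hc _ i hi1 hin (Finset.mem_insert_self i S),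
      tailCount_insert S hS hin, if_pos le_rfl, e1, e2, residueMono_lower hn c c' hc S hi1 hin hS,
      residueMono_upper hn c c' hc S hi1 hin hS, e, e3, e4, smul_add, smul_smul, smul_smul]
    congr 2 <;> ring
  · intro i hi hS
    obtain ⟨hi1, hin⟩ := Finset.mem_Icc.1 hi
    have hS' : i ∈ S := not_not.1 hS
    have e : (2 * tailCount n S (i + 1) + 2 * ((i + 1 : ℕ) : ℤ) - n - 1 : ℤ) =
        2 * tailCount n S i + 2 * i - n - 1 := by
      rw [tailCount_eq_add hin, bit, if_pos hS']
      push_cast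
      ring
    simp only [e, residueMono_succ c c' hc S hi1 hin hS']

/-- The mirror image: M_{\bar i} has poles only against sets without i, so the terms are collected
by the larger set S. Here the positions are t = 2N_j - n - 1, unchanged across i ∉ S, and the
surviving end lies at t = -(n + 1). -/
theorem IsDressing.sum_termCommutator_boxMonoBar (h : IsDressing P (n := n) R c c' U) (hn : 1 ≤ n)
    (hα : ∀ u, ∃ k : ℤ, zExponent (algebra P n R) α R.W.inr u = k) (hc : c + c' = 1)
    (S : Finset ℕ) :
    ∑ i ∈ Finset.Icc 1 n with i ∈ S,
        (xiCoeff P n (S.erase i) * (P.q ^ (-2 * (i : ℤ) + 1) * P.s₁⁻¹)) •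
          termCommutator P R U α c c' (boxMonoBar n i) (S.erase i) +
      (xiCoeff P n S * ((P.s₁ - P.s₁⁻¹) / (P.q - P.q⁻¹))) •
        termCommutator P R U α c c' (boxMonoMid n c' c) S =
      (xiCoeff P n S * (P.a * P.s₃)) •
        residue P R U α (-(n + 1)) (monoShift 0 (-2) (xiMono n c c' S)) := by
  have h1 := sum_filter_add_smul n (fun i => i ∈ S) (-(xiCoeff P n S * (P.a * P.s₃)))
    (fun i => (xiCoeff P n (S.erase i) * (P.q ^ (-2 * (i : ℤ) + 1) * P.s₁⁻¹)) •
          termCommutator P R U α c c' (boxMonoBar n i) (S.erase i))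
    (fun j => residue P R U α (2 * tailCount n S j - n - 1) (residueMonoBar n c c' S j)) ?_ ?_
  · rw [h.termCommutator_boxMonoMid_swap hn hα hc, smul_smul, mul_assoc (xiCoeff P n S),
      mid_coeff_swap, residueMonoBar_one hn c c' hc]
    have e2 : (2 * 0 - n - 1 : ℤ) = -(n + 1) := by ring
    rw [residueMonoBar_last hn c c' hc, tailCount_eq_zero (Nat.lt_succ_self n), e2, neg_neg] at h1
    exact h1
  · intro i hi hS
    obtain ⟨hi1, hin⟩ := Finset.mem_Icc.1 hi
    obtain ⟨S, hS', rfl⟩ : ∃ Q, i ∉ Q ∧ S = insert i Q :=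
      ⟨S.erase i, Finset.notMem_erase _ _, (Finset.insert_erase hS).symm⟩
    have l1 := residueMonoBar_insert hn c c' hc S hi1 hin hS' (Or.inl rfl)
    have l2 := residueMonoBar_insert hn c c' hc S hi1 hin hS' (Or.inr rfl)
    rw [if_pos rfl] at l1
    rw [if_neg (Nat.succ_ne_self i), add_zero] at l2
    have e : tailCount n S (i + 1) = tailCount n S i := by
      rw [tailCount_eq_add hin, bit, if_neg hS', zero_add]
    have e1 : (2 * (tailCount n S i + 1) - n - 1 : ℤ) = 2 * tailCount n S i - n + 1 := by ring
    have e4 : xiCoeff P n S * (P.q ^ (-2 * (i : ℤ) + 1) * P.s₁⁻¹) =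
        -(xiCoeff P n (insert i S) * P.s₃) := by
      have hq : P.q ^ (2 - 2 * (i : ℤ)) = P.q ^ (-2 * (i : ℤ) + 1) * P.q := by
        rw [← zpow_add_one₀ (q_ne_zero P)]
        ring_nf
      rw [xiCoeff_insert P S hi1 hin hS', hq, Params.s₃, mul_inv]
      have := q_ne_zero P
      field_simp
    rw [e1] at l1
    rw [Finset.erase_insert hS', h.termCommutator_boxMonoBar hn hα hc _ i hi1 hin hS', l1, l2,
      tailCount_insert S hS' hin, tailCount_insert S hS' hin, if_pos le_rfl,
      if_neg (by omega), add_zero, e, e1, e4, smul_add, smul_smul, smul_smul, add_comm]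
    congr 2 <;> ring
  · intro i hi hS
    have hin := (Finset.mem_Icc.1 hi).2
    have e : tailCount n S (i + 1) = tailCount n S i := by
      rw [tailCount_eq_add hin, bit, if_neg hS, zero_add]
    simp only [e, residueMonoBar_succ S c c' hS]

theorem commutator_T_dress_xiCurrent :
    commutator ((T P n R).field (algebra P n R) α)
        ((dress n U (xiCurrent P n c c')).field (algebra P n R) α) =
      ∑ S ∈ (Finset.Icc 1 n).powerset,
        (∑ i ∈ Finset.Icc 1 n, (xiCoeff P n S * (P.q ^ (2 * (i : ℤ) - 1) * P.s₁)) •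
          termCommutator P R U α c c' (boxMono n i) S +
        (xiCoeff P n S * ((P.s₁ - P.s₁⁻¹) / (P.q - P.q⁻¹))) •
          termCommutator P R U α c c' (boxMonoMid n 1 0) S +
        (xiCoeff P n S * ((P.s₁ - P.s₁⁻¹) / (P.q - P.q⁻¹))) •
          termCommutator P R U α c c' (boxMonoMid n 0 1) S +
        ∑ i ∈ Finset.Icc 1 n, (xiCoeff P n S * (P.q ^ (-2 * (i : ℤ) + 1) * P.s₁⁻¹)) •
          termCommutator P R U α c c' (boxMonoBar n i) S) := by
  rw [T_eq, dress_xiCurrent, field_sum, commutator_sum_right]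
  refine Finset.sum_congr rfl fun S _ => ?_
  simp only [field_add, field_sum, field_single, commutator_add_left, commutator_sum_left,
    commutator_smul_smul]
  rfl

theorem IsDressing.commutator_eq (h : IsDressing P (n := n) R c c' U) (hn : 1 ≤ n)
    (hα : ∀ u, ∃ k : ℤ, zExponent (algebra P n R) α R.W.inr u = k) (hc : c + c' = 1) :
    commutator ((T P n R).field (algebra P n R) α)
        ((dress n U (xiCurrent P n c c')).field (algebra P n R) α) =
      (-(P.a * P.q * P.s₁)) • deltaTimes (poleLog P (n + 1))
        ((shifted n R (poleLog P (n + 1)) ((2 : ℤ) * P.l₂) U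
          (dress n U (xiCurrent P n c c'))).field (algebra P n R) α) +
      (P.a * P.s₃) • deltaTimes (poleLog P (-(n + 1)))
        ((shifted n R (poleLog P (-(n + 1))) ((-2 : ℤ) * P.l₂) U
          (dress n U (xiCurrent P n c c'))).field (algebra P n R) α) := by
  -- For `F` the two middle monomials exchange their roles, so their sum is rewritten in terms of c
  -- and c'.
  have hmid (S : Finset ℕ) (x : ℂ) :
      x • termCommutator P R U α c c' (boxMonoMid n 1 0) S +
        x • termCommutator P R U α c c' (boxMonoMid n 0 1) S =
      x • termCommutator P R U α c c' (boxMonoMid n c c') S +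
        x • termCommutator P R U α c c' (boxMonoMid n c' c) S := by
    rcases (by omega : c = 0 ∧ c' = 1 ∨ c = 1 ∧ c' = 0) with ⟨rfl, rfl⟩ | ⟨rfl, rfl⟩
    · exact add_comm _ _
    · rfl
  have hbox (S : Finset ℕ) : ∑ i ∈ Finset.Icc 1 n,
        (xiCoeff P n S * (P.q ^ (2 * (i : ℤ) - 1) * P.s₁)) •
          termCommutator P R U α c c' (boxMono n i) S =
      ∑ i ∈ Finset.Icc 1 n with i ∈ S, (xiCoeff P n S * (P.q ^ (2 * (i : ℤ) - 1) * P.s₁)) •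
          termCommutator P R U α c c' (boxMono n i) S := by
    rw [Finset.sum_filter]
    refine Finset.sum_congr rfl fun i hi => ?_
    obtain ⟨hi1, hin⟩ := Finset.mem_Icc.1 hi
    split_ifs with hS
    · rfl
    · rw [h.termCommutator_boxMono_eq_zero hn hα hc S i hi1 hin hS, smul_zero]
  have hbar (S : Finset ℕ) : ∑ i ∈ Finset.Icc 1 n,
        (xiCoeff P n S * (P.q ^ (-2 * (i : ℤ) + 1) * P.s₁⁻¹)) •
          termCommutator P R U α c c' (boxMonoBar n i) S =
      ∑ i ∈ Finset.Icc 1 n with i ∉ S, (xiCoeff P n S * (P.q ^ (-2 * (i : ℤ) + 1) * P.s₁⁻¹)) •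
          termCommutator P R U α c c' (boxMonoBar n i) S := by
    rw [Finset.sum_filter]
    refine Finset.sum_congr rfl fun i hi => ?_
    obtain ⟨hi1, hin⟩ := Finset.mem_Icc.1 hi
    split_ifs with hS
    · rw [h.termCommutator_boxMonoBar_eq_zero hn hα hc S i hi1 hin hS, smul_zero]
    · rfl
  rw [commutator_T_dress_xiCurrent, shifted_dress_xiCurrent, shifted_dress_xiCurrent, field_sum,
    field_sum, deltaTimes_sum, deltaTimes_sum, Finset.smul_sum, Finset.smul_sum]
  simp only [add_assoc _ (_ • termCommutator P R U α c c' (boxMonoMid n 1 0) _)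
    (_ • termCommutator P R U α c c' (boxMonoMid n 0 1) _), hmid, hbox, hbar, Finset.sum_add_distrib]
  -- The terms M_i are reindexed by the set without i, the terms M_{\bar i} by the set with i. Each
  -- family then shares its index S with the middle term that closes its telescoping sum.
  rw [sum_powerset_mem (Finset.Icc 1 n) fun i S =>
      (xiCoeff P n S * (P.q ^ (2 * (i : ℤ) - 1) * P.s₁)) •
        termCommutator P R U α c c' (boxMono n i) S,
    sum_powerset_notMem (Finset.Icc 1 n) fun i S =>
      (xiCoeff P n S * (P.q ^ (-2 * (i : ℤ) + 1) * P.s₁⁻¹)) •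
        termCommutator P R U α c c' (boxMonoBar n i) S,
    ← add_assoc, add_assoc (_ + _) (∑ S ∈ (Finset.Icc 1 n).powerset, _),
    add_comm (∑ S ∈ (Finset.Icc 1 n).powerset,
      _ • termCommutator P R U α c c' (boxMonoMid n c' c) S), ← Finset.sum_add_distrib,
    ← Finset.sum_add_distrib]
  refine congrArg₂ HAdd.hAdd (Finset.sum_congr rfl fun S _ => ?_)
    (Finset.sum_congr rfl fun S _ => ?_)
  · rw [h.sum_termCommutator_boxMono hn hα hc, field_single, deltaTimes_smul, smul_smul, mul_comm]
    rfl
  · rw [h.sum_termCommutator_boxMonoBar hn hα hc, field_single, deltaTimes_smul, smul_smul, mul_comm]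
    rfl

end MainTheorem

end Osp

end

theorem mainTheorem5 {A : Type*} [Fintype A] (P : Osp.Params) (n : ℕ) (hn : 1 ≤ n)
    (R : Osp.Auxiliary A) (hR : Osp.IsRationalization P n R)
    (α : Osp.Color n ⊕ A → ℂ)
    (hα : ∀ u : Osp.Color n ⊕ A → ℂ, ∃ m : ℤ,
      Osp.zExponent (Osp.algebra P n R) α R.W.inr u = m) :
    Osp.commutator
        ((Osp.T P n R).field (Osp.algebra P n R) α)
        ((Osp.E P n R).field (Osp.algebra P n R) α) =
      (-(P.a * P.q * P.s₁)) • Osp.deltaTimes ((n + 1) * P.l₂ + P.l₁)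
        ((Osp.shifted n R ((n + 1) * P.l₂ + P.l₁) (2 * P.l₂) R.Lam (Osp.E P n R)).field
          (Osp.algebra P n R) α) +
      (P.a * P.s₃) • Osp.deltaTimes (-(n + 1) * P.l₂ + P.l₁)
        ((Osp.shifted n R (-(n + 1) * P.l₂ + P.l₁) (-2 * P.l₂) R.Lam (Osp.E P n R)).field
          (Osp.algebra P n R) α) ∧
    Osp.commutator
        ((Osp.T P n R).field (Osp.algebra P n R) α)
        ((Osp.F P n R).field (Osp.algebra P n R) α) =
      (-(P.a * P.q * P.s₁)) • Osp.deltaTimes ((n + 1) * P.l₂ + P.l₁)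
        ((Osp.shifted n R ((n + 1) * P.l₂ + P.l₁) (2 * P.l₂) R.LamBar (Osp.F P n R)).field
          (Osp.algebra P n R) α) +
      (P.a * P.s₃) • Osp.deltaTimes (-(n + 1) * P.l₂ + P.l₁)
        ((Osp.shifted n R (-(n + 1) * P.l₂ + P.l₁) (-2 * P.l₂) R.LamBar (Osp.F P n R)).field
          (Osp.algebra P n R) α) := by
  have e1 : ((n : ℂ) + 1) * P.l₂ + P.l₁ = Osp.poleLog P (n + 1) := by
    rw [Osp.poleLog]
    push_cast
    ring
  have e2 : -((n : ℂ) + 1) * P.l₂ + P.l₁ = Osp.poleLog P (-(n + 1)) := by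
    rw [Osp.poleLog]
    push_cast
    ring
  have h1 := hR.isDressing_lam.commutator_eq hn hα rfl
  have h2 := hR.isDressing_lamBar.commutator_eq hn hα rfl
  rw [Int.cast_neg, Int.cast_ofNat] at h1 h2
  rw [e1, e2]
  exact ⟨h1, h2⟩
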